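/- Let $n\ge 1$. Let $\mathrm{Homeo}(\mathbb R^n,0)$ be the group of homeomorphisms of $\mathbb R^n$ fixing $0$, and for $0\le r\le\infty$ let $\mathcal G^r(n)$ be the group of germs at $0$ of orientation-preserving $C^r$ diffeomorphisms of $\mathbb R^n$ fixing $0$ (homeomorphisms if $r=0$); two maps have the same germ if they agree near $0$. A group $\Gamma$ of germs is *realizable by homeomorphisms* if there is a group homomorphism $\varphi:\Gamma\to\mathrm{Homeo}(\mathbb R^n,0)$ such that the germ of $\varphi(\gamma)$ is $\gamma$ for all $\gamma\in\Gamma$. For an increasing homeomorphism $h$ of $\mathbb R$ let $\hat h$ be the germ at $0$ of the radial homeomorphism $e^{t}s\mapsto e^{h(t)}s$ ($t\in\mathbb R$, $\|s\|=1$), $0\mapsto 0$. Let $BS(1,2)=\langle a,b\mid aba^{-1}=b^2\rangle$. **Theorem.** (1) There is a finitely generated, torsion-free subgroup $\Gamma\le\mathcal G^0(n)$ that is not realizable by homeomorphisms. It can be taken of the following form. Let $a(t)=2t$, $b(t)=t-1$ on $\mathbb R$, and $$X=\bigcup_{k\in\mathbb Z}(-7\cdot2^k,-4\cdot2^k),\qquad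 Y=\bigcup_{k\in\mathbb Z}[-6\cdot2^k,-5\cdot2^k].$$ There are increasing homeomorphisms $f_1,f_2,g_1,g_2$ of $\mathbb R$ such that $f_1$ is the identity off $X$ and agrees with $b$ on $Y$ in a neighbourhood of $-\infty$; $f_2=f_1^{-1}\circ b$; and, for $i=1,2$, $g_i$ commutes with $a$ in a neighbourhood of $-\infty$ and the support $\overline{\{t: g_i(t)\ne t\}}$ equals $\mathrm{Fix}(f_i)$; and $\Gamma=\langle\hat a,\hat b,\hat f_1,\hat f_2,\hat g_1,\hat g_2\rangle$. In $\Gamma$, the elements $\hat a,\hat b$ generate a copy of $BS(1,2)$ as its standard generators, $\hat f_1\hat f_2=\hat b$, and $[\hat g_i,\hat f_i]=[\hat g_i,\hat a]=1$ for $i=1,2$. (2) There is also such a group inside $\mathcal G^\infty(n)$: there are increasing homeomorphisms $a,b,f_1,f_2,g_1,g_2$ of $\mathbb R$ such that $\Gamma=\langle\hat a,\hat b,\hat f_1,\hat f_2,\hat g_1,\hat g_2\rangle$ is a finitely generated, torsion-free subgroup of $\mathcal G^\infty(n)$ that is not realizable by homeomorphisms, where $\hat a,\hat b$ generate a copy of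 $BS(1,2)$ as its standard generators, $\hat f_1\hat f_2=\hat b$, and $[\hat g_i,\hat f_i]=1$ for $i=1,2$. -/

import Mathlib

open Set Filter Topology
open scoped ContDiff

namespace GermSection

/-- Euclidean space `ℝⁿ`. -/
abbrev E (n : ℕ) : Type := EuclideanSpace ℝ (Fin n)

/-- `Homeo(ℝⁿ, 0)`: the group (under composition) of homeomorphisms of `ℝⁿ` fixing `0`. -/
def HomeoFix (n : ℕ) : Subgroup (E n ≃ₜ E n) where
  carrier := {f | f 0 = 0}
  mul_mem' := by
    intro f g hf hg
    simp only [mem_ofPred_eq, Homeomorph.mul_apply] at *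
    rw [hg, hf]
  one_mem' := rfl
  inv_mem' := by
    intro f hf
    simp only [mem_ofPred_eq] at *
    change f.symm 0 = 0
    rw [Homeomorph.symm_apply_eq, hf]

/-- The homeomorphisms that restrict to the identity on a neighbourhood of `0`. -/
def trivialGerm (n : ℕ) : Subgroup (HomeoFix n) where
  carrier := {f | ∀ᶠ x in 𝓝 (0 : E n), f.1 x = x}
  mul_mem' := by
    intro f g hf hg
    simp only [mem_ofPred_eq] at *
    filter_upwards [hf, hg] with x h1 h2
    change f.1 (g.1 x) = x
    rw [h2, h1]
  one_mem' := Eventually.of_forall fun _ => rfl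
  inv_mem' := by
    intro f hf
    simp only [mem_ofPred_eq] at *
    filter_upwards [hf] with x h1
    change f.1.symm x = x
    rw [Homeomorph.symm_apply_eq, h1]

instance trivialGerm_normal (n : ℕ) : (trivialGerm n).Normal where
  conj_mem := by
    intro f hf g
    have hg0 : g.1.symm 0 = 0 := by
      rw [Homeomorph.symm_apply_eq]; exact (g.2 : g.1 0 = 0).symm
    have ht : Tendsto g.1.symm (𝓝 (0 : E n)) (𝓝 0) := by
      have := g.1.symm.continuous.tendsto (0 : E n)
      rwa [hg0] at this
    have hf' : ∀ᶠ x in 𝓝 (0 : E n), f.1 x = x := hf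
    change ∀ᶠ x in 𝓝 (0 : E n), g.1 (f.1 (g.1.symm x)) = x
    filter_upwards [ht.eventually hf'] with x hx
    rw [hx, Homeomorph.apply_symm_apply]

/-- The group of germs at `0` of homeomorphisms of `ℝⁿ` fixing `0`
(not necessarily orientation-preserving). -/
abbrev HomeoGerm (n : ℕ) : Type := HomeoFix n ⧸ trivialGerm n

/-- The natural surjection from `Homeo(ℝⁿ, 0)` to germs. -/
def germ (n : ℕ) : HomeoFix n →* HomeoGerm n := QuotientGroup.mk' (trivialGerm n)

/-- `Diff^r(ℝⁿ, 0)`: the `C^r` diffeomorphisms of `ℝⁿ` fixing `0`; for `r = 0` these are all the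
homeomorphisms fixing `0`. -/
def DiffFix (r : WithTop ℕ∞) (n : ℕ) : Subgroup (HomeoFix n) where
  carrier := {f | ContDiff ℝ r f.1 ∧ ContDiff ℝ r f.1.symm}
  mul_mem' := by
    rintro f g ⟨hf, hf'⟩ ⟨hg, hg'⟩
    exact ⟨hf.comp hg, hg'.comp hf'⟩
  one_mem' := ⟨contDiff_id, contDiff_id⟩
  inv_mem' := by
    rintro f ⟨hf, hf'⟩
    exact ⟨hf', hf⟩

/-- The self-map of `ℝⁿ ∖ {0}` induced by a homeomorphism fixing `0`. -/
def punctured {n : ℕ} (f : HomeoFix n) : C({x : E n // x ≠ 0}, {x : E n // x ≠ 0}) where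
  toFun x := ⟨f.1 x.1, fun h => x.2 (f.1.injective (h.trans (f.2 : f.1 0 = 0).symm))⟩
  continuous_toFun := by
    have := f.1.continuous
    fun_prop

/-- The orientation-preserving homeomorphisms of `ℝⁿ` fixing `0`: those for which the induced
self-map of `ℝⁿ ∖ {0} ≃ Sⁿ⁻¹` is homotopic to the identity. A homeomorphism induces a self homotopy
equivalence of `Sⁿ⁻¹`, of degree `1` or `-1`, and degree `1` means homotopic to the identity. -/
def OrientationPreserving (n : ℕ) : Subgroup (HomeoFix n) where
  carrier := {f | (punctured f).Homotopic (ContinuousMap.id _)}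
  mul_mem' := by
    intro f g hf hg
    exact hf.comp hg
  one_mem' := ContinuousMap.Homotopic.refl _
  inv_mem' := by
    intro f hf
    simp only [mem_ofPred_eq] at *
    have h := (ContinuousMap.Homotopic.refl (punctured f⁻¹)).comp hf
    have e : (punctured f⁻¹).comp (punctured f) = ContinuousMap.id _ := by
      ext1 x
      apply Subtype.ext
      exact f.1.symm_apply_apply x.1
    rw [e] at h
    exact h.symm

/-- `𝒢^r(n)`: the group of germs at `0` of orientation-preserving `C^r` diffeomorphisms of `ℝⁿ`
fixing `0`. -/
def G (r : WithTop ℕ∞) (n : ℕ) : Subgroup (HomeoGerm n) :=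
  (DiffFix r n ⊓ OrientationPreserving n).map (germ n)

/-- A group of germs is realizable by homeomorphisms if the germ map from `Homeo(ℝⁿ, 0)` has a
section over it that is a group homomorphism. -/
def IsRealizable {n : ℕ} (Γ : Subgroup (HomeoGerm n)) : Prop :=
  ∃ φ : Γ →* HomeoFix n, ∀ γ : Γ, germ n (φ γ) = γ

/-- The formula of a radial map. In polar coordinates `x = exp t • s` with `‖s‖ = 1` it
is `(s, t) ↦ (s, h t)`, extended by `0 ↦ 0`. -/
noncomputable def radialFun {n : ℕ} (h : ℝ → ℝ) (x : E n) : E n :=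
  (Real.exp (h (Real.log ‖x‖)) / ‖x‖) • x

theorem radialFun_zero {n : ℕ} (h : ℝ → ℝ) : radialFun h (0 : E n) = 0 := by
  simp [radialFun]

theorem norm_radialFun {n : ℕ} (h : ℝ → ℝ) {x : E n} (hx : x ≠ 0) :
    ‖radialFun h x‖ = Real.exp (h (Real.log ‖x‖)) := by
  have hx' : ‖x‖ ≠ 0 := norm_ne_zero_iff.mpr hx
  rw [radialFun, norm_smul, Real.norm_eq_abs, abs_of_nonneg (by positivity)]
  field_simp

theorem radialFun_radialFun {n : ℕ} (h k : ℝ → ℝ) (hk : ∀ t, k (h t) = t) (x : E n) :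
    radialFun k (radialFun h x) = x := by
  by_cases hx : x = 0
  · simp [hx, radialFun_zero]
  have hx' : ‖x‖ ≠ 0 := norm_ne_zero_iff.mpr hx
  have hp : 0 < ‖x‖ := norm_pos_iff.mpr hx
  have e : radialFun k (radialFun h x)
      = (Real.exp (k (Real.log ‖radialFun h x‖)) / ‖radialFun h x‖) • radialFun h x := rfl
  rw [e, norm_radialFun h hx, Real.log_exp, hk, Real.exp_log hp, radialFun, smul_smul]
  have : ‖x‖ / Real.exp (h (Real.log ‖x‖)) * (Real.exp (h (Real.log ‖x‖)) / ‖x‖) = 1 := by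
    field_simp
  rw [this, one_smul]

theorem continuous_radialFun {n : ℕ} (h : ℝ ≃o ℝ) : Continuous (radialFun (n := n) h) := by
  rw [continuous_iff_continuousAt]
  intro x
  by_cases hx : x = 0
  · subst hx
    rw [ContinuousAt, radialFun_zero, tendsto_zero_iff_norm_tendsto_zero,
      ← nhdsNE_sup_pure, tendsto_sup]
    constructor
    · have h1 : Tendsto (fun x : E n => ‖x‖) (𝓝[≠] 0) (𝓝[>] 0) := tendsto_norm_nhdsNE_zero
      have h2 := Real.tendsto_exp_atBot.comp
        (h.tendsto_atBot.comp (Real.tendsto_log_nhdsGT_zero.comp h1))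
      refine h2.congr' ?_
      filter_upwards [self_mem_nhdsWithin] with y hy
      exact (norm_radialFun h hy).symm
    · rw [tendsto_pure_left]
      intro s hs
      simpa [radialFun_zero] using mem_of_mem_nhds hs
  · have hx' : ‖x‖ ≠ 0 := norm_ne_zero_iff.mpr hx
    have hc : Continuous h := h.continuous
    have hl : ContinuousAt (fun y : E n => Real.log ‖y‖) x :=
      continuous_norm.continuousAt.log hx'
    have h1 : ContinuousAt (fun y : E n => Real.exp (h (Real.log ‖y‖))) x :=
      Real.continuous_exp.continuousAt.comp (hc.continuousAt.comp hl)
    exact (h1.div continuous_norm.continuousAt hx').smul continuousAt_id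

/-- The radial homeomorphism `(s, t) ↦ (s, h t)` of `ℝⁿ` fixing `0`, for an increasing
homeomorphism `h` of `ℝ`. -/
noncomputable def radial (n : ℕ) (h : ℝ ≃o ℝ) : HomeoFix n :=
  ⟨{ toFun := radialFun h
     invFun := radialFun h.symm
     left_inv := radialFun_radialFun h h.symm h.symm_apply_apply
     right_inv := radialFun_radialFun h.symm h h.apply_symm_apply
     continuous_toFun := continuous_radialFun h
     continuous_invFun := continuous_radialFun h.symm }, radialFun_zero h⟩

/-- The defining relation `a bᵐ a⁻¹ = bᵏ` of the Baumslag–Solitar group `BS(m, k)`; here `a` is the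
generator `true` and `b` is the generator `false`. -/
def bsRels (m k : ℤ) : Set (FreeGroup Bool) :=
  {FreeGroup.of true * FreeGroup.of false ^ m * (FreeGroup.of true)⁻¹ *
    (FreeGroup.of false ^ k)⁻¹}

/-- The Baumslag–Solitar group `BS(m, k) = ⟨a, b ∣ a bᵐ a⁻¹ = bᵏ⟩`. -/
abbrev BS (m k : ℤ) : Type := PresentedGroup (bsRels m k)

/-- `a` and `b` generate a copy of `BS(m, k)`, as its standard generators. -/
def GenerateBS {H : Type*} [Group H] (m k : ℤ) (a b : H) : Prop :=
  ∃ j : BS m k →* H, Function.Injective j ∧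
    j (PresentedGroup.of true) = a ∧ j (PresentedGroup.of false) = b

/-- Every element of finite order is trivial. -/
def TorsionFree {H : Type*} [Group H] (Γ : Subgroup H) : Prop :=
  ∀ γ ∈ Γ, IsOfFinOrder γ → γ = 1

/-- A disjoint union of open intervals in `(-∞, 0)`, invariant under `t ↦ 2 t`. -/
def X : Set ℝ := ⋃ k : ℤ, Ioo (-7 * (2 : ℝ) ^ k) (-4 * (2 : ℝ) ^ k)

/-- A disjoint union of closed intervals, invariant under `t ↦ 2 t` and contained in `X`. -/
def Y : Set ℝ := ⋃ k : ℤ, Icc (-6 * (2 : ℝ) ^ k) (-5 * (2 : ℝ) ^ k)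

/-- The choices made on the line, from which the group of germs is built. -/
structure LineData (a b f₁ f₂ g₁ g₂ : ℝ ≃o ℝ) : Prop where
  a_eq : ∀ t, a t = 2 * t
  b_eq : ∀ t, b t = t - 1
  /-- `f₁` is supported on `X` -/
  f₁_supp : ∀ t, t ∉ X → f₁ t = t
  /-- `f₁` agrees with `b` on `Y` near `-∞` -/
  f₁_eq_b : ∀ᶠ t in atBot, t ∈ Y → f₁ t = b t
  /-- `f₂ = f₁⁻¹ ∘ b` -/
  f₂_eq : ∀ t, f₂ t = f₁.symm (b t)
  g₁_comm : ∀ᶠ t in atBot, g₁ (a t) = a (g₁ t)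
  g₂_comm : ∀ᶠ t in atBot, g₂ (a t) = a (g₂ t)
  /-- the support of `gᵢ` is the fixed point set of `fᵢ` -/
  g₁_supp : closure {t | g₁ t ≠ t} = {t | f₁ t = t}
  g₂_supp : closure {t | g₂ t ≠ t} = {t | f₂ t = t}

/-- The germ at `0` of the radial homeomorphism of `ℝⁿ` with profile `h`. -/
noncomputable def rgerm (n : ℕ) (h : ℝ ≃o ℝ) : HomeoGerm n := germ n (radial n h)

/-- The group of germs generated by the six radial germs with the given profiles. -/
noncomputable def radialGroup (n : ℕ) (a b f₁ f₂ g₁ g₂ : ℝ ≃o ℝ) : Subgroup (HomeoGerm n) :=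
  Subgroup.closure {rgerm n a, rgerm n b, rgerm n f₁, rgerm n f₂, rgerm n g₁, rgerm n g₂}

end GermSection

open GermSection

/-! Write t = log ‖x‖: the origin is at t = -∞, the unit ball is t < 0, and radial maps act through
t. The obstruction is that a realization must continue the germ picture outwards by self-similarity,
up to scales where the unit translation `shift` is too large.

Suppose lifts A, B, F₁, F₂, G₁, G₂ satisfy the relations of the germs. Conjugating by B⁻ᵐSᵐ, which
has trivial germ, makes B the radial shift S on the whole unit ball (`exists_conj_standard`); the
relation of BS(1,2) then makes A the radial doubling there (`dilation_eq_on_ball`). The relation A G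
= G^c A carries the set of points moved by G from near 0 to the whole ball, where it becomes a union
of concentric shells invariant under t ↦ 2t (`moved_iff_mem_shells`). As Fᵢ commutes with Gᵢ, it
respects the set moved by Gᵢ. It is the identity on the shells near 0, and a connectedness argument
along rays, working outwards shell by shell, shows that it maps every shell to itself
(`preserves_shell`) and cannot carry the gaps between shells far (`preserves_gap`). Near t = 0
shells and gaps are shorter than 1, so the product F₁F₂ cannot move a point by 1 in t, whereas B
does. This is `no_lift_of_standard_translation`.

In the topological case the gᵢ commute with a, so c = 1, and the profiles are t - ψ(t) with ψ a
Lipschitz function built from distances to X and Y. In the smooth case all profiles are conjugated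
by a coordinate equal to -exp(1/‖x‖²) near 0. With q = ‖x‖², a map t ↦ t(1 + J(q)) becomes q ↦ q /
(1 + q log(1 + J(q))), which is radially smooth at 0 as soon as J is smooth and 1 + J(0) > 0. A
nontrivial profile commuting with doubling would make J oscillate as q → 0; the relation a g a⁻¹ =
g², so c = 2, instead allows displacements that stay bounded. These correspond to J(q) =
N(exp(-1/q), 1/q) with N periodic in the second variable and zero when the first is 0, and such J
are flat at 0 (`FlatPeriodic.contDiff_flatFun`). The required g is, on each shell, a rescaled
time-2⁻ᵏ map of one smooth flow. -/

namespace GermSection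

/-! ### Radial germs and their profiles; torsion-freeness -/

section Germs

variable {n : ℕ}

theorem germ_eq_iff {f g : HomeoFix n} :
    germ n f = germ n g ↔ ∀ᶠ x in 𝓝 (0 : E n), f.1 x = g.1 x := by
  change (f : HomeoFix n ⧸ trivialGerm n) = (g : HomeoFix n ⧸ trivialGerm n) ↔ _
  rw [QuotientGroup.eq]
  change (∀ᶠ x in 𝓝 (0 : E n), f.1.symm (g.1 x) = x) ↔ _
  refine eventually_congr (Eventually.of_forall fun x => ?_)
  rw [Homeomorph.symm_apply_eq, eq_comm]

theorem HomeoFix.ext {f g : HomeoFix n} (h : ∀ x, f.1 x = g.1 x) : f = g :=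
  Subtype.ext (Homeomorph.ext h)

theorem HomeoFix.map_zero (f : HomeoFix n) : f.1 0 = 0 := f.2

theorem HomeoFix.map_ne_zero (f : HomeoFix n) {x : E n} (hx : x ≠ 0) : f.1 x ≠ 0 := fun h =>
  hx (f.1.injective (h.trans (HomeoFix.map_zero f).symm))

theorem HomeoFix.mul_apply (f g : HomeoFix n) (x : E n) : (f * g).1 x = f.1 (g.1 x) := rfl

theorem HomeoFix.one_apply (x : E n) : (1 : HomeoFix n).1 x = x := rfl

theorem HomeoFix.inv_apply_self (f : HomeoFix n) (x : E n) : (f⁻¹).1 (f.1 x) = x :=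
  f.1.symm_apply_apply x

theorem HomeoFix.pow_apply (f : HomeoFix n) (k : ℕ) (x : E n) : (f ^ k).1 x = f.1^[k] x := by
  induction k with
  | zero => rfl
  | succ k ih => rw [pow_succ', HomeoFix.mul_apply, ih, Function.iterate_succ_apply']

theorem radial_apply (h : ℝ ≃o ℝ) (x : E n) : (radial n h).1 x = radialFun h x := rfl

theorem log_norm_radial (h : ℝ ≃o ℝ) {x : E n} (hx : x ≠ 0) :
    Real.log ‖(radial n h).1 x‖ = h (Real.log ‖x‖) := by
  rw [radial_apply, norm_radialFun h hx, Real.log_exp]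

theorem radialFun_comp (h k : ℝ → ℝ) (x : E n) :
    radialFun h (radialFun k x) = radialFun (h ∘ k) x := by
  by_cases hx : x = 0
  · simp [hx, radialFun_zero]
  have hx' : ‖x‖ ≠ 0 := norm_ne_zero_iff.mpr hx
  rw [radialFun, norm_radialFun k hx, Real.log_exp, radialFun, radialFun, smul_smul,
    Function.comp_apply]
  congr 1
  field_simp

/-- Extension of profiles to radial homeomorphisms, as a group homomorphism. -/
noncomputable def radialHom (n : ℕ) : (ℝ ≃o ℝ) →* HomeoFix n where
  toFun := radial n
  map_one' := by
    refine HomeoFix.ext fun x => ?_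
    rw [radial_apply, HomeoFix.one_apply]
    by_cases hx : x = 0
    · simp [hx, radialFun_zero]
    · have hp : 0 < ‖x‖ := norm_pos_iff.mpr hx
      simp [radialFun, Real.exp_log hp, hp.ne']
  map_mul' h k := by
    refine HomeoFix.ext fun x => ?_
    rw [HomeoFix.mul_apply, radial_apply, radial_apply, radial_apply, radialFun_comp]
    rfl

/-- The germ of a radial homeomorphism, as a group homomorphism. -/
noncomputable def rgermHom (n : ℕ) : (ℝ ≃o ℝ) →* HomeoGerm n := (germ n).comp (radialHom n)

theorem rgermHom_apply (h : ℝ ≃o ℝ) : rgermHom n h = rgerm n h := rfl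

theorem rgerm_mul (h k : ℝ ≃o ℝ) : rgerm n (h * k) = rgerm n h * rgerm n k :=
  (rgermHom n).map_mul h k

theorem eventually_log_norm {p : ℝ → Prop} (hp : ∀ᶠ t in atBot, p t) :
    ∀ᶠ x in 𝓝 (0 : E n), x ≠ 0 → p (Real.log ‖x‖) := by
  have h1 : Tendsto (fun x : E n => ‖x‖) (𝓝[≠] 0) (𝓝[>] 0) := tendsto_norm_nhdsNE_zero
  have h2 := (Real.tendsto_log_nhdsGT_zero.comp h1).eventually hp
  rwa [eventually_nhdsWithin_iff] at h2

theorem exists_log_norm_eq (hn : 1 ≤ n) (t : ℝ) : ∃ x : E n, x ≠ 0 ∧ Real.log ‖x‖ = t := by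
  refine ⟨EuclideanSpace.single ⟨0, hn⟩ (Real.exp t), ?_, ?_⟩
  · rw [← norm_ne_zero_iff]
    simp
  · simp

theorem eventually_atBot_of_germ (hn : 1 ≤ n) {p : ℝ → Prop}
    (h : ∀ᶠ x in 𝓝 (0 : E n), x ≠ 0 → p (Real.log ‖x‖)) : ∀ᶠ t in atBot, p t := by
  obtain ⟨ε, hε, hb⟩ := Metric.eventually_nhds_iff.mp h
  filter_upwards [eventually_lt_atBot (Real.log ε)] with t ht
  obtain ⟨x, hx, rfl⟩ := exists_log_norm_eq hn t
  refine hb ?_ hx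
  rw [dist_zero_right]
  exact (Real.log_lt_log_iff (norm_pos_iff.mpr hx) hε).mp ht

theorem rgerm_eq_of_eventuallyEq {h k : ℝ ≃o ℝ} (e : ∀ᶠ t in atBot, h t = k t) :
    rgerm n h = rgerm n k := by
  refine germ_eq_iff.mpr ?_
  filter_upwards [eventually_log_norm e] with x hx
  by_cases h0 : x = 0
  · rw [h0, HomeoFix.map_zero, HomeoFix.map_zero]
  · rw [radial_apply, radial_apply, radialFun, radialFun, hx h0]

theorem eventuallyEq_of_rgerm_eq (hn : 1 ≤ n) {h k : ℝ ≃o ℝ} (e : rgerm n h = rgerm n k) :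
    ∀ᶠ t in atBot, h t = k t := by
  refine eventually_atBot_of_germ hn ?_
  filter_upwards [germ_eq_iff.mp e] with x hx h0
  rw [← log_norm_radial h h0, ← log_norm_radial k h0, hx]

theorem radialGroup_le_range (a b f₁ f₂ g₁ g₂ : ℝ ≃o ℝ) :
    radialGroup n a b f₁ f₂ g₁ g₂ ≤ (rgermHom n).range := by
  refine (Subgroup.closure_le _).mpr ?_
  rintro x (rfl | rfl | rfl | rfl | rfl | rfl) <;> exact ⟨_, rfl⟩

theorem radialGroup_fg (a b f₁ f₂ g₁ g₂ : ℝ ≃o ℝ) : (radialGroup n a b f₁ f₂ g₁ g₂).FG := by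
  rw [Subgroup.fg_iff]
  exact ⟨_, rfl, Set.toFinite _⟩

theorem iterate_lt_self {h : ℝ → ℝ} (hm : StrictMono h) {t : ℝ} (ht : h t < t) :
    ∀ {k : ℕ}, k ≠ 0 → h^[k] t < t := by
  intro k
  induction k with
  | zero => simp
  | succ k ih =>
    intro _
    rw [Function.iterate_succ_apply']
    rcases eq_or_ne k 0 with rfl | hk
    · exact ht
    · exact (hm (ih hk)).trans ht

theorem coe_pow_orderIso (h : ℝ ≃o ℝ) (k : ℕ) (t : ℝ) : (h ^ k) t = h^[k] t := by
  induction k with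
  | zero => rfl
  | succ k ih => rw [pow_succ', RelIso.mul_apply, ih, Function.iterate_succ_apply']

/-- Iterates of an increasing map move a non-fixed point strictly in one direction; the upward case
is the downward one for the inverse. -/
theorem eq_of_iterate_eq (h : ℝ ≃o ℝ) {k : ℕ} (hk : k ≠ 0) {t : ℝ} (ht : h^[k] t = t) :
    h t = t := by
  rcases lt_trichotomy (h t) t with hlt | he | hgt
  · exact absurd ht (iterate_lt_self h.strictMono hlt hk).ne
  · exact he
  · have h1 : h.symm t < t := by rw [OrderIso.symm_apply_lt]; exact hgt
    have h2 := iterate_lt_self h.symm.strictMono h1 hk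
    have h3 : h.symm^[k] t = t := by
      conv_lhs => rw [← ht]
      exact (Function.LeftInverse.iterate h.symm_apply_apply k) t
    exact absurd h3 h2.ne

/-- Every element of the group is the germ of a single radial map, so its order can be read off the
profile near -∞, where periodic points are fixed points. -/
theorem torsionFree_radialGroup (hn : 1 ≤ n) (a b f₁ f₂ g₁ g₂ : ℝ ≃o ℝ) :
    TorsionFree (radialGroup n a b f₁ f₂ g₁ g₂) := by
  intro γ hγ ho
  obtain ⟨h, rfl⟩ := radialGroup_le_range a b f₁ f₂ g₁ g₂ hγ
  obtain ⟨k, hk, hk1⟩ := isOfFinOrder_iff_pow_eq_one.mp ho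
  rw [← map_pow, ← map_one (rgermHom n)] at hk1
  have e := eventuallyEq_of_rgerm_eq hn hk1
  rw [← map_one (rgermHom n)]
  refine rgerm_eq_of_eventuallyEq ?_
  filter_upwards [e] with t ht
  rw [coe_pow_orderIso] at ht
  exact eq_of_iterate_eq h hk.ne' ht

/-- Radial homeomorphisms are isotopic to the identity through radial homeomorphisms. -/
theorem radial_mem_orientationPreserving (h : ℝ ≃o ℝ) :
    radial n h ∈ OrientationPreserving n := by
  have hc : Continuous h := h.continuous
  have key : Continuous fun p : unitInterval × {x : E n // x ≠ 0} =>
      (Real.exp ((1 - (p.1 : ℝ)) * h (Real.log ‖p.2.1‖) + p.1 * Real.log ‖p.2.1‖) / ‖p.2.1‖) •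
        p.2.1 := by
    have h0 : ∀ p : unitInterval × {x : E n // x ≠ 0}, ‖p.2.1‖ ≠ 0 := fun p =>
      norm_ne_zero_iff.mpr p.2.2
    have hl : Continuous fun p : unitInterval × {x : E n // x ≠ 0} => Real.log ‖p.2.1‖ :=
      Continuous.log (by fun_prop) h0
    refine Continuous.smul (Continuous.div ?_ (by fun_prop) h0) (by fun_prop)
    fun_prop
  have hne : ∀ p : unitInterval × {x : E n // x ≠ 0},
      (Real.exp ((1 - (p.1 : ℝ)) * h (Real.log ‖p.2.1‖) + p.1 * Real.log ‖p.2.1‖) / ‖p.2.1‖) •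
        p.2.1 ≠ 0 := by
    intro p
    have := norm_pos_iff.mpr p.2.2
    exact smul_ne_zero (by positivity) p.2.2
  refine ⟨{ toFun := fun p => ⟨(Real.exp ((1 - (p.1 : ℝ)) * h (Real.log ‖p.2.1‖) +
              p.1 * Real.log ‖p.2.1‖) / ‖p.2.1‖) • p.2.1, hne p⟩
            continuous_toFun := key.subtype_mk hne
            map_zero_left := ?_
            map_one_left := ?_ }⟩
  · intro x
    apply Subtype.ext
    simp [punctured, radial_apply, radialFun]
  · intro x
    apply Subtype.ext
    have hp : 0 < ‖x.1‖ := norm_pos_iff.mpr x.2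
    simp [Real.exp_log hp, hp.ne']

end Germs

/-! ### Normal forms in BS(1,2) -/

section BaumslagSolitar

variable {H : Type*} [Group H]

theorem pow_mul_zpow_of_conj {a b : H} (h : a * b * a⁻¹ = b ^ 2) (i : ℕ) (m : ℤ) :
    a ^ i * b ^ m = b ^ ((2 : ℤ) ^ i * m) * a ^ i := by
  induction i generalizing m with
  | zero => simp
  | succ i ih =>
    have h1 : a * b ^ m = b ^ (2 * m) * a := by
      have : a * b ^ m * a⁻¹ = b ^ (2 * m) := by
        rw [← conj_zpow, h, zpow_mul, zpow_ofNat]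
      rw [← this]; group
    rw [pow_succ, mul_assoc, h1, ← mul_assoc, ih, mul_assoc]
    congr 2
    ring

/-- The set of such products is stable under left multiplication by the generators and their
inverses: `b ^ e` passes `(a ^ i)⁻¹` at the price of multiplying the exponent by `2 ^ i`. -/
theorem exists_normalForm {a b : H} (h : a * b * a⁻¹ = b ^ 2) {x : H}
    (hx : x ∈ Subgroup.closure {a, b}) :
    ∃ (i l : ℕ) (m : ℤ), x = (a ^ i)⁻¹ * b ^ m * a ^ l := by
  have hb : ∀ (i l : ℕ) (m e : ℤ), b ^ e * ((a ^ i)⁻¹ * b ^ m * a ^ l) =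
      (a ^ i)⁻¹ * b ^ ((2 : ℤ) ^ i * e + m) * a ^ l := by
    intro i l m e
    have := pow_mul_zpow_of_conj h i e
    rw [zpow_add, ← mul_assoc, ← mul_assoc, ← mul_assoc]
    congr 2
    rw [eq_inv_mul_iff_mul_eq, ← mul_assoc, this, mul_inv_cancel_right]
  induction hx using Subgroup.closure_induction_left with
  | one => exact ⟨0, 0, 0, by simp⟩
  | mul_left x hx y _ ih =>
    obtain ⟨i, l, m, rfl⟩ := ih
    rcases hx with rfl | rfl
    · rcases i with _ | i
      · refine ⟨0, l + 1, 2 * m, ?_⟩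
        have := pow_mul_zpow_of_conj h 1 m
        simp only [pow_one] at this
        rw [pow_zero, inv_one, one_mul, one_mul, ← mul_assoc, this, pow_succ', mul_assoc]
      · refine ⟨i, l, m, ?_⟩
        rw [pow_succ]
        group
    · exact ⟨i, l, _, by rw [← hb i l m 1, zpow_one]⟩
  | inv_mul_cancel x hx y _ ih =>
    obtain ⟨i, l, m, rfl⟩ := ih
    rcases hx with rfl | rfl
    · refine ⟨i + 1, l, m, ?_⟩
      rw [pow_succ]
      group
    · exact ⟨i, l, _, by rw [← hb i l m (-1), zpow_neg_one]⟩

theorem BS_relation : (PresentedGroup.of true : BS 1 2) * PresentedGroup.of false *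
    (PresentedGroup.of true)⁻¹ = PresentedGroup.of false ^ 2 := by
  have h : PresentedGroup.mk (bsRels 1 2) (FreeGroup.of true * FreeGroup.of false ^ (1 : ℤ) *
      (FreeGroup.of true)⁻¹ * (FreeGroup.of false ^ (2 : ℤ))⁻¹) = 1 :=
    PresentedGroup.one_of_mem rfl
  simp only [map_mul, map_inv, map_zpow, zpow_one] at h
  exact mul_inv_eq_one.mp h

/-- A pair satisfying the relation of `BS(1, 2)` generates a copy of `BS(1, 2)` as soon as
`a⁻ⁱ bᵐ aˡ = 1` only for `i = l`, `m = 0`. -/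
theorem generateBS_of_normalForm {a b : H} (h : a * b * a⁻¹ = b ^ 2)
    (hf : ∀ (i l : ℕ) (m : ℤ), (a ^ i)⁻¹ * b ^ m * a ^ l = 1 → i = l ∧ m = 0) :
    GenerateBS 1 2 a b := by
  let v : Bool → H := fun c => if c then a else b
  have hv : ∀ r ∈ bsRels 1 2, FreeGroup.lift v r = 1 := by
    rintro r rfl
    simp only [map_mul, map_inv, map_zpow, FreeGroup.lift_apply_of, v, zpow_one]
    simp only [if_true, Bool.false_eq_true, if_false]
    rw [mul_inv_eq_one, h, zpow_ofNat]
  refine ⟨PresentedGroup.toGroup hv, ?_, ?_, ?_⟩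
  · rw [injective_iff_map_eq_one]
    intro x hx
    have hcl : x ∈ Subgroup.closure {(PresentedGroup.of true : BS 1 2), PresentedGroup.of false} := by
      have : ({(PresentedGroup.of true : BS 1 2), PresentedGroup.of false} : Set (BS 1 2)) =
          Set.range PresentedGroup.of := by
        ext y; simp only [mem_insert_iff, mem_singleton_iff, mem_range, Bool.exists_bool]; tauto
      rw [this, PresentedGroup.closure_range_of]
      trivial
    obtain ⟨i, l, m, rfl⟩ := exists_normalForm BS_relation hcl
    simp only [map_mul, map_inv, map_zpow, map_pow, PresentedGroup.toGroup.of, v] at hx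
    obtain ⟨rfl, rfl⟩ := hf i l m hx
    simp
  · simp [PresentedGroup.toGroup.of, v]
  · simp [PresentedGroup.toGroup.of, v]

theorem GenerateBS.map {K : Type*} [Group K] {m k : ℤ} {a b : H} (h : GenerateBS m k a b)
    (f : H →* K) (hf : Function.Injective f) : GenerateBS m k (f a) (f b) := by
  obtain ⟨j, hj, rfl, rfl⟩ := h
  exact ⟨f.comp j, hf.comp hj, rfl, rfl⟩

end BaumslagSolitar

/-- Doubling of the line. -/
noncomputable def dbl : ℝ ≃o ℝ := OrderIso.mulLeft₀ (2 : ℝ) two_pos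

/-- Translation of the line by `-1`. -/
noncomputable def shift : ℝ ≃o ℝ := OrderIso.addRight (-1 : ℝ)

theorem dbl_apply (t : ℝ) : dbl t = 2 * t := rfl

theorem shift_apply (t : ℝ) : shift t = t - 1 := (sub_eq_add_neg t 1).symm

theorem dbl_mul_shift : dbl * shift * dbl⁻¹ = shift ^ 2 := by
  rw [mul_inv_eq_iff_eq_mul]
  ext t
  simp only [RelIso.mul_apply, dbl_apply, shift_apply, pow_two]
  ring

theorem dbl_pow_apply (k : ℕ) (t : ℝ) : (dbl ^ k) t = 2 ^ k * t := by
  induction k with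
  | zero => simp
  | succ k ih => rw [pow_succ', RelIso.mul_apply, ih, dbl_apply]; ring

theorem shift_pow_apply (k : ℕ) (t : ℝ) : (shift ^ k) t = t - k := by
  induction k with
  | zero => simp
  | succ k ih => rw [pow_succ', RelIso.mul_apply, ih, shift_apply]; push_cast; ring

theorem shift_zpow_apply (k : ℤ) (t : ℝ) : (shift ^ k) t = t - k := by
  obtain ⟨m, rfl | rfl⟩ := k.eq_nat_or_neg
  · rw [zpow_natCast, shift_pow_apply]; simp
  · rw [zpow_neg, zpow_natCast]
    have := (shift ^ m).symm_apply_apply (t + m)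
    rw [shift_pow_apply, add_sub_cancel_right] at this
    change (shift ^ m).symm t = _
    rw [this]; push_cast; ring

theorem generateBS_rgerm {n : ℕ} (hn : 1 ≤ n) :
    GenerateBS 1 2 (rgerm n dbl) (rgerm n shift) := by
  refine generateBS_of_normalForm ?_ ?_
  · have := congrArg (rgermHom n) dbl_mul_shift
    rwa [map_mul, map_mul, map_inv, map_pow] at this
  · intro i l m h
    have h' : rgermHom n (shift ^ m * dbl ^ l) = rgermHom n (dbl ^ i) := by
      rw [map_mul, map_pow, map_pow, map_zpow]
      rw [mul_assoc, inv_mul_eq_one] at h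
      exact h.symm
    have e := eventuallyEq_of_rgerm_eq hn h'
    obtain ⟨T, hT⟩ := eventually_atBot.mp e
    -- Both sides are affine in t, so two points suffice to compare slopes and constant terms.
    have e1 := hT T le_rfl
    have e2 := hT (T - 1) (by linarith)
    rw [RelIso.mul_apply, shift_zpow_apply, dbl_pow_apply, dbl_pow_apply] at e1 e2
    have hil : (2 : ℝ) ^ l = 2 ^ i := by linarith
    have hil' : i = l := (pow_right_injective₀ two_pos (by norm_num) hil).symm
    refine ⟨hil', ?_⟩
    rw [hil] at e1
    have : (m : ℝ) = 0 := by linarith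
    exact_mod_cast this

/-! ### Invariance of realizability under conjugation -/

section Conjugation

variable {n : ℕ}

/-- The conjugating map is an actual homeomorphism, so it conjugates a section back as well as
germs. This moves the smooth example to the standard doubling and shift, even though the conjugacy
is not smooth at 0. -/
theorem IsRealizable.of_conj {Γ Γ' : Subgroup (HomeoGerm n)} (C : HomeoFix n)
    (hΓ : ∀ γ ∈ Γ, germ n C * γ * (germ n C)⁻¹ ∈ Γ') (h : IsRealizable Γ') :
    IsRealizable Γ := by
  obtain ⟨φ, hφ⟩ := h
  let ι : Γ →* Γ' :=
    { toFun := fun γ => ⟨germ n C * γ * (germ n C)⁻¹, hΓ γ γ.2⟩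
      map_one' := by apply Subtype.ext; simp
      map_mul' := by intro x y; apply Subtype.ext; simp }
  refine ⟨((MulAut.conj C⁻¹).toMonoidHom.comp φ).comp ι, fun γ => ?_⟩
  have := hφ (ι γ)
  change germ n (C⁻¹ * φ (ι γ) * C⁻¹⁻¹) = γ
  rw [map_mul, map_mul, this, map_inv, map_inv]
  change (germ n C)⁻¹ * (germ n C * γ * (germ n C)⁻¹) * (germ n C)⁻¹⁻¹ = γ
  group

theorem conj_mem_radialGroup (θ a b f₁ f₂ g₁ g₂ : ℝ ≃o ℝ) {γ : HomeoGerm n}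
    (hγ : γ ∈ radialGroup n a b f₁ f₂ g₁ g₂) :
    rgerm n θ * γ * (rgerm n θ)⁻¹ ∈ radialGroup n (θ * a * θ⁻¹) (θ * b * θ⁻¹) (θ * f₁ * θ⁻¹)
      (θ * f₂ * θ⁻¹) (θ * g₁ * θ⁻¹) (θ * g₂ * θ⁻¹) := by
  have h : radialGroup n a b f₁ f₂ g₁ g₂ ≤ (radialGroup n (θ * a * θ⁻¹) (θ * b * θ⁻¹)
      (θ * f₁ * θ⁻¹) (θ * f₂ * θ⁻¹) (θ * g₁ * θ⁻¹) (θ * g₂ * θ⁻¹)).comap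
        (MulAut.conj (rgerm n θ)).toMonoidHom := by
    refine (Subgroup.closure_le _).mpr ?_
    have e : ∀ k : ℝ ≃o ℝ, (MulAut.conj (rgerm n θ)).toMonoidHom (rgerm n k) =
        rgerm n (θ * k * θ⁻¹) := by
      intro k
      rw [← rgermHom_apply (θ * k * θ⁻¹), map_mul, map_mul, map_inv]
      rfl
    rintro x (rfl | rfl | rfl | rfl | rfl | rfl) <;>
      (rw [SetLike.mem_coe, Subgroup.mem_comap, e]; apply Subgroup.subset_closure; simp)
  exact h hγ

end Conjugation

/-! ### Dyadic shells on the line and continuous maps respecting them -/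

section Shells

/-- The intervals `2 ^ k • (-Q, -P)`. -/
def shell (P Q : ℝ) (k : ℤ) : Set ℝ := Ioo (-Q * 2 ^ k) (-P * 2 ^ k)

/-- The union of the intervals `2 ^ k • (-Q, -P)`. -/
def shells (P Q : ℝ) : Set ℝ := ⋃ k, shell P Q k

variable {P Q : ℝ}

theorem shell_subset_shells (k : ℤ) : shell P Q k ⊆ shells P Q := subset_iUnion _ k

theorem neg_of_mem_shell (hP : 0 < P) {k : ℤ} {t : ℝ} (ht : t ∈ shell P Q k) : t < 0 := by
  have : (0 : ℝ) < 2 ^ k := by positivity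
  have := ht.2
  nlinarith

/-- The condition `Q < 2 * P` separates consecutive shells, so a fundamental domain of doubling that
starts at an endpoint of the k-th shell meets no other shell. -/
theorem mem_shells_iff (hP : 0 < P) (hQ : Q < 2 * P) (k : ℤ) {t : ℝ} (h1 : -P * 2 ^ (k + 1) ≤ t)
    (h2 : t < -P * 2 ^ k) : t ∈ shells P Q ↔ -Q * 2 ^ k < t := by
  refine ⟨fun h => ?_, fun h => mem_iUnion.mpr ⟨k, h, h2⟩⟩
  obtain ⟨j, hj⟩ := mem_iUnion.mp h
  rcases lt_trichotomy j k with hjk | rfl | hjk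
  · have h3 : (2 : ℝ) ^ (j + 1) ≤ 2 ^ k := zpow_le_zpow_right₀ one_le_two (by omega)
    rw [zpow_add_one₀ two_ne_zero] at h3
    have h4 := hj.1
    have : (0 : ℝ) < 2 ^ j := by positivity
    nlinarith
  · exact hj.1
  · have h3 : (2 : ℝ) ^ (k + 1) ≤ 2 ^ j := zpow_le_zpow_right₀ one_le_two (by omega)
    have h4 := hj.2
    nlinarith

theorem two_mul_mem_shell_iff {k : ℤ} {t : ℝ} : 2 * t ∈ shell P Q (k + 1) ↔ t ∈ shell P Q k := by
  simp only [shell, mem_Ioo, zpow_add_one₀ (two_ne_zero (α := ℝ))]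
  constructor <;> rintro ⟨h1, h2⟩ <;> constructor <;> nlinarith

theorem two_mul_mem_shells_iff {t : ℝ} : 2 * t ∈ shells P Q ↔ t ∈ shells P Q := by
  simp only [shells, mem_iUnion]
  constructor
  · rintro ⟨k, hk⟩
    refine ⟨k - 1, two_mul_mem_shell_iff.mp ?_⟩
    rwa [sub_add_cancel]
  · rintro ⟨k, hk⟩
    exact ⟨k + 1, two_mul_mem_shell_iff.mpr hk⟩

theorem two_pow_mul_mem_shells_iff (m : ℕ) {t : ℝ} : 2 ^ m * t ∈ shells P Q ↔ t ∈ shells P Q := by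
  induction m with
  | zero => simp
  | succ m ih => rw [pow_succ', mul_assoc, two_mul_mem_shells_iff, ih]

variable {z : ℝ → ℝ} {k : ℤ}

/-- A continuous function that respects the union of shells, and every shell of index `≥ k`, maps
the gap following the `k`-th shell to one of the two neighbouring gaps. -/
theorem mapsTo_gap (hP : 0 < P) (hPQ : P < Q) (hQ : Q < 2 * P) (hz : ContinuousOn z (Iio 0))
    (hS : ∀ s < 0, z s < 0 → (s ∈ shells P Q ↔ z s ∈ shells P Q))
    (hk : ∀ s < 0, s ∈ shell P Q k → z s ∈ shell P Q k) :
    ∀ s ∈ Icc (-P * 2 ^ k) (-Q * 2 ^ (k - 1)),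
      z s ∈ Icc (-P * 2 ^ (k + 1)) (-Q * 2 ^ (k - 1)) := by
  have hc : (0 : ℝ) < 2 ^ k := by positivity
  have e1 : (2 : ℝ) ^ (k + 1) = 2 * 2 ^ k := by rw [zpow_add_one₀ two_ne_zero, mul_comm]
  have e2 : (2 : ℝ) ^ (k - 1) = 2 ^ k / 2 := by rw [zpow_sub_one₀ two_ne_zero]; rfl
  have hs0 : -P * 2 ^ k < 0 := by nlinarith
  -- The gap begins at an endpoint of the k-th shell, so continuity sends this point into the
  -- closure of that shell.
  have h0 : z (-P * 2 ^ k) ∈ Icc (-Q * 2 ^ k) (-P * 2 ^ k) := by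
    have hsub : shell P Q k ⊆ Iio 0 := fun t ht => neg_of_mem_shell hP ht
    have hw : ContinuousWithinAt z (shell P Q k) (-P * 2 ^ k) := (hz _ hs0).mono hsub
    have hlt : -Q * 2 ^ k ≠ -P * (2 : ℝ) ^ k := by nlinarith
    have hcl : -P * 2 ^ k ∈ closure (shell P Q k) := by
      rw [shell, closure_Ioo hlt]
      exact ⟨by nlinarith, le_rfl⟩
    have := hw.mem_closure hcl (fun s hs => hk s (hsub hs) hs)
    rwa [shell, closure_Ioo hlt] at this
  have hgap : ∀ s ∈ Icc (-P * 2 ^ k) (-Q * 2 ^ (k - 1)), s < 0 ∧ s ∉ shells P Q := by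
    intro s hs
    have h1 := hs.1
    have h2 := hs.2
    refine ⟨by rw [e2] at h2; nlinarith, ?_⟩
    rw [mem_shells_iff hP hQ (k - 1) (by rw [sub_add_cancel]; exact h1) (by rw [e2] at *; nlinarith)]
    exact h2.not_gt
  intro s hs
  have hsub : Icc (-P * 2 ^ k) s ⊆ Icc (-P * 2 ^ k) (-Q * 2 ^ (k - 1)) :=
    Icc_subset_Icc_right hs.2
  have hcs : ContinuousOn z (Icc (-P * 2 ^ k) s) :=
    hz.mono fun t ht => (hgap t (hsub ht)).1
  -- On the gap, `z` avoids all shells, so its values can never cross one. To leave the target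
  -- interval they would have to cross shell `k + 1` or shell `k - 1`.
  have hno : ∀ j, ∀ v ∈ shell P Q j, v ∉ z '' Icc (-P * 2 ^ k) s := by
    rintro j v hv ⟨t, ht, rfl⟩
    obtain ⟨h1, h2⟩ := hgap t (hsub ht)
    exact h2 ((hS t h1 (neg_of_mem_shell hP hv)).mpr (shell_subset_shells j hv))
  constructor
  · by_contra! hlt
    -- The number `-(P + Q) * 2 ^ k` is the midpoint of shell `k + 1`; the maximum keeps the chosen
    -- value in the range of `z`, even if `z s` already lies inside that shell.
    refine hno (k + 1) (max (z s) (-(P + Q) * 2 ^ k)) ?_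
      (intermediate_value_Icc' hs.1 hcs ⟨le_max_left _ _, ?_⟩)
    · rw [shell, e1] at *
      exact ⟨lt_max_of_lt_right (by nlinarith), max_lt hlt (by nlinarith)⟩
    · rw [e1] at hlt
      exact max_le (by nlinarith [h0.1]) (by nlinarith [h0.1])
  · by_contra! hlt
    refine hno (k - 1) (min (z s) (-(P + Q) * 2 ^ k / 4)) ?_
      (intermediate_value_Icc hs.1 hcs ⟨?_, min_le_left _ _⟩)
    · rw [shell, e2] at *
      exact ⟨lt_min hlt (by nlinarith), min_lt_of_right_lt (by nlinarith)⟩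
    · rw [e2] at hlt
      exact le_min (by nlinarith [h0.2]) (by nlinarith [h0.2])

/-- A continuous function that respects the union of shells, and every shell of index `≥ k`, also
respects the shell of index `k - 1`. -/
theorem mapsTo_shell (hP : 0 < P) (hPQ : P < Q) (hQ : Q < 2 * P) (hz : ContinuousOn z (Iio 0))
    (hS : ∀ s < 0, z s < 0 → (s ∈ shells P Q ↔ z s ∈ shells P Q))
    (hk : ∀ j ≥ k, ∀ s < 0, s ∈ shell P Q j ↔ z s ∈ shell P Q j) :
    ∀ s ∈ shell P Q (k - 1), z s ∈ shell P Q (k - 1) := by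
  have hc : (0 : ℝ) < 2 ^ k := by positivity
  have e1 : (2 : ℝ) ^ (k + 1) = 2 * 2 ^ k := by rw [zpow_add_one₀ two_ne_zero, mul_comm]
  have e2 : (2 : ℝ) ^ (k - 1) = 2 ^ k / 2 := by rw [zpow_sub_one₀ two_ne_zero]; rfl
  have e3 : (2 : ℝ) ^ (k - 2) = 2 ^ k / 4 := by rw [zpow_sub₀ two_ne_zero]; norm_num
  intro s hs
  have hs1 := hs.1
  have hs2 := hs.2
  -- The lower endpoint of shell `k - 1` ends the gap after shell `k`, which localizes its image;
  -- `z` is then followed from there to `s`.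
  have h1 := mapsTo_gap hP hPQ hQ hz hS (fun s hs h => (hk k le_rfl s hs).mp h) (-Q * 2 ^ (k - 1))
    ⟨by rw [e2]; nlinarith, le_rfl⟩
  have hneg : ∀ t ∈ Icc (-Q * 2 ^ (k - 1)) s, t < 0 := fun t ht =>
    ht.2.trans_lt (neg_of_mem_shell hP hs)
  have hcs : ContinuousOn z (Icc (-Q * 2 ^ (k - 1)) s) := hz.mono hneg
  -- Too far up: `z` would take the endpoint value `-P * 2 ^ (k - 1)`, which lies in no shell, at a
  -- point of shell `k - 1`.
  rcases le_or_gt (-P * 2 ^ (k - 1)) (z s) with hA | hA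
  · exfalso
    obtain ⟨t, ht, hv⟩ := intermediate_value_Icc hs1.le hcs
      (⟨h1.2.trans (by rw [e2]; nlinarith), hA⟩ : -P * 2 ^ (k - 1) ∈ Icc _ _)
    have hne : -Q * 2 ^ (k - 1) ≠ t := by
      rintro rfl
      have := h1.2
      rw [hv, e2] at this
      nlinarith
    have hts : t ∈ shells P Q :=
      shell_subset_shells (k - 1) ⟨lt_of_le_of_ne ht.1 hne, ht.2.trans_lt hs2⟩
    rw [hS t (hneg t ht) (by rw [hv, e2]; nlinarith), hv,
      mem_shells_iff hP hQ (k - 2) (le_of_eq (by ring_nf)) (by rw [e2, e3]; nlinarith), e2,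
      e3] at hts
    nlinarith
  -- Too far down: `z` would enter shell `k + 1`, whose preimage is already known to be shell `k +
  -- 1` itself.
  rcases lt_or_ge (z s) (-P * 2 ^ (k + 1)) with hB | hB
  · exfalso
    obtain ⟨t, ht, hv⟩ := intermediate_value_Icc' hs1.le hcs
      (⟨le_max_left _ _, max_le (hB.le.trans h1.1) (le_trans (by rw [e1]; nlinarith) h1.1)⟩ :
        max (z s) (-(P + Q) * 2 ^ k) ∈ Icc _ _)
    have hm : t ∈ shell P Q (k + 1) := by
      rw [hk (k + 1) (by omega) t (hneg t ht), hv]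
      exact ⟨lt_max_of_lt_right (by rw [e1]; nlinarith), max_lt hB (by rw [e1]; nlinarith)⟩
    have h2 := hm.2
    have h3 := ht.1
    rw [e1] at h2
    rw [e2] at h3
    nlinarith
  have hs0 := neg_of_mem_shell hP hs
  have hz0 : z s < 0 := hA.trans (by rw [e2]; nlinarith)
  have hzs := (hS s hs0 hz0).mp (shell_subset_shells _ hs)
  -- Only shells `k` and `k - 1` remain, and the preimage of shell `k` is already known.
  rcases lt_or_ge (z s) (-P * 2 ^ k) with hD | hD
  · exfalso
    rw [mem_shells_iff hP hQ k hB hD] at hzs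
    have hsk := (hk k le_rfl s hs0).mpr ⟨hzs, hD⟩
    have := hsk.2
    rw [e2] at hs1
    nlinarith
  · rw [mem_shells_iff hP hQ (k - 1) (by rwa [sub_add_cancel]) hA] at hzs
    exact ⟨hzs, hA⟩

end Shells

/-! ### Rigidity of lifts and the obstruction to realizability -/

section Dynamics

variable {n : ℕ} {P Q : ℝ}

theorem ne_zero_of_log_norm_neg {x : E n} (hx : Real.log ‖x‖ < 0) : x ≠ 0 := by
  rintro rfl
  simp at hx

theorem exists_log_bound {p : E n → Prop} (hp : ∀ᶠ x in 𝓝 (0 : E n), p x) :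
    ∃ T < 0, ∀ x, Real.log ‖x‖ ≤ T → p x := by
  obtain ⟨ε, hε, hb⟩ := Metric.eventually_nhds_iff.mp hp
  refine ⟨min (-1) (Real.log ε - 1), (min_le_left _ _).trans_lt (by norm_num), fun x hx => hb ?_⟩
  have h1 : Real.log ‖x‖ < 0 := hx.trans_lt ((min_le_left _ _).trans_lt (by norm_num))
  have h2 : Real.log ‖x‖ < Real.log ε :=
    (hx.trans (min_le_right _ _)).trans_lt (by linarith)
  rw [dist_zero_right]
  exact (Real.log_lt_log_iff (norm_pos_iff.mpr (ne_zero_of_log_norm_neg h1)) hε).mp h2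

theorem radialFun_eq_self {h : ℝ → ℝ} {x : E n} (hx : x ≠ 0)
    (e : h (Real.log ‖x‖) = Real.log ‖x‖) : radialFun h x = x := by
  have hp : 0 < ‖x‖ := norm_pos_iff.mpr hx
  rw [radialFun, e, Real.exp_log hp, div_self hp.ne', one_smul]

theorem exists_ray {x : E n} (hx : x ≠ 0) :
    ∃ u : E n, ‖u‖ = 1 ∧ Real.exp (Real.log ‖x‖) • u = x := by
  have hp : 0 < ‖x‖ := norm_pos_iff.mpr hx
  refine ⟨‖x‖⁻¹ • x, ?_, ?_⟩
  · rw [norm_smul, norm_inv, norm_norm, inv_mul_cancel₀ hp.ne']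
  · rw [Real.exp_log hp, smul_smul, mul_inv_cancel₀ hp.ne', one_smul]

theorem log_norm_ray {u : E n} (hu : ‖u‖ = 1) (s : ℝ) : Real.log ‖Real.exp s • u‖ = s := by
  rw [norm_smul, hu, mul_one, Real.norm_eq_abs, Real.abs_exp, Real.log_exp]

theorem continuous_log_norm_ray (F : HomeoFix n) {u : E n} (hu : ‖u‖ = 1) :
    Continuous fun s => Real.log ‖F.1 (Real.exp s • u)‖ := by
  have hF := F.1.continuous
  refine Continuous.log (by fun_prop) fun s => norm_ne_zero_iff.mpr (HomeoFix.map_ne_zero F ?_)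
  exact smul_ne_zero (Real.exp_pos s).ne' (norm_ne_zero_iff.mp (by rw [hu]; exact one_ne_zero))

theorem moved_iff_of_commute {F G : HomeoFix n} (h : Commute G F) (x : E n) :
    G.1 (F.1 x) ≠ F.1 x ↔ G.1 x ≠ x := by
  rw [← HomeoFix.mul_apply, h.eq, HomeoFix.mul_apply, F.1.injective.ne_iff]

/-- A map commuting with `G` preserves the set of points moved by `G`. Along a ray this gives the
hypothesis of the one-dimensional shell lemmas, as long as the image stays in the unit ball. -/
theorem log_norm_ray_mem_shells {F G : HomeoFix n} (h : Commute G F)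
    (hG : ∀ x, Real.log ‖x‖ < 0 → (G.1 x ≠ x ↔ Real.log ‖x‖ ∈ shells P Q)) {u : E n}
    (hu : ‖u‖ = 1) : ∀ s < 0, Real.log ‖F.1 (Real.exp s • u)‖ < 0 →
      (s ∈ shells P Q ↔ Real.log ‖F.1 (Real.exp s • u)‖ ∈ shells P Q) := by
  intro s hs hz
  rw [← hG _ hz, moved_iff_of_commute h, hG _ (by rwa [log_norm_ray hu]), log_norm_ray hu]

theorem preserves_shell_pred (hP : 0 < P) (hPQ : P < Q) (hQ : Q < 2 * P) {F G : HomeoFix n}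
    (h : Commute G F)
    (hG : ∀ x, Real.log ‖x‖ < 0 → (G.1 x ≠ x ↔ Real.log ‖x‖ ∈ shells P Q)) {k : ℤ}
    (hk : ∀ j ≥ k, ∀ x, Real.log ‖x‖ ∈ shell P Q j ↔ Real.log ‖F.1 x‖ ∈ shell P Q j) (x : E n)
    (hx : Real.log ‖x‖ ∈ shell P Q (k - 1)) : Real.log ‖F.1 x‖ ∈ shell P Q (k - 1) := by
  obtain ⟨u, hu, hux⟩ := exists_ray (ne_zero_of_log_norm_neg (neg_of_mem_shell hP hx))
  have := mapsTo_shell hP hPQ hQ (continuous_log_norm_ray F hu).continuousOn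
    (log_norm_ray_mem_shells h hG hu) (k := k)
    (fun j hj s _ => by rw [← hk j hj, log_norm_ray hu]) _ hx
  rwa [hux] at this

/-- Shells of large index lie near 0, where `F` is the identity on them. Decreasing the index moves
outwards, one shell at a time; the equivalence needed for the induction comes from treating `F` and
its inverse together. -/
theorem preserves_shell (hP : 0 < P) (hPQ : P < Q) (hQ : Q < 2 * P) {F G : HomeoFix n}
    (h : Commute G F)
    (hG : ∀ x, Real.log ‖x‖ < 0 → (G.1 x ≠ x ↔ Real.log ‖x‖ ∈ shells P Q))
    (hF : ∀ᶠ x in 𝓝 (0 : E n), Real.log ‖x‖ ∈ shells P Q → F.1 x = x) (k : ℤ) (x : E n) :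
    Real.log ‖x‖ ∈ shell P Q k ↔ Real.log ‖F.1 x‖ ∈ shell P Q k := by
  obtain ⟨T, hT, hTF⟩ := exists_log_bound hF
  obtain ⟨k₀, hk₀⟩ : ∃ k₀ : ℕ, -P * 2 ^ k₀ ≤ T := by
    obtain ⟨m, hm⟩ := pow_unbounded_of_one_lt (-T / P) (one_lt_two (α := ℝ))
    refine ⟨m, ?_⟩
    rw [div_lt_iff₀ hP] at hm
    linarith
  have hself : ∀ j ≥ (k₀ : ℤ), ∀ x : E n, Real.log ‖x‖ ∈ shell P Q j → F.1 x = x := by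
    intro j hj x hx
    refine hTF x ?_ (shell_subset_shells j hx)
    have h1 : (2 : ℝ) ^ k₀ ≤ 2 ^ j := by
      rw [← zpow_natCast]; exact zpow_le_zpow_right₀ one_le_two hj
    have := hx.2
    nlinarith
  have hbase : ∀ j ≥ (k₀ : ℤ), ∀ x : E n,
      Real.log ‖x‖ ∈ shell P Q j ↔ Real.log ‖F.1 x‖ ∈ shell P Q j := by
    refine fun j hj x => ⟨fun hx => by rwa [hself j hj x hx], fun hx => ?_⟩
    have := F.1.injective (hself j hj _ hx)
    rwa [this] at hx
  have hstep : ∀ m : ℕ, ∀ j ≥ (k₀ : ℤ) - m, ∀ x : E n,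
      Real.log ‖x‖ ∈ shell P Q j ↔ Real.log ‖F.1 x‖ ∈ shell P Q j := by
    intro m
    induction m with
    | zero => simpa using hbase
    | succ m ih =>
      intro j hj x
      rcases eq_or_lt_of_le hj with rfl | hj
      · have e : (k₀ : ℤ) - (m + 1 : ℕ) = k₀ - m - 1 := by push_cast; ring
        rw [e]
        have h' : Commute G F⁻¹ := h.inv_right
        have ih' : ∀ j ≥ (k₀ : ℤ) - m, ∀ x : E n,
            Real.log ‖x‖ ∈ shell P Q j ↔ Real.log ‖(F⁻¹).1 x‖ ∈ shell P Q j := by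
          intro j hj x
          rw [ih j hj ((F⁻¹).1 x), ← HomeoFix.mul_apply, mul_inv_cancel, HomeoFix.one_apply]
        refine ⟨preserves_shell_pred hP hPQ hQ h hG ih x, fun hx => ?_⟩
        have := preserves_shell_pred hP hPQ hQ h' hG ih' _ hx
        rwa [HomeoFix.inv_apply_self] at this
      · exact ih j (by push_cast at hj; omega) x
  exact hstep (k₀ - k).toNat k (by omega) x

theorem preserves_gap (hP : 0 < P) (hPQ : P < Q) (hQ : Q < 2 * P) {F G : HomeoFix n}
    (h : Commute G F)
    (hG : ∀ x, Real.log ‖x‖ < 0 → (G.1 x ≠ x ↔ Real.log ‖x‖ ∈ shells P Q))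
    (hF : ∀ᶠ x in 𝓝 (0 : E n), Real.log ‖x‖ ∈ shells P Q → F.1 x = x) (k : ℤ) (x : E n)
    (hx0 : x ≠ 0) (hx : Real.log ‖x‖ ∈ Icc (-P * 2 ^ k) (-Q * 2 ^ (k - 1))) :
    Real.log ‖F.1 x‖ ∈ Icc (-P * 2 ^ (k + 1)) (-Q * 2 ^ (k - 1)) := by
  obtain ⟨u, hu, hux⟩ := exists_ray hx0
  have := mapsTo_gap hP hPQ hQ (continuous_log_norm_ray F hu).continuousOn
    (log_norm_ray_mem_shells h hG hu) (k := k)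
    (fun s _ hs => by
      have := (preserves_shell hP hPQ hQ h hG hF k (Real.exp s • u)).mp
      rw [log_norm_ray hu] at this
      exact this hs) _ hx
  rwa [hux] at this

theorem semiconj_pow {H : Type*} [Group H] {A G : H} {c : ℕ} (h : A * G = G ^ c * A) (m : ℕ) :
    A ^ m * G = G ^ c ^ m * A ^ m := by
  have h' : SemiconjBy A G (G ^ c) := h
  induction m with
  | zero => simp
  | succ m ih =>
    have := h'.pow_right (c ^ m)
    rw [← pow_mul, ← pow_succ'] at this
    rw [pow_succ', mul_assoc, ih, ← mul_assoc, this.eq, mul_assoc]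

theorem log_norm_pow_dbl {A : HomeoFix n}
    (hA : ∀ x, Real.log ‖x‖ < 0 → A.1 x = (radial n dbl).1 x) {x : E n}
    (hx : Real.log ‖x‖ < 0) (m : ℕ) : Real.log ‖(A ^ m).1 x‖ = 2 ^ m * Real.log ‖x‖ := by
  induction m with
  | zero => simp
  | succ m ih =>
    have hneg : Real.log ‖(A ^ m).1 x‖ < 0 := by
      rw [ih]; exact mul_neg_of_pos_of_neg (by positivity) hx
    rw [pow_succ', HomeoFix.mul_apply, hA _ hneg,
      log_norm_radial _ (ne_zero_of_log_norm_neg hneg), dbl_apply, ih, pow_succ']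
    ring

/-- A homeomorphism `G` with radial germ that satisfies `A G A⁻¹ = G ^ c`, where `A` doubles the
radial coordinate on the unit ball, moves exactly the points of the unit ball which are seen by
the germ of `G` after rescaling. -/
theorem moved_iff_mem_shells {A G : HomeoFix n} {c : ℕ} (hc : c ≠ 0) (hAG : A * G = G ^ c * A)
    (hA : ∀ x, Real.log ‖x‖ < 0 → A.1 x = (radial n dbl).1 x) {g : ℝ ≃o ℝ}
    (hG : germ n G = rgerm n g) (hle : ∀ᶠ t in atBot, g t ≤ t)
    (hmv : ∀ᶠ t in atBot, g t ≠ t ↔ t ∈ shells P Q) (x : E n) (hx : Real.log ‖x‖ < 0) :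
    G.1 x ≠ x ↔ Real.log ‖x‖ ∈ shells P Q := by
  obtain ⟨T₁, hT₁, hT⟩ := exists_log_bound (germ_eq_iff.mp hG)
  obtain ⟨T₂, hT₂⟩ := eventually_atBot.mp (hle.and hmv)
  set T := min T₁ T₂
  have hT0 : T < 0 := (min_le_left _ _).trans_lt hT₁
  obtain ⟨m, hm⟩ : ∃ m : ℕ, 2 ^ m * Real.log ‖x‖ ≤ T := by
    obtain ⟨m, hm⟩ := pow_unbounded_of_one_lt (T / Real.log ‖x‖) (one_lt_two (α := ℝ))
    exact ⟨m, ((div_lt_iff_of_neg hx).mp hm).le⟩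
  set y := (A ^ m).1 x with hy
  have hlogy : Real.log ‖y‖ = 2 ^ m * Real.log ‖x‖ := log_norm_pow_dbl hA hx m
  have hyT : Real.log ‖y‖ ≤ T := by rwa [hlogy]
  -- Since `g t ≤ t` near -∞, the forward orbit of `y` never leaves the region where `G` is known to
  -- be radial.
  have horb : ∀ j : ℕ, Real.log ‖(G ^ j).1 y‖ = g^[j] (Real.log ‖y‖) ∧
      Real.log ‖(G ^ j).1 y‖ ≤ T := by
    intro j
    induction j with
    | zero => exact ⟨rfl, hyT⟩
    | succ j ih =>
      have h1 : Real.log ‖(G ^ (j + 1)).1 y‖ = g (Real.log ‖(G ^ j).1 y‖) := by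
        rw [pow_succ', HomeoFix.mul_apply, hT _ (ih.2.trans (min_le_left _ _)),
          log_norm_radial _ (ne_zero_of_log_norm_neg (ih.2.trans_lt hT0))]
      refine ⟨by rw [h1, ih.1, Function.iterate_succ_apply'], ?_⟩
      rw [h1]
      exact (hT₂ _ (ih.2.trans (min_le_right _ _))).1.trans ih.2
  -- Hence `G` fixes `x` exactly when `G ^ c ^ m` fixes `y`, and by monotonicity of `g` this happens
  -- exactly when `g` fixes `log ‖y‖`.
  have hconj : (A ^ m).1 (G.1 x) = (G ^ c ^ m).1 y := by
    rw [hy, ← HomeoFix.mul_apply, ← HomeoFix.mul_apply, semiconj_pow hAG]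
  have hW : Real.log ‖x‖ ∈ shells P Q ↔ Real.log ‖y‖ ∈ shells P Q := by
    rw [hlogy, two_pow_mul_mem_shells_iff]
  obtain ⟨hle', hmv'⟩ := hT₂ _ (hyT.trans (min_le_right _ _))
  rw [hW, ← hmv']
  constructor
  · intro hne hg
    have hGy : G.1 y = y := by
      rw [hT _ (hyT.trans (min_le_left _ _)), radial_apply,
        radialFun_eq_self (ne_zero_of_log_norm_neg (hyT.trans_lt hT0)) hg]
    have hGj : (G ^ c ^ m).1 y = y := by
      rw [HomeoFix.pow_apply]
      exact Function.iterate_fixed hGy _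
    exact hne ((A ^ m).1.injective (hconj.trans hGj))
  · intro hg he
    rw [he] at hconj
    have h1 := iterate_lt_self g.strictMono (lt_of_le_of_ne hle' hg) (pow_ne_zero m hc)
    rw [← (horb _).1, ← hconj] at h1
    exact lt_irrefl _ h1

theorem log_norm_pow_shift {B : HomeoFix n} {x : E n} (hx : Real.log ‖x‖ < 0)
    (hB : ∀ x, Real.log ‖x‖ < 0 → B.1 x = (radial n shift).1 x) (m : ℕ) :
    (B ^ m).1 x = (radial n (shift ^ m)).1 x ∧ Real.log ‖(B ^ m).1 x‖ = Real.log ‖x‖ - m := by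
  have h2 : Real.log ‖(radial n (shift ^ m)).1 x‖ = Real.log ‖x‖ - m := by
    rw [log_norm_radial _ (ne_zero_of_log_norm_neg hx), shift_pow_apply]
  have h1 : (B ^ m).1 x = (radial n (shift ^ m)).1 x := by
    induction m with
    | zero =>
      rw [pow_zero, pow_zero]
      exact congrArg (fun f : HomeoFix n => f.1 x) (radialHom n).map_one.symm
    | succ m ih =>
      have h2 : Real.log ‖(radial n (shift ^ m)).1 x‖ = Real.log ‖x‖ - m := by
        rw [log_norm_radial _ (ne_zero_of_log_norm_neg hx), shift_pow_apply]
      have e : radial n (shift ^ (m + 1)) = radial n shift * radial n (shift ^ m) := by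
        rw [pow_succ']; exact (radialHom n).map_mul _ _
      have : (0 : ℝ) ≤ m := m.cast_nonneg
      rw [pow_succ', HomeoFix.mul_apply, ih h2, e, HomeoFix.mul_apply, hB _ (by rw [h2]; linarith)]
  exact ⟨h1, by rw [h1, h2]⟩

/-- In a lift of the affine group whose translation is standard on the unit ball, the dilation is
standard on the unit ball. -/
theorem dilation_eq_on_ball {A B : HomeoFix n} (hAB : A * B * A⁻¹ = B ^ 2)
    (hA : germ n A = rgerm n dbl)
    (hB : ∀ x, Real.log ‖x‖ < 0 → B.1 x = (radial n shift).1 x) (x : E n)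
    (hx : Real.log ‖x‖ < 0) : A.1 x = (radial n dbl).1 x := by
  obtain ⟨T, hT, hTA⟩ := exists_log_bound (germ_eq_iff.mp hA)
  obtain ⟨m, hm⟩ := exists_nat_gt (-T)
  obtain ⟨h1, h2⟩ := log_norm_pow_shift hx hB m
  -- `B ^ m` pushes `x` into the region where `A` agrees with its germ; the relation `A B ^ m = B ^
  -- (2 m) A` and injectivity of `B ^ (2 m)` bring the information back to `x`.
  have h3 := hTA ((B ^ m).1 x) (by rw [h2]; linarith)
  have hx0 := ne_zero_of_log_norm_neg hx
  have hdx : Real.log ‖(radial n dbl).1 x‖ = 2 * Real.log ‖x‖ := by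
    rw [log_norm_radial _ hx0, dbl_apply]
  have h4 := (log_norm_pow_shift (x := (radial n dbl).1 x) (by rw [hdx]; linarith) hB (2 * m)).1
  have hrel : A * B ^ m = B ^ (2 * m) * A := by
    have := pow_mul_zpow_of_conj hAB 1 m
    rw [pow_one, zpow_natCast, pow_one] at this
    rw [this]
    congr 1
  have hrel' : dbl * shift ^ m = shift ^ (2 * m) * dbl := by
    ext t
    simp only [RelIso.mul_apply, shift_pow_apply, dbl_apply]
    push_cast
    ring
  refine (B ^ (2 * m)).1.injective ?_
  rw [← HomeoFix.mul_apply, ← hrel, HomeoFix.mul_apply, h3, h1, h4, ← HomeoFix.mul_apply,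
    ← HomeoFix.mul_apply]
  have := congrArg (radialHom n) hrel'
  rw [map_mul, map_mul] at this
  exact congrArg (fun f : HomeoFix n => f.1 x) this

theorem no_lift_of_standard_translation {A B F₁ F₂ G₁ G₂ : HomeoFix n} (hn : 1 ≤ n)
    {f₁ f₂ g₁ g₂ : ℝ ≃o ℝ} {c : ℕ} (hc : c ≠ 0)
    (hA : germ n A = rgerm n dbl)
    (hF₁ : germ n F₁ = rgerm n f₁) (hF₂ : germ n F₂ = rgerm n f₂)
    (hG₁ : germ n G₁ = rgerm n g₁) (hG₂ : germ n G₂ = rgerm n g₂)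
    (hAB : A * B * A⁻¹ = B ^ 2) (hFF : F₁ * F₂ = B) (hGF₁ : Commute G₁ F₁) (hGF₂ : Commute G₂ F₂)
    (hAG₁ : A * G₁ = G₁ ^ c * A) (hAG₂ : A * G₂ = G₂ ^ c * A)
    (hle₁ : ∀ᶠ t in atBot, g₁ t ≤ t) (hle₂ : ∀ᶠ t in atBot, g₂ t ≤ t)
    (hg₁ : ∀ᶠ t in atBot, g₁ t ≠ t ↔ t ∈ shells (7 / 2) 4)
    (hg₂ : ∀ᶠ t in atBot, g₂ t ≠ t ↔ t ∈ shells 5 6)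
    (hf₁ : ∀ᶠ t in atBot, t ∈ shells (7 / 2) 4 → f₁ t = t)
    (hf₂ : ∀ᶠ t in atBot, t ∈ shells 5 6 → f₂ t = t)
    (hB : ∀ x, Real.log ‖x‖ < 0 → B.1 x = (radial n shift).1 x) : False := by
  have hA' := dilation_eq_on_ball hAB hA hB
  have hM₁ := moved_iff_mem_shells hc hAG₁ hA' hG₁ hle₁ hg₁
  have hM₂ := moved_iff_mem_shells hc hAG₂ hA' hG₂ hle₂ hg₂
  have hfix : ∀ {P Q : ℝ}, 0 < P → ∀ {F : HomeoFix n} {f : ℝ ≃o ℝ}, germ n F = rgerm n f →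
      (∀ᶠ t in atBot, t ∈ shells P Q → f t = t) →
      ∀ᶠ x in 𝓝 (0 : E n), Real.log ‖x‖ ∈ shells P Q → F.1 x = x := by
    intro P Q hP F f hF hf
    filter_upwards [germ_eq_iff.mp hF, eventually_log_norm hf] with x h1 h2 hx
    obtain ⟨k, hk⟩ := mem_iUnion.mp hx
    have hx0 := ne_zero_of_log_norm_neg (neg_of_mem_shell hP hk)
    rw [h1, radial_apply, radialFun_eq_self hx0 (h2 hx0 hx)]
  -- The value -11/32 is the midpoint of the shell (-6/16, -5/16), which F₂ preserves. This shell
  -- lies in the gap [-7/16, -1/4] for F₁, whose image stays in [-7/8, -1/4]. But B sends -11/32 to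
  -- -43/32, below -7/8.
  obtain ⟨x, hx0, hx⟩ := exists_log_norm_eq hn (-(11 / 32))
  have s₂ : Real.log ‖F₂.1 x‖ ∈ shell 5 6 (-4) := by
    refine (preserves_shell (by norm_num) (by norm_num) (by norm_num) hGF₂ hM₂
      (hfix (by norm_num) hF₂ hf₂) (-4) x).mp ?_
    rw [hx]
    constructor <;> norm_num
  have s₁ := preserves_gap (by norm_num) (by norm_num) (by norm_num) hGF₁ hM₁
    (hfix (by norm_num) hF₁ hf₁) (-3) _ (HomeoFix.map_ne_zero F₂ hx0)
    ⟨le_trans (by norm_num) s₂.1.le, s₂.2.le.trans (by norm_num)⟩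
  rw [← HomeoFix.mul_apply, hFF, hB x (by rw [hx]; norm_num), log_norm_radial _ hx0, hx,
    shift_apply] at s₁
  have := s₁.1
  norm_num at this

/-- A lift of the translation germ is conjugate, by a homeomorphism with trivial germ, to a lift
that is standard on the unit ball. -/
theorem exists_conj_standard {B : HomeoFix n} (hB : germ n B = rgerm n shift) :
    ∃ H : HomeoFix n, germ n H = 1 ∧
      ∀ x, Real.log ‖x‖ < 0 → (H⁻¹ * B * H).1 x = (radial n shift).1 x := by
  obtain ⟨T, hT, hTB⟩ := exists_log_bound (germ_eq_iff.mp hB)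
  obtain ⟨m, hm⟩ := exists_nat_gt (-T)
  set S := radial n shift
  refine ⟨(B ^ m)⁻¹ * S ^ m, ?_, fun x hx => ?_⟩
  · rw [map_mul, map_inv, map_pow, map_pow, hB]
    exact inv_mul_cancel _
  · have h1 := log_norm_pow_shift (B := S) hx (fun _ _ => rfl) m
    -- The powers of `B` cancel because they commute with `B`; what is left evaluates `B` only on
    -- the image of the unit ball under `S ^ m`, where `B` equals `S`.
    have e : ((B ^ m)⁻¹ * S ^ m)⁻¹ * B * ((B ^ m)⁻¹ * S ^ m) = (S ^ m)⁻¹ * (B * S ^ m) := by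
      have : B ^ m * B * (B ^ m)⁻¹ = B := by
        rw [← pow_succ, pow_succ', mul_inv_cancel_right]
      rw [mul_inv_rev, inv_inv, ← mul_assoc, mul_assoc (S ^ m)⁻¹ (B ^ m) B,
        mul_assoc (S ^ m)⁻¹ (B ^ m * B), this, mul_assoc]
    have h3 : B.1 ((S ^ m).1 x) = S.1 ((S ^ m).1 x) := hTB _ (by rw [h1.2]; linarith)
    rw [e, HomeoFix.mul_apply, HomeoFix.mul_apply, h3, ← HomeoFix.mul_apply,
      ← HomeoFix.mul_apply, mul_assoc, ← pow_succ', pow_succ, inv_mul_cancel_left]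

/-- The exponent `c` serves both examples: it is 1 for the topological group and 2 for the smooth
one. -/
theorem not_isRealizable (hn : 1 ≤ n) {f₁ f₂ g₁ g₂ : ℝ ≃o ℝ} {c : ℕ} (hc : c ≠ 0)
    (hff : rgerm n f₁ * rgerm n f₂ = rgerm n shift)
    (hgf₁ : Commute (rgerm n g₁) (rgerm n f₁)) (hgf₂ : Commute (rgerm n g₂) (rgerm n f₂))
    (hag₁ : rgerm n dbl * rgerm n g₁ = rgerm n g₁ ^ c * rgerm n dbl)
    (hag₂ : rgerm n dbl * rgerm n g₂ = rgerm n g₂ ^ c * rgerm n dbl)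
    (hle₁ : ∀ᶠ t in atBot, g₁ t ≤ t) (hle₂ : ∀ᶠ t in atBot, g₂ t ≤ t)
    (hg₁ : ∀ᶠ t in atBot, g₁ t ≠ t ↔ t ∈ shells (7 / 2) 4)
    (hg₂ : ∀ᶠ t in atBot, g₂ t ≠ t ↔ t ∈ shells 5 6)
    (hf₁ : ∀ᶠ t in atBot, t ∈ shells (7 / 2) 4 → f₁ t = t)
    (hf₂ : ∀ᶠ t in atBot, t ∈ shells 5 6 → f₂ t = t) :
    ¬ IsRealizable (radialGroup n dbl shift f₁ f₂ g₁ g₂) := by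
  rintro ⟨φ, hφ⟩
  have mem : ∀ γ ∈ ({rgerm n dbl, rgerm n shift, rgerm n f₁, rgerm n f₂, rgerm n g₁,
      rgerm n g₂} : Set (HomeoGerm n)), γ ∈ radialGroup n dbl shift f₁ f₂ g₁ g₂ :=
    fun γ hγ => Subgroup.subset_closure hγ
  let a : radialGroup n dbl shift f₁ f₂ g₁ g₂ := ⟨rgerm n dbl, mem _ (by simp)⟩
  let b : radialGroup n dbl shift f₁ f₂ g₁ g₂ := ⟨rgerm n shift, mem _ (by simp)⟩
  let p₁ : radialGroup n dbl shift f₁ f₂ g₁ g₂ := ⟨rgerm n f₁, mem _ (by simp)⟩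
  let p₂ : radialGroup n dbl shift f₁ f₂ g₁ g₂ := ⟨rgerm n f₂, mem _ (by simp)⟩
  let q₁ : radialGroup n dbl shift f₁ f₂ g₁ g₂ := ⟨rgerm n g₁, mem _ (by simp)⟩
  let q₂ : radialGroup n dbl shift f₁ f₂ g₁ g₂ := ⟨rgerm n g₂, mem _ (by simp)⟩
  obtain ⟨H, hH, hst⟩ := exists_conj_standard (hφ b)
  let ψ : radialGroup n dbl shift f₁ f₂ g₁ g₂ →* HomeoFix n :=
    (MulAut.conj H⁻¹).toMonoidHom.comp φ
  have hψ : ∀ γ, germ n (ψ γ) = γ := by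
    intro γ
    change germ n (H⁻¹ * φ γ * H⁻¹⁻¹) = γ
    rw [map_mul, map_mul, hφ, map_inv, map_inv, map_inv, hH, inv_one, inv_one, one_mul, mul_one]
  have hab : a * b * a⁻¹ = b ^ 2 := by
    apply Subtype.ext
    have := congrArg (rgermHom n) dbl_mul_shift
    rwa [map_mul, map_mul, map_inv, map_pow] at this
  have hpp : p₁ * p₂ = b := Subtype.ext hff
  have hqp₁ : Commute q₁ p₁ := Subtype.ext hgf₁
  have hqp₂ : Commute q₂ p₂ := Subtype.ext hgf₂
  have haq₁ : a * q₁ = q₁ ^ c * a := Subtype.ext hag₁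
  have haq₂ : a * q₂ = q₂ ^ c * a := Subtype.ext hag₂
  refine no_lift_of_standard_translation (A := ψ a) (B := ψ b) (F₁ := ψ p₁) (F₂ := ψ p₂)
    (G₁ := ψ q₁) (G₂ := ψ q₂) hn hc (hψ _) (hψ _) (hψ _) (hψ _) (hψ _) ?_ ?_ (hqp₁.map ψ)
    (hqp₂.map ψ) ?_ ?_ hle₁ hle₂ hg₁ hg₂ hf₁ hf₂ ?_
  · rw [← map_mul, ← map_inv, ← map_mul, hab, map_pow]
  · rw [← map_mul, hpp]
  · rw [← map_mul, haq₁, map_mul, map_pow]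
  · rw [← map_mul, haq₂, map_mul, map_pow]
  · intro x hx
    rw [← hst x hx]
    change (H⁻¹ * φ b * H⁻¹⁻¹).1 x = _
    rw [inv_inv]

end Dynamics

/-! ### Increasing homeomorphisms from displacements -/

section Profiles

/-- The increasing homeomorphism underlying a proper increasing continuous function. -/
noncomputable def orderIsoOfTendsto (h : ℝ → ℝ) (hm : StrictMono h) (hc : Continuous h)
    (ht : Tendsto h atTop atTop) (hb : Tendsto h atBot atBot) : ℝ ≃o ℝ :=
  hm.orderIsoOfSurjective h (hc.surjective ht hb)

theorem orderIsoOfTendsto_apply (h : ℝ → ℝ) (hm : StrictMono h) (hc : Continuous h)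
    (ht : Tendsto h atTop atTop) (hb : Tendsto h atBot atBot) (t : ℝ) :
    orderIsoOfTendsto h hm hc ht hb t = h t := rfl

theorem exists_orderIso_of_lipschitz {ψ : ℝ → ℝ} (hψ : LipschitzWith (1 / 2) ψ) :
    ∃ h : ℝ ≃o ℝ, ∀ t, h t = t - ψ t := by
  have hd : ∀ s t, |ψ s - ψ t| ≤ 1 / 2 * |s - t| := fun s t => by
    simpa [Real.dist_eq] using hψ.dist_le_mul s t
  have hm : StrictMono fun t => t - ψ t := by
    intro s t hst
    have h1 := (abs_le.mp (hd t s)).2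
    rw [abs_of_pos (sub_pos.mpr hst)] at h1
    simp only
    linarith
  have ht : Tendsto (fun t => t - ψ t) atTop atTop := by
    refine tendsto_atTop_mono' atTop (f₁ := fun t => t / 2 - ψ 0) ?_ ?_
    · filter_upwards [eventually_ge_atTop 0] with t ht
      have h1 := (abs_le.mp (hd t 0)).2
      rw [sub_zero, abs_of_nonneg ht] at h1
      linarith
    · exact tendsto_atTop_add_const_right _ _ (tendsto_id.atTop_div_const two_pos)
  have hb : Tendsto (fun t => t - ψ t) atBot atBot := by
    refine tendsto_atBot_mono' atBot (f₁ := fun t => t / 2 - ψ 0) ?_ ?_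
    · filter_upwards [eventually_le_atBot 0] with t ht
      have h1 := (abs_le.mp (hd t 0)).1
      rw [sub_zero, abs_of_nonpos ht] at h1
      linarith
    · exact tendsto_atBot_add_const_right _ _ (tendsto_id.atBot_div_const two_pos)
  exact ⟨orderIsoOfTendsto _ hm (continuous_id.sub hψ.continuous) ht hb, fun t => rfl⟩

/-- Two profiles commute near `-∞` when each point moved by one is fixed by the other. -/
theorem commute_rgerm_of_disjoint {n : ℕ} {f g : ℝ ≃o ℝ}
    (h : ∀ᶠ t in atBot, g t ≠ t → f t = t) : Commute (rgerm n g) (rgerm n f) := by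
  change _ * _ = _ * _
  rw [← rgerm_mul, ← rgerm_mul]
  refine rgerm_eq_of_eventuallyEq ?_
  filter_upwards [h, g.tendsto_atBot.eventually h, f.tendsto_atBot.eventually h] with t h1 h2 h3
  rw [RelIso.mul_apply, RelIso.mul_apply]
  by_cases hg : g t = t
  · rw [hg]
    by_contra hne
    have h4 := f.injective (h3 hne)
    rw [h4] at hne
    exact hne hg
  · rw [h1 hg, h2 fun he => hg (g.injective he)]

end Profiles

/-! ### The topological profiles on the line -/

section LineConstruction

theorem exists_dyadic {P : ℝ} (hP : 0 < P) {t : ℝ} (ht : t < 0) :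
    ∃ k : ℤ, -P * 2 ^ (k + 1) ≤ t ∧ t < -P * 2 ^ k := by
  obtain ⟨k, h1, h2⟩ := exists_mem_Ioc_zpow (div_pos (neg_pos.mpr ht) hP) (one_lt_two (α := ℝ))
  rw [lt_div_iff₀ hP] at h1
  rw [div_le_iff₀ hP] at h2
  exact ⟨k, by linarith, by linarith⟩

open scoped Pointwise in
theorem infDist_two_mul {S : Set ℝ} (hS : ∀ t, 2 * t ∈ S ↔ t ∈ S) (t : ℝ) :
    Metric.infDist (2 * t) S = 2 * Metric.infDist t S := by
  have h : (2 : ℝ) • S = S := by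
    ext s
    rw [mem_smul_set_iff_inv_smul_mem₀ two_ne_zero, ← hS, smul_eq_mul, mul_inv_cancel_left₀]
    exact two_ne_zero
  have := infDist_smul₀ (c := (2 : ℝ)) two_ne_zero S t
  rwa [h, smul_eq_mul, Real.norm_ofNat] at this

theorem X_eq_shells : X = shells 4 7 := rfl

theorem two_mul_mem_Y_iff (t : ℝ) : 2 * t ∈ Y ↔ t ∈ Y := by
  have h : ∀ k : ℤ, 2 * t ∈ Icc (-6 * (2 : ℝ) ^ (k + 1)) (-5 * (2 : ℝ) ^ (k + 1)) ↔
      t ∈ Icc (-6 * (2 : ℝ) ^ k) (-5 * (2 : ℝ) ^ k) := by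
    intro k
    simp only [mem_Icc, zpow_add_one₀ (two_ne_zero (α := ℝ))]
    constructor <;> rintro ⟨h1, h2⟩ <;> constructor <;> nlinarith
  simp only [Y, mem_iUnion]
  constructor
  · rintro ⟨k, hk⟩
    refine ⟨k - 1, (h _).mp ?_⟩
    rwa [sub_add_cancel]
  · rintro ⟨k, hk⟩
    exact ⟨k + 1, (h k).mpr hk⟩

theorem isOpen_X : IsOpen X := isOpen_iUnion fun _ => isOpen_Ioo

theorem neg_of_mem_Y {t : ℝ} (ht : t ∈ Y) : t < 0 := by
  obtain ⟨k, hk⟩ := mem_iUnion.mp ht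
  have : (0 : ℝ) < 2 ^ k := by positivity
  linarith [hk.2]

theorem neg_of_mem_X {t : ℝ} (ht : t ∈ X) : t < 0 := by
  obtain ⟨k, hk⟩ := mem_iUnion.mp ht
  exact neg_of_mem_shell (P := 4) (by norm_num) hk

/-- Around a negative point, `Y` reduces to a single interval. -/
theorem exists_nhds_inter_Y_subset {t : ℝ} (ht : t < 0) : ∃ (U : Set ℝ) (k : ℤ), IsOpen U ∧ t ∈ U ∧
    U ∩ Y ⊆ Icc (-6 * (2 : ℝ) ^ k) (-5 * (2 : ℝ) ^ k) := by
  obtain ⟨k, h1, h2⟩ := exists_dyadic (P := 4) (by norm_num) ht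
  have hc : (0 : ℝ) < 2 ^ k := by positivity
  rw [zpow_add_one₀ two_ne_zero] at h1
  refine ⟨Ioo (-9 * 2 ^ k) (-3 * 2 ^ k), k, isOpen_Ioo, ⟨by linarith, by linarith⟩, ?_⟩
  rintro s ⟨hs, hsY⟩
  obtain ⟨j, hj⟩ := mem_iUnion.mp hsY
  rcases lt_trichotomy j k with hjk | rfl | hjk
  · have h3 : (2 : ℝ) ^ (j + 1) ≤ 2 ^ k := zpow_le_zpow_right₀ one_le_two (by omega)
    rw [zpow_add_one₀ two_ne_zero] at h3
    linarith [hj.1, hs.2]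
  · exact hj
  · have h3 : (2 : ℝ) ^ (k + 1) ≤ 2 ^ j := zpow_le_zpow_right₀ one_le_two (by omega)
    rw [zpow_add_one₀ two_ne_zero] at h3
    linarith [hj.2, hs.1]

theorem mem_closure_Y {t : ℝ} (ht : t < 0) (h : t ∈ closure Y) : t ∈ Y := by
  obtain ⟨U, k, hU, htU, hsub⟩ := exists_nhds_inter_Y_subset ht
  exact mem_iUnion.mpr ⟨k, closure_minimal hsub isClosed_Icc (hU.inter_closure ⟨htU, h⟩)⟩

theorem interior_Y : interior Y = shells 5 6 := by
  apply Subset.antisymm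
  · intro t ht
    obtain ⟨U, k, hU, htU, hsub⟩ := exists_nhds_inter_Y_subset (neg_of_mem_Y (interior_subset ht))
    have h1 : t ∈ interior (U ∩ Y) := by
      rw [interior_inter, hU.interior_eq]; exact ⟨htU, ht⟩
    have h2 := interior_mono hsub h1
    rw [interior_Icc] at h2
    exact mem_iUnion.mpr ⟨k, h2⟩
  · refine interior_maximal ?_ (isOpen_iUnion fun _ => isOpen_Ioo)
    exact iUnion_mono fun k => Ioo_subset_Icc_self

/-- Consecutive components of `X` are (-7·2ᵏ, -4·2ᵏ) and (-(7/2)·2ᵏ, -2·2ᵏ), which leaves the open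
gap (-4·2ᵏ, -(7/2)·2ᵏ). -/
theorem not_mem_closure_X_iff {t : ℝ} (ht : t < 0) : t ∉ closure X ↔ t ∈ shells (7 / 2) 4 := by
  constructor
  · intro h
    obtain ⟨k, h1, h2⟩ := exists_dyadic (P := 7 / 2) (by norm_num) ht
    have hc : (0 : ℝ) < 2 ^ k := by positivity
    rw [zpow_add_one₀ two_ne_zero] at h1
    rw [mem_shells_iff (by norm_num) (by norm_num) k (by rw [zpow_add_one₀ two_ne_zero]; linarith)
      h2]
    by_contra! hle
    refine h (closure_mono (shell_subset_shells (P := 4) (Q := 7) k) ?_)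
    rw [shell, closure_Ioo (by linarith)]
    exact ⟨by linarith, hle⟩
  · intro h hcl
    obtain ⟨k, hk⟩ := mem_iUnion.mp h
    obtain ⟨s, hs, hsX⟩ := mem_closure_iff.mp hcl _ isOpen_Ioo hk
    have hc : (0 : ℝ) < 2 ^ k := by positivity
    have e : (2 : ℝ) ^ (k - 1) = 2 ^ k / 2 := by rw [zpow_sub_one₀ two_ne_zero]; rfl
    rw [X_eq_shells, mem_shells_iff (by norm_num) (by norm_num) (k - 1)
      (by rw [sub_add_cancel]; exact hs.1.le) (by rw [e]; linarith [hs.2])] at hsX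
    rw [e] at hsX
    linarith [hs.2]

theorem closure_compl_closure_X : closure (closure X)ᶜ = Xᶜ := by
  apply Subset.antisymm
  · exact closure_minimal (compl_subset_compl.mpr subset_closure) isOpen_X.isClosed_compl
  · intro t ht
    have hpos : Ioi (0 : ℝ) ⊆ (closure X)ᶜ := by
      intro s hs hcl
      obtain ⟨r, hr, hrX⟩ := mem_closure_iff.mp hcl _ isOpen_Ioi hs
      exact (neg_of_mem_X hrX).not_gt hr
    rcases lt_or_ge t 0 with h0 | h0
    · obtain ⟨k, h1, h2⟩ := exists_dyadic (P := 7 / 2) (by norm_num) h0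
      have hc : (0 : ℝ) < 2 ^ k := by positivity
      obtain ⟨j, hj⟩ : ∃ j : ℤ, t ∈ closure (shell (7 / 2) 4 j) := by
        rcases le_or_gt (-4 * 2 ^ k) t with h3 | h3
        · refine ⟨k, ?_⟩
          rw [shell, closure_Ioo (by linarith)]
          exact ⟨h3, h2.le⟩
        · refine ⟨k + 1, ?_⟩
          rw [zpow_add_one₀ two_ne_zero] at h1
          rw [shell, zpow_add_one₀ two_ne_zero, closure_Ioo (by linarith)]
          refine ⟨by linarith, ?_⟩
          by_contra! h4
          exact ht (mem_iUnion.mpr ⟨k, by linarith, h3⟩)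
      refine closure_mono ?_ hj
      intro s hs
      exact (not_mem_closure_X_iff (neg_of_mem_shell (by norm_num) hs)).mpr
        (shell_subset_shells j hs)
    · refine closure_mono hpos ?_
      rwa [closure_Ioi]

theorem infDist_pos_iff {S : Set ℝ} (hS : S.Nonempty) {t : ℝ} :
    0 < Metric.infDist t S ↔ t ∉ closure S := by
  rw [Metric.mem_closure_iff_infDist_zero hS, Metric.infDist_nonneg.lt_iff_ne, ne_comm]

theorem zero_notMem_X : (0 : ℝ) ∉ X := fun h => lt_irrefl _ (neg_of_mem_X h)

theorem zero_notMem_Y : (0 : ℝ) ∉ Y := fun h => lt_irrefl _ (neg_of_mem_Y h)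

theorem X_nonempty : X.Nonempty := ⟨-5, mem_iUnion.mpr ⟨0, by constructor <;> norm_num⟩⟩

theorem Y_nonempty : Y.Nonempty := ⟨-5, mem_iUnion.mpr ⟨0, by constructor <;> norm_num⟩⟩

/-- The displacement of the profile `f₁`: it vanishes exactly off `X` and is `1` exactly on
the large components of `Y`. -/
noncomputable def displacement (t : ℝ) : ℝ :=
  min (1 / 2 * Metric.infDist t Xᶜ) (max (1 / 2) (1 - 1 / 2 * Metric.infDist t Y))

theorem lipschitz_half_infDist (S : Set ℝ) :
    LipschitzWith (1 / 2) fun t => 1 / 2 * Metric.infDist t S := by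
  refine LipschitzWith.of_dist_le_mul fun s t => ?_
  have := (Metric.lipschitz_infDist_pt S).dist_le_mul s t
  simp only [Real.dist_eq, NNReal.coe_one, one_mul] at this ⊢
  rw [← mul_sub, abs_mul]
  push_cast
  rw [abs_of_pos (by norm_num : (0 : ℝ) < 1 / 2)]
  linarith

theorem lipschitz_displacement : LipschitzWith (1 / 2) displacement := by
  have h1 : LipschitzWith (1 / 2) fun t => 1 - 1 / 2 * Metric.infDist t Y := by
    have := (LipschitzWith.const (1 : ℝ)).sub (lipschitz_half_infDist Y)
    rwa [zero_add] at this
  have := (lipschitz_half_infDist Xᶜ).min (h1.const_max (1 / 2))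
  rwa [max_self] at this

theorem displacement_eq_zero_iff {t : ℝ} : displacement t = 0 ↔ t ∉ X := by
  have h0 : (Xᶜ).Nonempty := ⟨0, zero_notMem_X⟩
  rw [← mem_compl_iff, ← isOpen_X.isClosed_compl.closure_eq,
    Metric.mem_closure_iff_infDist_zero h0, displacement]
  have h1 : (1 / 2 : ℝ) ≤ max (1 / 2) (1 - 1 / 2 * Metric.infDist t Y) := le_max_left _ _
  constructor
  · intro h
    rcases min_eq_iff.mp h with h | h <;> linarith [h.1]
  · intro h
    rw [h, mul_zero, min_eq_left (by linarith)]

/-- The value 1 requires a point of `Y` at distance at least 2 from the complement of `X`. On the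
component of index k this distance is at least 2ᵏ everywhere, which suffices for k ≥ 1, while for k
≤ 0 no point qualifies. The number -8 separates the components of index 0 and 1. -/
theorem displacement_eq_one_iff {t : ℝ} : displacement t = 1 ↔ t ∈ Y ∧ t < -8 := by
  constructor
  · intro h
    rw [displacement] at h
    have h1 : 1 ≤ 1 / 2 * Metric.infDist t Xᶜ := h.symm.le.trans (min_le_left _ _)
    have h2 : 1 ≤ max (1 / 2) (1 - 1 / 2 * Metric.infDist t Y) := h.symm.le.trans (min_le_right _ _)
    have h3 : Metric.infDist t Y = 0 := by
      rcases le_max_iff.mp h2 with h2 | h2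
      · norm_num at h2
      · linarith [Metric.infDist_nonneg (x := t) (s := Y)]
    have htX : t ∈ X := by
      by_contra hX
      rw [Metric.infDist_zero_of_mem hX] at h1
      norm_num at h1
    have htY := mem_closure_Y (neg_of_mem_X htX)
      ((Metric.mem_closure_iff_infDist_zero Y_nonempty).mpr h3)
    refine ⟨htY, ?_⟩
    obtain ⟨k, hk⟩ := mem_iUnion.mp htY
    have hc : (0 : ℝ) < 2 ^ k := by positivity
    have hend : -7 * (2 : ℝ) ^ k ∈ Xᶜ ∧ -4 * (2 : ℝ) ^ k ∈ Xᶜ := by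
      have e : (2 : ℝ) ^ (k - 1) = 2 ^ k / 2 := by rw [zpow_sub_one₀ two_ne_zero]; rfl
      constructor
      · rw [mem_compl_iff, X_eq_shells, mem_shells_iff (by norm_num) (by norm_num) k
          (by rw [zpow_add_one₀ two_ne_zero]; linarith) (by linarith)]
        exact lt_irrefl _
      · rw [mem_compl_iff, X_eq_shells, mem_shells_iff (by norm_num) (by norm_num) (k - 1)
          (by rw [sub_add_cancel]) (by rw [e]; linarith), e]
        linarith
    have d1 := Metric.infDist_le_dist_of_mem (x := t) hend.1
    have d2 := Metric.infDist_le_dist_of_mem (x := t) hend.2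
    rw [Real.dist_eq, abs_of_nonneg (by linarith [hk.1])] at d1
    rw [Real.dist_eq, abs_of_nonpos (by linarith [hk.2])] at d2
    have hk1 : 1 ≤ k := by
      by_contra! hk0
      have : (2 : ℝ) ^ k ≤ 2 ^ (0 : ℤ) := zpow_le_zpow_right₀ one_le_two (by omega)
      rw [zpow_zero] at this
      linarith
    have : (2 : ℝ) ^ (1 : ℤ) ≤ 2 ^ k := zpow_le_zpow_right₀ one_le_two hk1
    rw [zpow_one] at this
    linarith [hk.2]
  · rintro ⟨htY, ht⟩
    obtain ⟨k, hk⟩ := mem_iUnion.mp htY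
    have hk1 : 1 ≤ k := by
      by_contra! hk0
      have : (2 : ℝ) ^ k ≤ 2 ^ (0 : ℤ) := zpow_le_zpow_right₀ one_le_two (by omega)
      rw [zpow_zero] at this
      linarith [hk.1]
    have h2 : (2 : ℝ) ^ (1 : ℤ) ≤ 2 ^ k := zpow_le_zpow_right₀ one_le_two hk1
    rw [zpow_one] at h2
    have h0 : (Xᶜ).Nonempty := ⟨0, zero_notMem_X⟩
    have hd : 2 ≤ Metric.infDist t Xᶜ := by
      refine (Metric.le_infDist h0).mpr fun s hs => ?_
      by_contra! hlt
      rw [Real.dist_eq, abs_lt] at hlt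
      exact hs (mem_iUnion.mpr ⟨k, by linarith [hk.1], by linarith [hk.2]⟩)
    rw [displacement, Metric.infDist_zero_of_mem htY]
    norm_num
    linarith

/-- The displacement of the profile `g₂`. -/
noncomputable def cutDisplacement (t : ℝ) : ℝ :=
  1 / 2 * min (1 / 2 * Metric.infDist t Yᶜ) (max 0 (-8 - t))

theorem lipschitz_cutDisplacement : LipschitzWith (1 / 2) cutDisplacement := by
  have h1 : LipschitzWith 1 fun t : ℝ => -8 - t := by
    have := (LipschitzWith.const (-8 : ℝ)).sub LipschitzWith.id
    rwa [zero_add] at this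
  have h2 := (lipschitz_half_infDist Yᶜ).min (h1.const_max 0)
  refine LipschitzWith.of_dist_le_mul fun s t => ?_
  have h3 := h2.dist_le_mul s t
  have e : max (1 / 2 : NNReal) 1 = 1 := max_eq_right (by
    rw [← NNReal.coe_le_coe]; push_cast; norm_num)
  rw [e] at h3
  simp only [Real.dist_eq, NNReal.coe_one, one_mul] at h3 ⊢
  rw [cutDisplacement, cutDisplacement, ← mul_sub, abs_mul]
  push_cast
  rw [abs_of_pos (by norm_num : (0 : ℝ) < 1 / 2)]
  linarith

theorem cutDisplacement_nonneg (t : ℝ) : 0 ≤ cutDisplacement t := by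
  have : 0 ≤ Metric.infDist t Yᶜ := Metric.infDist_nonneg
  rw [cutDisplacement]
  positivity

theorem cutDisplacement_ne_zero_iff {t : ℝ} :
    cutDisplacement t ≠ 0 ↔ t ∈ shells 5 6 ∧ t < -8 := by
  have h0 : (Yᶜ).Nonempty := ⟨0, zero_notMem_Y⟩
  have h1 : t ∈ shells 5 6 ↔ 0 < Metric.infDist t Yᶜ := by
    rw [infDist_pos_iff h0, closure_compl, notMem_compl_iff, interior_Y]
  rw [← (cutDisplacement_nonneg t).lt_iff_ne', h1, cutDisplacement]
  have h2 : 0 < max 0 (-8 - t) ↔ t < -8 := by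
    rw [lt_max_iff]
    constructor
    · rintro (h | h) <;> linarith
    · intro h; right; linarith
  rw [← h2, mul_pos_iff_of_pos_left (by norm_num), lt_min_iff,
    mul_pos_iff_of_pos_left (by norm_num)]

/-- The distance to the complement of `Y` is at most |t|, as 0 lies in it. So half of it is at most
-8 - t once t ≤ -16: there the cut is inactive and only a homogeneous distance remains. -/
theorem cutDisplacement_two_mul {t : ℝ} (ht : t ≤ -16) :
    cutDisplacement (2 * t) = 2 * cutDisplacement t := by
  have h : ∀ s ≤ (-16 : ℝ), cutDisplacement s = 1 / 2 * (1 / 2 * Metric.infDist s Yᶜ) := by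
    intro s hs
    have := Metric.infDist_le_dist_of_mem (x := s) (show (0 : ℝ) ∈ Yᶜ from zero_notMem_Y)
    rw [Real.dist_eq, sub_zero, abs_of_nonpos (by linarith)] at this
    rw [cutDisplacement, min_eq_left]
    exact le_max_of_le_right (by linarith)
  rw [h _ ht, h _ (by linarith), infDist_two_mul fun t => not_congr (two_mul_mem_Y_iff t)]
  ring

theorem closure_shells_large :
    closure {t : ℝ | t ∈ shells 5 6 ∧ t < -8} = {t | displacement t = 1} := by
  apply Subset.antisymm
  · refine closure_minimal ?_ (isClosed_eq lipschitz_displacement.continuous continuous_const)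
    rintro t ⟨h1, h2⟩
    rw [← interior_Y] at h1
    exact displacement_eq_one_iff.mpr ⟨interior_subset h1, h2⟩
  · intro t ht
    obtain ⟨htY, ht8⟩ := displacement_eq_one_iff.mp ht
    obtain ⟨k, hk⟩ := mem_iUnion.mp htY
    have hk1 : 1 ≤ k := by
      by_contra! hk0
      have : (2 : ℝ) ^ k ≤ 2 ^ (0 : ℤ) := zpow_le_zpow_right₀ one_le_two (by omega)
      rw [zpow_zero] at this
      linarith [hk.1]
    have h2 : (2 : ℝ) ^ (1 : ℤ) ≤ 2 ^ k := zpow_le_zpow_right₀ one_le_two hk1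
    rw [zpow_one] at h2
    have hsub : shell 5 6 k ⊆ {t : ℝ | t ∈ shells 5 6 ∧ t < -8} := fun s hs =>
      ⟨shell_subset_shells k hs, by linarith [hs.2]⟩
    refine closure_mono hsub ?_
    rwa [shell, closure_Ioo (by linarith)]

/-- The fixed points of f₂ = f₁⁻¹b are the points where f₁ has displacement exactly 1, that is, the
large components of `Y`. This is why g₂ must be cut off at -8, and why it commutes with doubling
only near -∞. -/
theorem exists_lineData : ∃ f₁ f₂ g₁ g₂ : ℝ ≃o ℝ, LineData dbl shift f₁ f₂ g₁ g₂ ∧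
    f₁ * f₂ = shift ∧ (∀ t, g₁ t ≤ t) ∧ (∀ t, g₂ t ≤ t) ∧
    (∀ t < 0, g₁ t ≠ t ↔ t ∈ shells (7 / 2) 4) ∧ (∀ t < -8, g₂ t ≠ t ↔ t ∈ shells 5 6) := by
  obtain ⟨f₁, hf₁⟩ := exists_orderIso_of_lipschitz lipschitz_displacement
  obtain ⟨g₁, hg₁⟩ := exists_orderIso_of_lipschitz (lipschitz_half_infDist X)
  obtain ⟨g₂, hg₂⟩ := exists_orderIso_of_lipschitz lipschitz_cutDisplacement
  have fix₁ : ∀ t, f₁ t = t ↔ t ∉ X := fun t => by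
    rw [hf₁, sub_eq_self, displacement_eq_zero_iff]
  have fix₂ : ∀ t, (f₁⁻¹ * shift) t = t ↔ displacement t = 1 := fun t => by
    change f₁.symm (shift t) = t ↔ _
    rw [OrderIso.symm_apply_eq, hf₁, shift_apply]
    constructor <;> intro h <;> linarith
  have mv₁ : ∀ t, g₁ t ≠ t ↔ t ∈ (closure X)ᶜ := fun t => by
    rw [hg₁, ne_eq, sub_eq_self, mem_compl_iff, ← infDist_pos_iff X_nonempty,
      Metric.infDist_nonneg.lt_iff_ne']
    simp
  have mv₂ : ∀ t, g₂ t ≠ t ↔ t ∈ shells 5 6 ∧ t < -8 := fun t => by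
    rw [hg₂, ne_eq, sub_eq_self, ← ne_eq, cutDisplacement_ne_zero_iff]
  refine ⟨f₁, f₁⁻¹ * shift, g₁, g₂, ?_, mul_inv_cancel_left _ _, ?_, ?_, ?_, ?_⟩
  · refine ⟨dbl_apply, shift_apply, fun t ht => (fix₁ t).mpr ht, ?_, fun _ => rfl, ?_, ?_, ?_, ?_⟩
    · filter_upwards [eventually_lt_atBot (-8)] with t ht htY
      rw [hf₁, shift_apply, displacement_eq_one_iff.mpr ⟨htY, ht⟩]
    · refine Eventually.of_forall fun t => ?_
      have hX : ∀ t, 2 * t ∈ X ↔ t ∈ X := fun t => two_mul_mem_shells_iff (P := 4) (Q := 7)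
      rw [hg₁, dbl_apply, dbl_apply, hg₁, infDist_two_mul hX]
      ring
    · filter_upwards [eventually_le_atBot (-16)] with t ht
      rw [hg₂, dbl_apply, dbl_apply, hg₂, cutDisplacement_two_mul ht]
      ring
    · simp only [mv₁, fix₁]
      exact closure_compl_closure_X
    · simp only [mv₂, fix₂]
      exact closure_shells_large
  · intro t
    rw [hg₁]
    linarith [Metric.infDist_nonneg (x := t) (s := X)]
  · intro t
    rw [hg₂]
    linarith [cutDisplacement_nonneg t]
  · intro t ht
    rw [mv₁, mem_compl_iff, not_mem_closure_X_iff ht]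
  · intro t ht
    rw [mv₂, and_iff_left ht]

end LineConstruction

/-! ### The topological example -/

section ContinuousCase

theorem radialGroup_le_G {n : ℕ} {r : WithTop ℕ∞} {a b f₁ f₂ g₁ g₂ : ℝ ≃o ℝ}
    (ha : radial n a ∈ DiffFix r n) (hb : radial n b ∈ DiffFix r n)
    (hf₁ : radial n f₁ ∈ DiffFix r n) (hf₂ : radial n f₂ ∈ DiffFix r n)
    (hg₁ : radial n g₁ ∈ DiffFix r n) (hg₂ : radial n g₂ ∈ DiffFix r n) :
    radialGroup n a b f₁ f₂ g₁ g₂ ≤ G r n := by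
  refine (Subgroup.closure_le _).mpr ?_
  have h : ∀ k : ℝ ≃o ℝ, radial n k ∈ DiffFix r n → rgerm n k ∈ G r n := fun k hk =>
    ⟨radial n k, ⟨hk, radial_mem_orientationPreserving k⟩, rfl⟩
  rintro x (rfl | rfl | rfl | rfl | rfl | rfl)
  exacts [h _ ha, h _ hb, h _ hf₁, h _ hf₂, h _ hg₁, h _ hg₂]

theorem mem_DiffFix_zero {n : ℕ} (f : HomeoFix n) : f ∈ DiffFix 0 n :=
  ⟨contDiff_zero.mpr f.1.continuous, contDiff_zero.mpr f.1.symm.continuous⟩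

theorem exists_continuous_example {n : ℕ} (hn : 1 ≤ n) :
    ∃ a b f₁ f₂ g₁ g₂ : ℝ ≃o ℝ, LineData a b f₁ f₂ g₁ g₂ ∧
      radialGroup n a b f₁ f₂ g₁ g₂ ≤ G 0 n ∧
      (radialGroup n a b f₁ f₂ g₁ g₂).FG ∧
      TorsionFree (radialGroup n a b f₁ f₂ g₁ g₂) ∧
      GenerateBS 1 2 (rgerm n a) (rgerm n b) ∧
      rgerm n f₁ * rgerm n f₂ = rgerm n b ∧
      Commute (rgerm n g₁) (rgerm n f₁) ∧ Commute (rgerm n g₂) (rgerm n f₂) ∧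
      Commute (rgerm n g₁) (rgerm n a) ∧ Commute (rgerm n g₂) (rgerm n a) ∧
      ¬ IsRealizable (radialGroup n a b f₁ f₂ g₁ g₂) := by
  obtain ⟨f₁, f₂, g₁, g₂, hL, hff, hle₁, hle₂, hg₁, hg₂⟩ := exists_lineData
  have fix₁ : ∀ t, g₁ t ≠ t → f₁ t = t := fun t ht => by
    have := subset_closure (s := {t | g₁ t ≠ t}) ht
    rwa [hL.g₁_supp] at this
  have fix₂ : ∀ t, g₂ t ≠ t → f₂ t = t := fun t ht => by
    have := subset_closure (s := {t | g₂ t ≠ t}) ht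
    rwa [hL.g₂_supp] at this
  have hff' : rgerm n f₁ * rgerm n f₂ = rgerm n shift := by rw [← rgerm_mul, hff]
  have c₁ : Commute (rgerm n g₁) (rgerm n f₁) :=
    commute_rgerm_of_disjoint (Eventually.of_forall fix₁)
  have c₂ : Commute (rgerm n g₂) (rgerm n f₂) :=
    commute_rgerm_of_disjoint (Eventually.of_forall fix₂)
  have ca : ∀ g : ℝ ≃o ℝ, (∀ᶠ t in atBot, g (dbl t) = dbl (g t)) →
      Commute (rgerm n g) (rgerm n dbl) := by
    intro g hg
    change _ * _ = _ * _
    rw [← rgerm_mul, ← rgerm_mul]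
    exact rgerm_eq_of_eventuallyEq hg
  have ca₁ := ca g₁ hL.g₁_comm
  have ca₂ := ca g₂ hL.g₂_comm
  have ev₁ : ∀ᶠ t in atBot, g₁ t ≠ t ↔ t ∈ shells (7 / 2) 4 :=
    (eventually_lt_atBot 0).mono hg₁
  have ev₂ : ∀ᶠ t in atBot, g₂ t ≠ t ↔ t ∈ shells 5 6 := (eventually_lt_atBot (-8)).mono hg₂
  refine ⟨dbl, shift, f₁, f₂, g₁, g₂, hL,
    radialGroup_le_G (mem_DiffFix_zero _) (mem_DiffFix_zero _) (mem_DiffFix_zero _)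
      (mem_DiffFix_zero _) (mem_DiffFix_zero _) (mem_DiffFix_zero _),
    radialGroup_fg _ _ _ _ _ _, torsionFree_radialGroup hn _ _ _ _ _ _, generateBS_rgerm hn, hff',
    c₁, c₂, ca₁, ca₂, ?_⟩
  refine not_isRealizable hn one_ne_zero hff' c₁ c₂ (by rw [pow_one, ca₁.eq])
    (by rw [pow_one, ca₂.eq]) (Eventually.of_forall hle₁) (Eventually.of_forall hle₂) ev₁ ev₂ ?_ ?_
  · filter_upwards [ev₁] with t h1 h2 using fix₁ t (h1.mpr h2)
  · filter_upwards [ev₂] with t h1 h2 using fix₂ t (h1.mpr h2)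

end ContinuousCase

/-! ### Derivative bounds for the smooth step function -/

section SmoothTransition

theorem differentiable_smoothTransition : Differentiable ℝ Real.smoothTransition :=
  (Real.smoothTransition.contDiff (n := 1)).differentiable (by norm_num)

theorem deriv_smoothTransition_nonneg (t : ℝ) : 0 ≤ deriv Real.smoothTransition t :=
  Real.smoothTransition.monotone.deriv_nonneg

theorem deriv_smoothTransition_of_neg {t : ℝ} (ht : t < 0) : deriv Real.smoothTransition t = 0 := by
  have : Real.smoothTransition =ᶠ[𝓝 t] fun _ => 0 := by
    filter_upwards [Iio_mem_nhds ht] with s hs using Real.smoothTransition.zero_of_nonpos hs.le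
  rw [this.deriv_eq, deriv_const]

theorem deriv_smoothTransition_of_one_lt {t : ℝ} (ht : 1 < t) :
    deriv Real.smoothTransition t = 0 := by
  have : Real.smoothTransition =ᶠ[𝓝 t] fun _ => 1 := by
    filter_upwards [Ioi_mem_nhds ht] with s hs using Real.smoothTransition.one_of_one_le hs.le
  rw [this.deriv_eq, deriv_const]

theorem exists_bound_deriv_smoothTransition :
    ∃ C, 0 < C ∧ ∀ t, |deriv Real.smoothTransition t| ≤ C := by
  have hc : Continuous (deriv Real.smoothTransition) :=
    (Real.smoothTransition.contDiff (n := 1)).continuous_deriv le_rfl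
  obtain ⟨C, hC⟩ := (isCompact_Icc (a := (0 : ℝ)) (b := 1)).exists_bound_of_continuousOn
    hc.continuousOn
  refine ⟨max C 1, by positivity, fun t => ?_⟩
  rcases lt_or_ge t 0 with h0 | h0
  · rw [deriv_smoothTransition_of_neg h0, abs_zero]; positivity
  rcases le_or_gt t 1 with h1 | h1
  · exact (hC t ⟨h0, h1⟩).trans (le_max_left _ _)
  · rw [deriv_smoothTransition_of_one_lt h1, abs_zero]; positivity

end SmoothTransition

/-! ### The doubly exponential coordinate -/

section Coordinate

/-- A smooth coordinate on the line, equal to `-exp (exp (-2 t))` on the negative half-line. -/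
noncomputable def coordFun (t : ℝ) : ℝ :=
  -Real.exp (Real.exp (-2 * t)) + t * Real.smoothTransition t

theorem coordFun_of_nonpos {t : ℝ} (ht : t ≤ 0) : coordFun t = -Real.exp (Real.exp (-2 * t)) := by
  rw [coordFun, Real.smoothTransition.zero_of_nonpos ht, mul_zero, add_zero]

theorem contDiff_coordFun : ContDiff ℝ ∞ coordFun := by
  have := Real.smoothTransition.contDiff (n := ⊤)
  unfold coordFun
  fun_prop

theorem deriv_coordFun_pos (t : ℝ) : 0 < deriv coordFun t := by
  have h1 : HasDerivAt (fun t : ℝ => -2 * t) (-2) t := by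
    simpa using (hasDerivAt_id t).const_mul (-2)
  have h2 := (differentiable_smoothTransition t).hasDerivAt
  have h3 : HasDerivAt coordFun _ t := (h1.exp.exp.neg).add ((hasDerivAt_id t).mul h2)
  rw [h3.deriv]
  have h4 : 0 ≤ t * deriv Real.smoothTransition t := by
    rcases lt_or_ge t 0 with h0 | h0
    · rw [deriv_smoothTransition_of_neg h0, mul_zero]
    · exact mul_nonneg h0 (deriv_smoothTransition_nonneg t)
  have h5 := Real.smoothTransition.nonneg t
  have h6 : 0 < Real.exp (Real.exp (-2 * t)) * Real.exp (-2 * t) := by positivity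
  simp only [id_eq, one_mul]
  nlinarith

/-- The smooth coordinate `coordFun` as an increasing homeomorphism. -/
noncomputable def coord : ℝ ≃o ℝ :=
  orderIsoOfTendsto coordFun (strictMono_of_deriv_pos deriv_coordFun_pos)
    contDiff_coordFun.continuous
    (by
      refine tendsto_atTop_mono' atTop (f₁ := fun t => t + -Real.exp 1) ?_
        (tendsto_atTop_add_const_right _ _ tendsto_id)
      filter_upwards [eventually_ge_atTop 1] with t ht
      have h1 : Real.exp (-2 * t) ≤ 1 := Real.exp_le_one_iff.mpr (by linarith)
      have h2 := Real.exp_le_exp.mpr h1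
      rw [coordFun, Real.smoothTransition.one_of_one_le ht]
      linarith)
    (by
      refine tendsto_atBot_mono' atBot (f₁ := fun t => t) ?_ tendsto_id
      filter_upwards [eventually_le_atBot 0] with t ht
      have h1 := Real.add_one_le_exp (-2 * t)
      have h2 := Real.add_one_le_exp (Real.exp (-2 * t))
      rw [coordFun_of_nonpos ht]
      linarith)

theorem coord_apply (t : ℝ) : coord t = coordFun t := rfl

/-- The inverse of an increasing smooth homeomorphism with positive derivative is smooth. -/
theorem contDiff_orderIso_symm {h : ℝ ≃o ℝ} (hs : ContDiff ℝ ∞ h) (hd : ∀ t, 0 < deriv h t) :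
    ContDiff ℝ ∞ h.symm :=
  h.toHomeomorph.contDiff_symm_deriv (fun t => (hd t).ne')
    (fun t => (hs.differentiable (by simp) t).hasDerivAt) hs

theorem contDiff_coord_symm : ContDiff ℝ ∞ coord.symm :=
  contDiff_orderIso_symm contDiff_coordFun deriv_coordFun_pos

theorem coord_symm_neg_exp_exp {t : ℝ} (ht : t ≤ 0) :
    coord.symm (-Real.exp (Real.exp (-2 * t))) = t := by
  rw [OrderIso.symm_apply_eq, coord_apply, coordFun_of_nonpos ht]

end Coordinate

/-! ### Smoothness at the origin of conjugated radial maps -/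

section RadialSmoothness

variable {n : ℕ}

theorem contDiffAt_radialFun {h : ℝ → ℝ} (hs : ContDiff ℝ ∞ h) {x : E n} (hx : x ≠ 0) :
    ContDiffAt ℝ ∞ (radialFun (n := n) h) x := by
  have h1 : ContDiffAt ℝ ∞ (fun y : E n => ‖y‖) x := contDiffAt_norm ℝ hx
  have h2 : ‖x‖ ≠ 0 := norm_ne_zero_iff.mpr hx
  have h3 := hs.contDiffAt.comp x (h1.log h2)
  exact (h3.exp.div h1 h2).smul contDiffAt_id

/-- Near `0`, a map which is asymptotically dilating in the coordinate `coord` extends smoothly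
as a radial map. -/
theorem radialFun_conj_eventuallyEq {h : ℝ ≃o ℝ} {J : ℝ → ℝ} (hJ : ContinuousAt J 0)
    (hJ0 : 0 < 1 + J 0)
    (hh : ∀ᶠ q in 𝓝[>] (0 : ℝ), h (-Real.exp q⁻¹) = -Real.exp q⁻¹ * (1 + J q)) :
    radialFun (n := n) (coord⁻¹ * h * coord : ℝ ≃o ℝ) =ᶠ[𝓝 0]
      fun x => (√(1 + ‖x‖ ^ 2 * Real.log (1 + J (‖x‖ ^ 2))))⁻¹ • x := by
  have hq : Tendsto (fun x : E n => ‖x‖ ^ 2) (𝓝 0) (𝓝 0) := by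
    have : Continuous fun x : E n => ‖x‖ ^ 2 := by fun_prop
    simpa using this.tendsto 0
  have hlog : Tendsto (fun q => Real.log (1 + J q)) (𝓝 0) (𝓝 (Real.log (1 + J 0))) :=
    ((hJ.const_add 1).log hJ0.ne')
  have hq1 : Tendsto (fun q => q * Real.log (1 + J q)) (𝓝 0) (𝓝 0) := by
    simpa using tendsto_id.mul hlog
  have e1 : ∀ᶠ q in 𝓝 (0 : ℝ), q - q * Real.log (1 + J q) < 1 := by
    have : Tendsto (fun q => q - q * Real.log (1 + J q)) (𝓝 0) (𝓝 0) := by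
      simpa using tendsto_id.sub hq1
    exact this.eventually_lt_const one_pos
  have e2 : ∀ᶠ q in 𝓝 (0 : ℝ), -1 < q * Real.log (1 + J q) :=
    hq1.eventually_const_lt (by norm_num)
  have e3 : ∀ᶠ q in 𝓝 (0 : ℝ), 0 < 1 + J q := (hJ.const_add 1).eventually_const_lt hJ0
  have e4 : ∀ᶠ q in 𝓝 (0 : ℝ), q < 1 := eventually_lt_nhds one_pos
  rw [eventually_nhdsWithin_iff] at hh
  filter_upwards [hq.eventually hh, hq.eventually e1, hq.eventually e2, hq.eventually e3,
    hq.eventually e4] with x h0 h1 h2 h3 h4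
  by_cases hx : x = 0
  · simp [hx, radialFun_zero]
  have hp : 0 < ‖x‖ := norm_pos_iff.mpr hx
  set q := ‖x‖ ^ 2 with hqdef
  have hqpos : 0 < q := by positivity
  set L := Real.log (1 + J q)
  have hlt : Real.log ‖x‖ ≤ 0 := by
    refine Real.log_nonpos hp.le ?_
    nlinarith
  have hexp : Real.exp (-2 * Real.log ‖x‖) = q⁻¹ := by
    rw [neg_mul, Real.exp_neg, two_mul, Real.exp_add, Real.exp_log hp, hqdef, sq]
  have hpos : 0 < 1 + q * L := by linarith
  have hval : (coord⁻¹ * h * coord : ℝ ≃o ℝ) (Real.log ‖x‖) =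
      Real.log (‖x‖ * (√(1 + q * L))⁻¹) := by
    change coord.symm (h (coord (Real.log ‖x‖))) = _
    rw [coord_apply, coordFun_of_nonpos hlt, hexp, h0 hqpos, ← Real.exp_log h3, neg_mul,
      ← Real.exp_add]
    have hr0 : 0 < ‖x‖ * (√(1 + q * L))⁻¹ := by positivity
    -- Multiplying -exp(1/q) by 1 + J adds L to 1/q, so the new squared norm is q / (1 + q L).
    have hs : q⁻¹ + L = Real.exp (-2 * Real.log (‖x‖ * (√(1 + q * L))⁻¹)) := by
      rw [neg_mul, Real.exp_neg, two_mul, Real.exp_add, Real.exp_log hr0, ← sq, mul_pow, inv_pow,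
        Real.sq_sqrt hpos.le, mul_inv, inv_inv, ← hqdef]
      field_simp
    have hr1 : Real.log (‖x‖ * (√(1 + q * L))⁻¹) ≤ 0 := by
      have h5 : (1 : ℝ) ≤ q⁻¹ + L := by
        have : q * 1 ≤ q * (q⁻¹ + L) := by
          rw [mul_add, mul_inv_cancel₀ hqpos.ne']; linarith
        exact le_of_mul_le_mul_left this hqpos
      rw [hs, Real.one_le_exp_iff] at h5
      linarith
    change coord.symm (-Real.exp (q⁻¹ + L)) = _
    rw [hs, coord_symm_neg_exp_exp hr1]
  rw [radialFun, hval, Real.exp_log (by positivity)]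
  congr 1
  field_simp

theorem contDiffAt_radial_model {J : ℝ → ℝ} (hJ : ContDiffAt ℝ ∞ J 0) (hJ0 : 0 < 1 + J 0) :
    ContDiffAt ℝ ∞ (fun x : E n => (√(1 + ‖x‖ ^ 2 * Real.log (1 + J (‖x‖ ^ 2))))⁻¹) 0 := by
  have hq : ContDiffAt ℝ ∞ (fun x : E n => ‖x‖ ^ 2) 0 := (contDiff_norm_sq ℝ).contDiffAt
  have e : ‖(0 : E n)‖ ^ 2 = 0 := by simp
  have hJ' : ContDiffAt ℝ ∞ (fun x : E n => J (‖x‖ ^ 2)) 0 := by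
    refine ContDiffAt.comp (0 : E n) ?_ hq
    rwa [e]
  have h1 : ContDiffAt ℝ ∞ (fun x : E n => Real.log (1 + J (‖x‖ ^ 2))) 0 := by
    refine (contDiffAt_const.add hJ').log ?_
    rw [e]; exact hJ0.ne'
  have h2 : ContDiffAt ℝ ∞ (fun x : E n => 1 + ‖x‖ ^ 2 * Real.log (1 + J (‖x‖ ^ 2))) 0 :=
    contDiffAt_const.add (hq.mul h1)
  have h3 : 1 + ‖(0 : E n)‖ ^ 2 * Real.log (1 + J (‖(0 : E n)‖ ^ 2)) ≠ 0 := by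
    rw [e, zero_mul, add_zero]; exact one_ne_zero
  exact (h2.sqrt h3).inv (by rw [e, zero_mul, add_zero, Real.sqrt_one]; exact one_ne_zero)

/-- Away from 0, smoothness is that of the profile. At 0 the map is a smooth scalar function with
value 1 times x, so its derivative is the identity and the inverse function theorem handles the
inverse. -/
theorem radial_conj_mem_DiffFix {h : ℝ ≃o ℝ} (hs : ContDiff ℝ ∞ h) (hd : ∀ t, 0 < deriv h t)
    {J : ℝ → ℝ} (hJ : ContDiffAt ℝ ∞ J 0) (hJ0 : 0 < 1 + J 0)
    (hh : ∀ᶠ q in 𝓝[>] (0 : ℝ), h (-Real.exp q⁻¹) = -Real.exp q⁻¹ * (1 + J q)) :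
    radial n (coord⁻¹ * h * coord) ∈ DiffFix ∞ n := by
  have hconj : ContDiff ℝ ∞ (coord⁻¹ * h * coord : ℝ ≃o ℝ) :=
    contDiff_coord_symm.comp (hs.comp contDiff_coordFun)
  have hconj' : ContDiff ℝ ∞ (coord⁻¹ * h * coord : ℝ ≃o ℝ).symm :=
    contDiff_coord_symm.comp ((contDiff_orderIso_symm hs hd).comp contDiff_coordFun)
  have heq := radialFun_conj_eventuallyEq (n := n) hJ.continuousAt hJ0 hh
  have hmod := contDiffAt_radial_model (n := n) hJ hJ0
  have h0 : ContDiffAt ℝ ∞ (radial n (coord⁻¹ * h * coord)).1 0 :=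
    (hmod.smul contDiffAt_id).congr_of_eventuallyEq heq
  have hder : HasFDerivAt (radial n (coord⁻¹ * h * coord)).1
      ((ContinuousLinearEquiv.refl ℝ (E n) : E n ≃L[ℝ] E n) : E n →L[ℝ] E n) 0 := by
    have h1 := (hmod.differentiableAt (by simp)).hasFDerivAt.smul (hasFDerivAt_id (0 : E n))
    refine HasFDerivAt.congr_of_eventuallyEq (h1.congr_fderiv ?_) heq
    ext v
    simp
  refine ⟨contDiff_iff_contDiffAt.mpr fun x => ?_, contDiff_iff_contDiffAt.mpr fun x => ?_⟩
  · by_cases hx : x = 0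
    · rw [hx]; exact h0
    · exact contDiffAt_radialFun hconj hx
  · by_cases hx : x = 0
    · rw [hx]
      have e : (radial n (coord⁻¹ * h * coord)).1.symm 0 = 0 :=
        HomeoFix.map_zero (radial n (coord⁻¹ * h * coord))⁻¹
      refine (radial n (coord⁻¹ * h * coord)).1.toOpenPartialHomeomorph.contDiffAt_symm
        (f₀' := ContinuousLinearEquiv.refl ℝ (E n)) (mem_univ _) ?_ ?_
      · change HasFDerivAt _ _ ((radial n (coord⁻¹ * h * coord)).1.symm 0)
        rw [e]; exact hder
      · change ContDiffAt ℝ ∞ _ ((radial n (coord⁻¹ * h * coord)).1.symm 0)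
        rw [e]; exact h0
    · exact contDiffAt_radialFun hconj' hx

theorem radial_conj_dbl_mem_DiffFix : radial n (coord⁻¹ * dbl * coord) ∈ DiffFix ∞ n := by
  refine radial_conj_mem_DiffFix (J := fun _ => 1) ?_ (fun t => ?_) contDiffAt_const (by norm_num)
    (Eventually.of_forall fun q => ?_)
  · exact contDiff_const.mul contDiff_id
  · have : HasDerivAt dbl (2 * 1) t := (hasDerivAt_id t).const_mul (2 : ℝ)
    rw [this.deriv]; norm_num
  · rw [dbl_apply]; ring

theorem radial_conj_shift_mem_DiffFix : radial n (coord⁻¹ * shift * coord) ∈ DiffFix ∞ n := by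
  refine radial_conj_mem_DiffFix (J := expNegInvGlue) ?_ (fun t => ?_)
    expNegInvGlue.contDiff.contDiffAt (by rw [expNegInvGlue.zero]; norm_num) ?_
  · exact contDiff_id.add contDiff_const
  · have : HasDerivAt shift 1 t := (hasDerivAt_id t).add_const _
    rw [this.deriv]; norm_num
  -- With t = -exp(1/q), the shift is t - 1 = t (1 + exp(-1/q)).
  · filter_upwards [self_mem_nhdsWithin] with q hq
    rw [shift_apply, expNegInvGlue, if_neg (not_le.mpr hq), mul_add, neg_mul _ (Real.exp _),
      ← Real.exp_add]
    simp [sub_eq_add_neg]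

end RadialSmoothness

/-! ### Flat functions from periodic ones -/

section Flat

/-- Smooth functions of `(ε, u)` which are periodic in `u` and vanish for `ε = 0`. -/
structure FlatPeriodic (N : ℝ × ℝ → ℝ) : Prop where
  contDiff : ContDiff ℝ ∞ N
  periodic : ∀ ε u, N (ε, u + Real.log 2) = N (ε, u)
  zero : ∀ u, N (0, u) = 0

variable {N : ℝ × ℝ → ℝ}

/-- The derivative of `N` along the vector field `ε ∂_ε - ∂_u`. -/
noncomputable def flatDeriv (N : ℝ × ℝ → ℝ) (p : ℝ × ℝ) : ℝ := fderiv ℝ N p (p.1, -1)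

theorem FlatPeriodic.flatDeriv (hN : FlatPeriodic N) : FlatPeriodic (flatDeriv N) where
  contDiff := by
    have h1 : ContDiff ℝ ∞ (fderiv ℝ N) := hN.contDiff.fderiv_right (by simp)
    unfold GermSection.flatDeriv
    exact h1.clm_apply (contDiff_fst.prodMk contDiff_const)
  periodic ε u := by
    have h : (fun p : ℝ × ℝ => N (p + (0, Real.log 2))) = N := by
      ext ⟨ε, u⟩
      simpa using hN.periodic ε u
    have := fderiv_comp_add_right (𝕜 := ℝ) (f := N) (x := (ε, u)) (0, Real.log 2)
    rw [h, Prod.mk_add_mk, add_zero] at this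
    rw [GermSection.flatDeriv, GermSection.flatDeriv, ← this]
  zero u := by
    have h1 : HasFDerivAt N (fderiv ℝ N (0, u)) (0, u) :=
      (hN.contDiff.differentiable (by simp) _).hasFDerivAt
    have h2 : HasDerivAt (fun s : ℝ => ((0 : ℝ), u - s)) ((0 : ℝ), -1) 0 :=
      (hasDerivAt_const _ _).prodMk ((hasDerivAt_id _).const_sub u)
    have h3 : HasDerivAt (N ∘ fun s : ℝ => ((0 : ℝ), u - s)) (fderiv ℝ N (0, u) (0, -1)) 0 := by
      refine HasFDerivAt.comp_hasDerivAt (0 : ℝ) ?_ h2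
      rwa [sub_zero]
    have h4 : (N ∘ fun s : ℝ => ((0 : ℝ), u - s)) = fun _ => 0 := by
      ext s; exact hN.zero _
    rw [h4] at h3
    exact h3.unique (hasDerivAt_const _ _)

theorem FlatPeriodic.periodic_int (hN : FlatPeriodic N) (ε u : ℝ) (k : ℤ) :
    N (ε, u - k * Real.log 2) = N (ε, u) :=
  Function.Periodic.sub_int_mul_eq (f := fun u => N (ε, u)) (hN.periodic ε) k

/-- Periodicity reduces u to a compact interval, on which the derivative is bounded; the mean value
inequality starting from ε = 0 gives the factor ε. -/
theorem FlatPeriodic.exists_bound (hN : FlatPeriodic N) :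
    ∃ C, 0 < C ∧ ∀ ε ∈ Icc (0 : ℝ) 1, ∀ u, |N (ε, u)| ≤ C * ε := by
  have hc : Continuous fun p => ‖fderiv ℝ N p‖ :=
    (hN.contDiff.continuous_fderiv (by simp)).norm
  have hl : 0 < Real.log 2 := Real.log_pos one_lt_two
  set K : Set (ℝ × ℝ) := Icc 0 1 ×ˢ Icc 0 (Real.log 2)
  have hK : IsCompact K := isCompact_Icc.prod isCompact_Icc
  obtain ⟨C, hC⟩ := hK.exists_bound_of_continuousOn hc.continuousOn
  refine ⟨max C 1, by positivity, fun ε hε u => ?_⟩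
  obtain ⟨k, v, hv, hkv⟩ : ∃ (k : ℤ) (v : ℝ), v ∈ Icc 0 (Real.log 2) ∧
      u - k * Real.log 2 = v := by
    refine ⟨toIcoDiv hl 0 u, _, ?_, rfl⟩
    have := sub_toIcoDiv_zsmul_mem_Ico hl 0 u
    rw [zsmul_eq_mul, zero_add] at this
    exact Ico_subset_Icc_self this
  rw [← hN.periodic_int ε u k, hkv]
  have hconv : Convex ℝ K := (convex_Icc _ _).prod (convex_Icc _ _)
  have := hconv.norm_image_sub_le_of_norm_fderiv_le (f := N) (𝕜 := ℝ) (C := max C 1)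
    (fun p _ => hN.contDiff.differentiable (by simp) p)
    (fun p hp => by
      have := hC p hp
      rw [norm_norm] at this
      exact this.trans (le_max_left _ _))
    (show ((0 : ℝ), v) ∈ K from ⟨⟨le_rfl, zero_le_one⟩, hv⟩)
    (show ((ε : ℝ), v) ∈ K from ⟨hε, hv⟩)
  rw [hN.zero, sub_zero, Prod.mk_sub_mk, sub_zero, sub_self, Prod.norm_mk, norm_zero,
    Real.norm_eq_abs, Real.norm_eq_abs, abs_of_nonneg hε.1, max_eq_left hε.1] at this
  exact this

/-- The functions `q ↦ q⁻ᵐ N(exp(-1/q), 1/q)`, extended by `0` to `q ≤ 0`. -/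
noncomputable def flatFun (m : ℕ) (N : ℝ × ℝ → ℝ) (q : ℝ) : ℝ :=
  q⁻¹ ^ m * N (expNegInvGlue q, q⁻¹)

theorem expNegInvGlue_le_one (q : ℝ) : expNegInvGlue q ≤ 1 := by
  rw [expNegInvGlue]
  split_ifs with h
  · exact zero_le_one
  · rw [Real.exp_le_one_iff, neg_nonpos, inv_nonneg]
    exact (not_le.mp h).le

/-- The derivative stays in the same family of functions. Away from 0 this is the chain rule, since
(exp(-1/q), 1/q) has velocity q⁻² (ε, -1) for q > 0, which is the field defining `flatDeriv`. At 0
the bound |N| ≤ C ε with ε = exp(-1/q) beats every power of 1/q. -/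
theorem FlatPeriodic.hasDerivAt_flatFun (hN : FlatPeriodic N) (m : ℕ) (q : ℝ) :
    HasDerivAt (flatFun m N)
      (-m * flatFun (m + 1) N q + flatFun (m + 2) (GermSection.flatDeriv N) q) q := by
  rcases eq_or_ne q 0 with rfl | hq
  · have e : -(m : ℝ) * flatFun (m + 1) N 0 + flatFun (m + 2) (GermSection.flatDeriv N) 0 = 0 := by
      simp [flatFun]
    rw [e, hasDerivAt_iff_tendsto_slope]
    obtain ⟨C, hC, hb⟩ := hN.exists_bound
    have h1 : Tendsto (fun q : ℝ => C * |q⁻¹ ^ (m + 1) * expNegInvGlue q|) (𝓝[≠] 0) (𝓝 0) := by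
      have := ((expNegInvGlue.tendsto_polynomial_inv_mul_zero (Polynomial.X ^ (m + 1))).abs.const_mul
        C).mono_left (nhdsWithin_le_nhds (s := {0}ᶜ))
      simpa using this
    refine squeeze_zero_norm (fun q => ?_) h1
    have h0 : flatFun m N 0 = 0 := by
      rw [flatFun, expNegInvGlue.zero, hN.zero, mul_zero]
    have hbq := hb (expNegInvGlue q) ⟨expNegInvGlue.nonneg q, expNegInvGlue_le_one q⟩ q⁻¹
    rw [slope_def_field, h0, sub_zero, sub_zero, flatFun, Real.norm_eq_abs, div_eq_mul_inv,
      abs_mul, abs_mul, abs_mul, abs_of_nonneg (expNegInvGlue.nonneg q), pow_succ, abs_mul]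
    calc |q⁻¹ ^ m| * |N (expNegInvGlue q, q⁻¹)| * |q⁻¹|
        ≤ |q⁻¹ ^ m| * (C * expNegInvGlue q) * |q⁻¹| := by gcongr
      _ = C * (|q⁻¹ ^ m| * |q⁻¹| * expNegInvGlue q) := by ring
  · have h1 : HasDerivAt expNegInvGlue (q⁻¹ ^ 2 * expNegInvGlue q) q := by
      simpa using expNegInvGlue.hasDerivAt_polynomial_eval_inv_mul 1 q
    have h2 : HasDerivAt (fun q : ℝ => q⁻¹) (-(q ^ 2)⁻¹) q := hasDerivAt_inv hq
    have h3 : HasFDerivAt N (fderiv ℝ N (expNegInvGlue q, q⁻¹)) (expNegInvGlue q, q⁻¹) :=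
      (hN.contDiff.differentiable (by simp) _).hasFDerivAt
    have h4 := (h2.pow m).mul (h3.comp_hasDerivAt q (h1.prodMk h2))
    refine h4.congr_deriv ?_
    have e : (q⁻¹ ^ 2 * expNegInvGlue q, -(q ^ 2)⁻¹) =
        q⁻¹ ^ 2 • (expNegInvGlue q, (-1 : ℝ)) := by
      rw [Prod.smul_mk, smul_eq_mul, smul_eq_mul, inv_pow]; ring_nf
    rw [e, map_smul, smul_eq_mul]
    simp only [flatFun, GermSection.flatDeriv, Pi.pow_apply, Function.comp_apply]
    rcases m with _ | m
    · simp
    · rw [Nat.add_sub_cancel, ← inv_pow]; push_cast; ring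

/-- Induction on the order of smoothness, simultaneously for all `m` and `N`, because
differentiation changes both. -/
theorem FlatPeriodic.contDiff_flatFun (hN : FlatPeriodic N) (m : ℕ) :
    ContDiff ℝ ∞ (flatFun m N) := by
  rw [contDiff_infty]
  intro k
  induction k generalizing m N with
  | zero =>
    refine contDiff_zero.mpr (Differentiable.continuous (𝕜 := ℝ) fun q => ?_)
    exact (hN.hasDerivAt_flatFun m q).differentiableAt
  | succ k ih =>
    have hd : deriv (flatFun m N) =
        fun q => -m * flatFun (m + 1) N q + flatFun (m + 2) (GermSection.flatDeriv N) q :=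
      funext fun q => (hN.hasDerivAt_flatFun m q).deriv
    push_cast
    rw [contDiff_succ_iff_deriv]
    refine ⟨fun q => (hN.hasDerivAt_flatFun m q).differentiableAt, by simp, ?_⟩
    rw [hd]
    exact (contDiff_const.mul (ih hN (m + 1))).add (ih hN.flatDeriv (m + 2))

end Flat

/-! ### From periodic data to smooth profiles -/

section Realization

/-- A function which is smooth near `-∞`, bounded, and with derivative tending to `0`, is near `-∞`
the displacement of a smooth diffeomorphism of the line. -/
theorem exists_smooth_orderIso {δ δ' : ℝ → ℝ} (hs : ∀ t < -1, ContDiffAt ℝ ∞ δ t) {C : ℝ}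
    (hC : ∀ t < -1, |δ t| ≤ C) (hder : ∀ t < -1, HasDerivAt δ (δ' t) t)
    (hd : ∀ᶠ t in atBot, |δ' t| ≤ 1 / 4) :
    ∃ h : ℝ ≃o ℝ, ContDiff ℝ ∞ h ∧ (∀ t, 0 < deriv h t) ∧ ∀ᶠ t in atBot, h t = t + δ t := by
  obtain ⟨M, hM, hMb⟩ := exists_bound_deriv_smoothTransition
  obtain ⟨T₀, hT₀⟩ := eventually_atBot.mp hd
  have hC0 : 0 ≤ C := (abs_nonneg _).trans (hC (-2) (by norm_num))
  -- The cutoff is spread over [-2T, -T], so its slope is at most M / T; the bound `4 * (M * C) ≤ T`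
  -- makes its contribution to the derivative at most 1/4. The term with `δ'` contributes at most
  -- 1/4 more, so the derivative remains positive.
  set T := max (max 2 (-T₀)) (4 * (M * C))
  have hT2 : 2 ≤ T := (le_max_left _ _).trans (le_max_left _ _)
  have hTT₀ : -T₀ ≤ T := (le_max_right _ _).trans (le_max_left _ _)
  have hTM : 4 * (M * C) ≤ T := le_max_right _ _
  have hTpos : 0 < T := by linarith
  set χ : ℝ → ℝ := fun t => Real.smoothTransition (-t / T - 1) with hχ
  set f : ℝ → ℝ := fun t => t + χ t * δ t with hf
  have hχ0 : ∀ t, -T ≤ t → χ t = 0 := fun t ht => by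
    refine Real.smoothTransition.zero_of_nonpos ?_
    rw [sub_nonpos, div_le_one hTpos]; linarith
  have hχ1 : ∀ t, t ≤ -(2 * T) → χ t = 1 := fun t ht => by
    refine Real.smoothTransition.one_of_one_le ?_
    rw [le_sub_iff_add_le, le_div_iff₀ hTpos]; linarith
  have hχs : ContDiff ℝ ∞ χ := by
    have := Real.smoothTransition.contDiff (n := ⊤)
    exact this.comp (by fun_prop)
  have hflat : ∀ t, -T < t → f =ᶠ[𝓝 t] id := fun t ht => by
    filter_upwards [Ioi_mem_nhds ht] with s hs
    rw [hf, id]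
    simp only
    rw [hχ0 s (le_of_lt hs), zero_mul, add_zero]
  have hfs : ContDiff ℝ ∞ f := contDiff_iff_contDiffAt.mpr fun t => by
    rcases lt_or_ge (-T) t with ht | ht
    · exact contDiffAt_id.congr_of_eventuallyEq (hflat t ht)
    · exact contDiffAt_id.add (hχs.contDiffAt.mul (hs t (by linarith)))
  have hfd : ∀ t, 0 < deriv f t := fun t => by
    rcases lt_or_ge (-T) t with ht | ht
    · rw [(hflat t ht).deriv_eq, deriv_id]; exact one_pos
    · have h1 : HasDerivAt (fun t => -t / T - 1) (-1 / T) t :=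
        (((hasDerivAt_id t).neg).div_const T).sub_const 1
      have h2 := (differentiable_smoothTransition (-t / T - 1)).hasDerivAt.comp t h1
      have ht1 : t < -1 := by linarith
      have h3 : HasDerivAt f _ t := (hasDerivAt_id t).add (h2.mul (hder t ht1))
      rw [h3.deriv]
      have b1 : |deriv Real.smoothTransition (-t / T - 1) * (-1 / T) * δ t| ≤ 1 / 4 := by
        rw [abs_mul, abs_mul, abs_div, abs_neg, abs_one, abs_of_pos hTpos]
        calc |deriv Real.smoothTransition (-t / T - 1)| * (1 / T) * |δ t|
            ≤ M * (1 / T) * C := by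
              gcongr
              · exact hMb _
              · exact hC t ht1
          _ = (M * C) / T := by ring
          _ ≤ 1 / 4 := by rw [div_le_iff₀ hTpos]; linarith
      have b2 : |(Real.smoothTransition ∘ fun t => -t / T - 1) t * δ' t| ≤ 1 / 4 := by
        rw [abs_mul, Function.comp_apply, abs_of_nonneg (Real.smoothTransition.nonneg _)]
        have := hT₀ t (by linarith)
        have h5 := Real.smoothTransition.le_one (-t / T - 1)
        have h6 := Real.smoothTransition.nonneg (-t / T - 1)
        nlinarith [abs_nonneg (δ' t)]
      have c1 := (abs_le.mp b1).1
      have c2 := (abs_le.mp b2).1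
      linarith
  have hbd : ∀ t, |χ t * δ t| ≤ C := fun t => by
    rcases le_or_gt (-T) t with ht | ht
    · rw [hχ0 t ht, zero_mul, abs_zero]; exact hC0
    · rw [abs_mul, abs_of_nonneg (Real.smoothTransition.nonneg _)]
      have h5 := Real.smoothTransition.le_one (-t / T - 1)
      have h6 := Real.smoothTransition.nonneg (-t / T - 1)
      have := hC t (by linarith)
      nlinarith [abs_nonneg (δ t)]
  refine ⟨orderIsoOfTendsto f (strictMono_of_deriv_pos hfd) hfs.continuous ?_ ?_, hfs, hfd, ?_⟩
  · refine tendsto_atTop_mono (f := fun t => t + -C) (fun t => ?_)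
      (tendsto_atTop_add_const_right _ _ tendsto_id)
    have := (abs_le.mp (hbd t)).1
    rw [hf]; simp only; linarith
  · refine tendsto_atBot_mono (f := fun t => t + C) (fun t => ?_)
      (tendsto_atBot_add_const_right _ _ tendsto_id)
    have := (abs_le.mp (hbd t)).2
    rw [hf]; simp only; linarith
  · filter_upwards [eventually_le_atBot (-(2 * T))] with t ht
    rw [orderIsoOfTendsto_apply, hf]
    simp only
    rw [hχ1 t ht, one_mul]

/-- The germ at `-∞` of `t ↦ t (1 + N(-1/t, log(-t)))` is, in the coordinate `coord`, the germ of a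
radial diffeomorphism. -/
theorem FlatPeriodic.exists_profile {N : ℝ × ℝ → ℝ} (hN : FlatPeriodic N) :
    ∃ h : ℝ ≃o ℝ, (∀ n, radial n (coord⁻¹ * h * coord) ∈ DiffFix ∞ n) ∧
      ∀ᶠ t in atBot, h t = t * (1 + N (-t⁻¹, Real.log (-t))) := by
  obtain ⟨C, hC, hCb⟩ := hN.exists_bound
  obtain ⟨C', hC', hCb'⟩ := hN.flatDeriv.exists_bound
  have hmem : ∀ t < (-1 : ℝ), -t⁻¹ ∈ Icc (0 : ℝ) 1 := fun t ht => by
    rw [← inv_neg]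
    exact ⟨inv_nonneg.mpr (by linarith), inv_le_one_of_one_le₀ (by linarith)⟩
  have hs : ∀ t < (-1 : ℝ), ContDiffAt ℝ ∞ (fun t => t * N (-t⁻¹, Real.log (-t))) t := by
    intro t ht
    have h0 : t ≠ 0 := by linarith
    have h1 : ContDiffAt ℝ ∞ (fun t : ℝ => (-t⁻¹, Real.log (-t))) t :=
      ((contDiffAt_inv ℝ h0).neg).prodMk (contDiffAt_id.neg.log (neg_ne_zero.mpr h0))
    exact contDiffAt_id.mul (hN.contDiff.contDiffAt.comp t h1)
  have hder : ∀ t < (-1 : ℝ), HasDerivAt (fun t => t * N (-t⁻¹, Real.log (-t)))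
      (N (-t⁻¹, Real.log (-t)) - GermSection.flatDeriv N (-t⁻¹, Real.log (-t))) t := by
    intro t ht
    have h0 : t ≠ 0 := by linarith
    have h1 : HasDerivAt (fun t : ℝ => (-t⁻¹, Real.log (-t))) (- -(t ^ 2)⁻¹, -1 / -t) t :=
      ((hasDerivAt_inv h0).neg).prodMk ((hasDerivAt_id t).neg.log (neg_ne_zero.mpr h0))
    have h2 : HasFDerivAt N (fderiv ℝ N (-t⁻¹, Real.log (-t))) (-t⁻¹, Real.log (-t)) :=
      (hN.contDiff.differentiable (by simp) _).hasFDerivAt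
    have h3 := (hasDerivAt_id t).mul (h2.comp_hasDerivAt t h1)
    refine h3.congr_deriv ?_
    -- The curve (-1/t, log(-t)) also runs along the field of `flatDeriv`. The factor -1/t cancels
    -- the t in front of N, so the derivative of the displacement is N minus `flatDeriv N`, which
    -- tends to 0.
    have e : (- -(t ^ 2)⁻¹, -1 / -t) = (-t⁻¹) • (-t⁻¹, (-1 : ℝ)) := by
      rw [Prod.smul_mk, smul_eq_mul, smul_eq_mul]
      congr 1 <;> field_simp
    rw [e, map_smul, smul_eq_mul, GermSection.flatDeriv]
    simp only [id_eq, one_mul, Function.comp_apply]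
    field_simp
    ring
  have hbd : ∀ t < (-1 : ℝ), |t * N (-t⁻¹, Real.log (-t))| ≤ C := by
    intro t ht
    have h0 : t < 0 := by linarith
    have := hCb _ (hmem t ht) (Real.log (-t))
    rw [abs_mul, abs_of_neg h0]
    calc -t * |N (-t⁻¹, Real.log (-t))| ≤ -t * (C * -t⁻¹) := by
          gcongr; linarith
      _ = C := by
        have := h0.ne
        field_simp
  have hd : ∀ᶠ t in atBot, |N (-t⁻¹, Real.log (-t)) -
      GermSection.flatDeriv N (-t⁻¹, Real.log (-t))| ≤ 1 / 4 := by
    have ht : Tendsto (fun t : ℝ => (C + C') * -t⁻¹) atBot (𝓝 0) := by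
      simpa using (tendsto_inv_atBot_zero (𝕜 := ℝ)).neg.const_mul (C + C')
    filter_upwards [ht.eventually_lt_const (show (0 : ℝ) < 1 / 4 by norm_num),
      eventually_lt_atBot (-1)] with t h1 h2
    have b1 := hCb _ (hmem t h2) (Real.log (-t))
    have b2 := hCb' _ (hmem t h2) (Real.log (-t))
    refine (abs_sub _ _).trans ?_
    linarith
  obtain ⟨h, hh, hh', hev⟩ := exists_smooth_orderIso hs hbd hder hd
  refine ⟨h, fun n => ?_, ?_⟩
  · refine radial_conj_mem_DiffFix hh hh' (J := flatFun 0 N) (hN.contDiff_flatFun 0).contDiffAt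
      ?_ ?_
    · rw [flatFun, expNegInvGlue.zero, hN.zero]; norm_num
    · have ht : Tendsto (fun q : ℝ => -Real.exp q⁻¹) (𝓝[>] 0) atBot :=
        tendsto_neg_atTop_atBot.comp (Real.tendsto_exp_atTop.comp tendsto_inv_nhdsGT_zero)
      filter_upwards [ht.eventually hev, self_mem_nhdsWithin] with q hq hq0
      rw [hq, flatFun, pow_zero, one_mul, neg_neg, Real.log_exp, expNegInvGlue,
        if_neg (not_le.mpr hq0), inv_neg, neg_neg, ← Real.exp_neg]
      ring
  · filter_upwards [hev] with t ht
    rw [ht]; ring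

end Realization

/-! ### A smooth flow supported on a compact interval -/

section IntervalFlow

theorem smoothTransition_one_sub (t : ℝ) :
    Real.smoothTransition (1 - t) = 1 - Real.smoothTransition t := by
  have h := Real.smoothTransition.pos_denom t
  rw [Real.smoothTransition, Real.smoothTransition, sub_sub_cancel, add_comm (expNegInvGlue (1 - t)),
    eq_sub_iff_add_eq, ← add_div, add_comm (expNegInvGlue (1 - t)), div_self h.ne']

/-- A diffeomorphism from `(0, 1)` to the line, with the exact expressions `-exp (1 / y)` near `0`
and `exp (1 / (1 - y))` near `1`. -/
noncomputable def unroll (y : ℝ) : ℝ :=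
  -Real.exp y⁻¹ * (1 - Real.smoothTransition (3 * y - 1)) +
    Real.exp (1 - y)⁻¹ * Real.smoothTransition (3 * y - 1)

theorem unroll_one_sub (y : ℝ) : unroll (1 - y) = -unroll y := by
  have h : Real.smoothTransition (3 * (1 - y) - 1) = 1 - Real.smoothTransition (3 * y - 1) := by
    rw [← smoothTransition_one_sub]; ring_nf
  have e : 1 - (1 - y) = y := sub_sub_cancel 1 y
  rw [unroll, unroll, h, e]
  ring

theorem unroll_of_le {y : ℝ} (hy : y ≤ 1 / 3) : unroll y = -Real.exp y⁻¹ := by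
  rw [unroll, Real.smoothTransition.zero_of_nonpos (by linarith)]
  ring

theorem contDiffAt_unroll {y : ℝ} (hy : y ∈ Ioo (0 : ℝ) 1) : ContDiffAt ℝ ∞ unroll y := by
  have h1 : ContDiffAt ℝ ∞ (fun y : ℝ => y⁻¹) y := contDiffAt_inv ℝ hy.1.ne'
  have h2 : ContDiffAt ℝ ∞ (fun y : ℝ => (1 - y)⁻¹) y :=
    (contDiffAt_const.sub contDiffAt_id).inv (sub_pos.mpr hy.2).ne'
  have h3 : ContDiffAt ℝ ∞ (fun y : ℝ => Real.smoothTransition (3 * y - 1)) y :=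
    ((Real.smoothTransition.contDiff (n := ⊤)).comp (by fun_prop)).contDiffAt
  exact (h1.exp.neg.mul (contDiffAt_const.sub h3)).add (h2.exp.mul h3)

theorem deriv_unroll_pos {y : ℝ} (hy : y ∈ Ioo (0 : ℝ) 1) : 0 < deriv unroll y := by
  have hy1 : 0 < 1 - y := sub_pos.mpr hy.2
  have h1 : HasDerivAt (fun y : ℝ => y⁻¹) (-(y ^ 2)⁻¹) y := hasDerivAt_inv hy.1.ne'
  have h2 : HasDerivAt (fun y : ℝ => (1 - y)⁻¹) (-(-1) / (1 - y) ^ 2) y :=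
    ((hasDerivAt_id y).const_sub 1).inv hy1.ne'
  have h3 : HasDerivAt (fun y : ℝ => 3 * y - 1) 3 y := by
    simpa using ((hasDerivAt_id y).const_mul (3 : ℝ)).sub_const 1
  have h4 := (differentiable_smoothTransition (3 * y - 1)).hasDerivAt.comp y h3
  have h5 : HasDerivAt unroll _ y := (h1.exp.neg.mul (h4.const_sub 1)).add (h2.exp.mul h4)
  rw [h5.deriv]
  simp only [Function.comp_apply, Pi.neg_apply]
  have hd := deriv_smoothTransition_nonneg (3 * y - 1)
  have hs0 := Real.smoothTransition.nonneg (3 * y - 1)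
  have hs1 := Real.smoothTransition.le_one (3 * y - 1)
  set χ := Real.smoothTransition (3 * y - 1)
  set χ' := deriv Real.smoothTransition (3 * y - 1)
  have hA : 0 < Real.exp y⁻¹ * (y ^ 2)⁻¹ := by have := hy.1; positivity
  have hB : 0 < Real.exp (1 - y)⁻¹ * (1 / (1 - y) ^ 2) := by positivity
  have hC : 0 ≤ χ' * (3 * Real.exp y⁻¹ + 3 * Real.exp (1 - y)⁻¹) := by positivity
  have key : 0 < (1 - χ) * (Real.exp y⁻¹ * (y ^ 2)⁻¹) +
      χ * (Real.exp (1 - y)⁻¹ * (1 / (1 - y) ^ 2)) := by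
    rcases hs0.eq_or_lt with h0 | h0
    · rw [← h0]; linarith
    · have := mul_nonneg (sub_nonneg.mpr hs1) hA.le
      have := mul_pos h0 hB
      linarith
  rw [neg_neg]
  linarith

theorem continuousOn_unroll : ContinuousOn unroll (Ioo 0 1) := fun _ hy =>
  (contDiffAt_unroll hy).continuousAt.continuousWithinAt

theorem strictMonoOn_unroll : StrictMonoOn unroll (Ioo 0 1) :=
  strictMonoOn_of_deriv_pos (convex_Ioo _ _) continuousOn_unroll fun y hy => by
    rw [interior_Ioo] at hy
    exact deriv_unroll_pos hy

theorem exists_unroll_le (c : ℝ) : ∃ y ∈ Ioc (0 : ℝ) (1 / 3), unroll y ≤ c := by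
  have h0 : 0 ≤ |c| := abs_nonneg c
  refine ⟨(3 + |c|)⁻¹, ⟨by positivity, ?_⟩, ?_⟩
  · rw [one_div]; exact inv_anti₀ (by norm_num) (by linarith)
  · rw [unroll_of_le, inv_inv]
    · linarith [Real.add_one_le_exp (3 + |c|), neg_abs_le c]
    · rw [one_div]; exact inv_anti₀ (by norm_num) (by linarith)

theorem exists_unroll_eq (c : ℝ) : ∃ y ∈ Ioo (0 : ℝ) 1, unroll y = c := by
  obtain ⟨y₁, h1, h1'⟩ := exists_unroll_le c
  obtain ⟨y₂, h2, h2'⟩ := exists_unroll_le (-c)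
  have hsub : Icc y₁ (1 - y₂) ⊆ Ioo 0 1 := fun y hy =>
    ⟨h1.1.trans_le hy.1, hy.2.trans_lt (by linarith [h2.1])⟩
  have hle : y₁ ≤ 1 - y₂ := by linarith [h1.2, h2.2]
  obtain ⟨y, hy, rfl⟩ := intermediate_value_Icc hle (continuousOn_unroll.mono hsub)
    (⟨h1', by rw [unroll_one_sub]; linarith⟩ : c ∈ Icc _ _)
  exact ⟨y, hsub hy, rfl⟩

/-- `unroll` as an order isomorphism from `(0, 1)` to the line. -/
noncomputable def unrollIso : Ioo (0 : ℝ) 1 ≃o ℝ :=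
  StrictMono.orderIsoOfSurjective (fun y : Ioo (0 : ℝ) 1 => unroll y)
    (fun x y hxy => strictMonoOn_unroll x.2 y.2 hxy)
    (fun c => by
      obtain ⟨y, hy, h⟩ := exists_unroll_eq c
      exact ⟨⟨y, hy⟩, h⟩)

/-- The inverse of `unroll`. -/
noncomputable def roll (c : ℝ) : ℝ := unrollIso.symm c

theorem roll_mem (c : ℝ) : roll c ∈ Ioo (0 : ℝ) 1 := (unrollIso.symm c).2

theorem unroll_roll (c : ℝ) : unroll (roll c) = c := unrollIso.apply_symm_apply c

theorem roll_eq {y c : ℝ} (hy : y ∈ Ioo (0 : ℝ) 1) (h : unroll y = c) : roll c = y :=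
  strictMonoOn_unroll.injOn (roll_mem c) hy ((unroll_roll c).trans h.symm)

theorem roll_neg (c : ℝ) : roll (-c) = 1 - roll c := by
  have h := roll_mem c
  refine roll_eq ⟨by linarith [h.2], by linarith [h.1]⟩ ?_
  rw [unroll_one_sub, unroll_roll]

theorem strictMono_roll : StrictMono roll := fun _ _ h => unrollIso.symm.strictMono h

theorem continuous_roll : Continuous roll := continuous_subtype_val.comp unrollIso.symm.continuous

/-- `unroll` as a partial homeomorphism of the line. -/
noncomputable def unrollHomeo : OpenPartialHomeomorph ℝ ℝ where
  toFun := unroll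
  invFun := roll
  source := Ioo 0 1
  target := univ
  map_source' _ _ := mem_univ _
  map_target' c _ := roll_mem c
  left_inv' _ hy := roll_eq hy rfl
  right_inv' c _ := unroll_roll c
  open_source := isOpen_Ioo
  open_target := isOpen_univ
  continuousOn_toFun := continuousOn_unroll
  continuousOn_invFun := continuous_roll.continuousOn

theorem contDiff_roll : ContDiff ℝ ∞ roll := contDiff_iff_contDiffAt.mpr fun c =>
  unrollHomeo.contDiffAt_symm_deriv (deriv_unroll_pos (roll_mem c)).ne' (mem_univ c)
    ((contDiffAt_unroll (roll_mem c)).differentiableAt (by simp)).hasDerivAt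
    (contDiffAt_unroll (roll_mem c))

open Classical in
/-- A smooth flow on the line, with support `[0, 1]`. -/
noncomputable def flow (s y : ℝ) : ℝ := if y ∈ Ioo (0 : ℝ) 1 then roll (unroll y + s) else y

theorem flow_of_mem {s y : ℝ} (hy : y ∈ Ioo (0 : ℝ) 1) : flow s y = roll (unroll y + s) :=
  if_pos hy

theorem flow_of_notMem {s y : ℝ} (hy : y ∉ Ioo (0 : ℝ) 1) : flow s y = y := if_neg hy

theorem flow_mem {s y : ℝ} (hy : y ∈ Ioo (0 : ℝ) 1) : flow s y ∈ Ioo (0 : ℝ) 1 := by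
  rw [flow_of_mem hy]; exact roll_mem _

theorem flow_zero (y : ℝ) : flow 0 y = y := by
  by_cases hy : y ∈ Ioo (0 : ℝ) 1
  · rw [flow_of_mem hy, add_zero, roll_eq hy rfl]
  · exact flow_of_notMem hy

theorem flow_flow (s r y : ℝ) : flow s (flow r y) = flow (r + s) y := by
  by_cases hy : y ∈ Ioo (0 : ℝ) 1
  · rw [flow_of_mem (flow_mem hy), flow_of_mem hy, unroll_roll, flow_of_mem hy, add_assoc]
  · rw [flow_of_notMem hy, flow_of_notMem hy, flow_of_notMem hy]

theorem lt_flow {s y : ℝ} (hs : 0 < s) (hy : y ∈ Ioo (0 : ℝ) 1) : y < flow s y := by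
  rw [flow_of_mem hy]
  conv_lhs => rw [← roll_eq hy rfl]
  exact strictMono_roll (by linarith)

theorem flow_eq_one_sub (s y : ℝ) : flow s y = 1 - flow (-s) (1 - y) := by
  by_cases hy : y ∈ Ioo (0 : ℝ) 1
  · have hy' : 1 - y ∈ Ioo (0 : ℝ) 1 := ⟨by linarith [hy.2], by linarith [hy.1]⟩
    rw [flow_of_mem hy, flow_of_mem hy', unroll_one_sub, ← neg_add, roll_neg, sub_sub_cancel]
  · have hy' : 1 - y ∉ Ioo (0 : ℝ) 1 := fun h => hy ⟨by linarith [h.2], by linarith [h.1]⟩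
    rw [flow_of_notMem hy, flow_of_notMem hy', sub_sub_cancel]

/-- Near 0 the conjugacy is -exp(1/y), so for small y > 0 the flow is y / (1 + y log(1 - s
exp(-1/y))). This formula is jointly smooth across y = 0 and reduces to y for y ≤ 0. -/
theorem contDiffAt_flow_zero (s₀ : ℝ) :
    ContDiffAt ℝ ∞ (fun p : ℝ × ℝ => flow p.1 p.2) (s₀, 0) := by
  have hE : ContDiff ℝ ∞ fun p : ℝ × ℝ => 1 - p.1 * expNegInvGlue p.2 :=
    contDiff_const.sub (contDiff_fst.mul ((expNegInvGlue.contDiff (n := ⊤)).comp contDiff_snd))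
  have e0 : 1 - s₀ * expNegInvGlue 0 = 1 := by rw [expNegInvGlue.zero]; ring
  have hL : ContDiffAt ℝ ∞ (fun p : ℝ × ℝ =>
      1 + p.2 * Real.log (1 - p.1 * expNegInvGlue p.2)) (s₀, 0) := by
    refine contDiffAt_const.add (contDiffAt_snd.mul (hE.contDiffAt.log ?_))
    simp only [e0]; exact one_ne_zero
  have e1 : 1 + (0 : ℝ) * Real.log (1 - s₀ * expNegInvGlue 0) = 1 := by ring
  have hR : ContDiffAt ℝ ∞ (fun p : ℝ × ℝ =>
      p.2 / (1 + p.2 * Real.log (1 - p.1 * expNegInvGlue p.2))) (s₀, 0) := by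
    refine contDiffAt_snd.div hL ?_
    simp only [e1]; exact one_ne_zero
  refine hR.congr_of_eventuallyEq ?_
  have v1 : ∀ᶠ p in 𝓝 (s₀, (0 : ℝ)), 0 < 1 - p.1 * expNegInvGlue p.2 :=
    hE.continuous.continuousAt.eventually_const_lt (by simp only [e0]; exact one_pos)
  have v2 : ∀ᶠ p in 𝓝 (s₀, (0 : ℝ)),
      0 < 1 + p.2 * Real.log (1 - p.1 * expNegInvGlue p.2) :=
    hL.continuousAt.eventually_const_lt (by simp only [e1]; exact one_pos)
  have v3 : ∀ᶠ p in 𝓝 (s₀, (0 : ℝ)),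
      p.2 / (1 + p.2 * Real.log (1 - p.1 * expNegInvGlue p.2)) < 1 / 3 :=
    hR.continuousAt.eventually_lt_const (by simp)
  have v4 : ∀ᶠ p in 𝓝 (s₀, (0 : ℝ)), p.2 < 1 / 3 :=
    continuousAt_snd.eventually_lt_const (by norm_num)
  filter_upwards [v1, v2, v3, v4] with p h1 h2 h3 h4
  rcases le_or_gt p.2 0 with hy | hy
  · rw [flow_of_notMem fun h => h.1.not_ge hy, expNegInvGlue.zero_of_nonpos hy]
    simp
  · rw [flow_of_mem ⟨hy, by linarith⟩]
    set z := p.2 / (1 + p.2 * Real.log (1 - p.1 * expNegInvGlue p.2)) with hz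
    have hz0 : 0 < z := div_pos hy h2
    refine roll_eq ⟨hz0, by linarith⟩ ?_
    have hinv : z⁻¹ = p.2⁻¹ + Real.log (1 - p.1 * expNegInvGlue p.2) := by
      rw [hz, inv_div]
      field_simp
    have he : Real.exp p.2⁻¹ * expNegInvGlue p.2 = 1 := by
      rw [expNegInvGlue, if_neg hy.not_ge, ← Real.exp_add, add_neg_cancel, Real.exp_zero]
    rw [unroll_of_le h3.le, unroll_of_le h4.le, hinv, Real.exp_add, Real.exp_log h1]
    linear_combination p.1 * he

theorem contDiff_flow : ContDiff ℝ ∞ fun p : ℝ × ℝ => flow p.1 p.2 := by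
  refine contDiff_iff_contDiffAt.mpr fun ⟨s, y⟩ => ?_
  rcases lt_trichotomy y 0 with hy | rfl | hy
  · refine contDiffAt_snd.congr_of_eventuallyEq ?_
    filter_upwards [(continuousAt_snd (p := (s, y))).eventually_lt_const hy] with p hp
    exact flow_of_notMem fun h => h.1.not_gt hp
  · exact contDiffAt_flow_zero s
  rcases lt_trichotomy y 1 with hy1 | rfl | hy1
  · have h1 : ContDiffAt ℝ ∞ (fun p : ℝ × ℝ => roll (unroll p.2 + p.1)) (s, y) := by
      refine contDiff_roll.contDiffAt.comp _ (ContDiffAt.add ?_ contDiffAt_fst)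
      exact ContDiffAt.comp (s, y) (contDiffAt_unroll ⟨hy, hy1⟩) contDiffAt_snd
    refine h1.congr_of_eventuallyEq ?_
    filter_upwards [(continuousAt_snd (p := (s, y))).eventually_const_lt hy,
      (continuousAt_snd (p := (s, y))).eventually_lt_const hy1] with p hp hp1
    exact flow_of_mem ⟨hp, hp1⟩
  -- The symmetry y ↦ 1 - y, which reverses time, reduces this endpoint to 0.
  · have h1 : ContDiffAt ℝ ∞ (fun p : ℝ × ℝ => 1 - flow (-p.1) (1 - p.2)) (s, 1) := by
      refine contDiffAt_const.sub ?_
      have h2 : ContDiffAt ℝ ∞ (fun p : ℝ × ℝ => (-p.1, 1 - p.2)) (s, 1) :=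
        contDiffAt_fst.neg.prodMk (contDiffAt_const.sub contDiffAt_snd)
      refine ContDiffAt.comp (s, (1 : ℝ)) (g := fun p : ℝ × ℝ => flow p.1 p.2) ?_ h2
      simp only [sub_self]
      exact contDiffAt_flow_zero (-s)
    exact h1.congr_of_eventuallyEq (Eventually.of_forall fun p => flow_eq_one_sub _ _)
  · refine contDiffAt_snd.congr_of_eventuallyEq ?_
    filter_upwards [(continuousAt_snd (p := (s, y))).eventually_const_lt hy1] with p hp
    exact flow_of_notMem fun h => h.2.not_gt hp

/-- The flow `flow` transported to the interval `[P, Q]`. -/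
noncomputable def flowOn (P Q s y : ℝ) : ℝ := P + (Q - P) * flow s ((y - P) / (Q - P))

variable {P Q : ℝ}

theorem rescale_mem_iff (hPQ : P < Q) {y : ℝ} :
    (y - P) / (Q - P) ∈ Ioo (0 : ℝ) 1 ↔ y ∈ Ioo P Q := by
  have h : 0 < Q - P := sub_pos.mpr hPQ
  rw [mem_Ioo, mem_Ioo, div_pos_iff_of_pos_right h, div_lt_one h, sub_pos, sub_lt_sub_iff_right]

theorem flowOn_of_notMem (hPQ : P < Q) {s y : ℝ} (hy : y ∉ Ioo P Q) : flowOn P Q s y = y := by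
  have h : Q - P ≠ 0 := (sub_pos.mpr hPQ).ne'
  rw [flowOn, flow_of_notMem (mt (rescale_mem_iff hPQ).mp hy), mul_div_cancel₀ _ h,
    add_sub_cancel]

theorem rescale_flowOn (hPQ : P < Q) (s y : ℝ) :
    (flowOn P Q s y - P) / (Q - P) = flow s ((y - P) / (Q - P)) := by
  have h : Q - P ≠ 0 := (sub_pos.mpr hPQ).ne'
  rw [flowOn, add_sub_cancel_left, mul_div_cancel_left₀ _ h]

theorem flowOn_mem (hPQ : P < Q) {s y : ℝ} (hy : y ∈ Ioo P Q) : flowOn P Q s y ∈ Ioo P Q := by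
  rw [← rescale_mem_iff hPQ, rescale_flowOn hPQ]
  exact flow_mem ((rescale_mem_iff hPQ).mpr hy)

theorem lt_flowOn (hPQ : P < Q) {s y : ℝ} (hs : 0 < s) (hy : y ∈ Ioo P Q) :
    y < flowOn P Q s y := by
  have h := lt_flow hs ((rescale_mem_iff hPQ).mpr hy)
  rw [← rescale_flowOn hPQ, div_lt_div_iff_of_pos_right (sub_pos.mpr hPQ)] at h
  linarith

theorem flowOn_flowOn (hPQ : P < Q) (s r y : ℝ) :
    flowOn P Q s (flowOn P Q r y) = flowOn P Q (r + s) y := by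
  rw [flowOn, rescale_flowOn hPQ, flow_flow, ← flowOn]

theorem flowOn_zero (hPQ : P < Q) (y : ℝ) : flowOn P Q 0 y = y := by
  have h : Q - P ≠ 0 := (sub_pos.mpr hPQ).ne'
  rw [flowOn, flow_zero, mul_div_cancel₀ _ h, add_sub_cancel]

theorem contDiff_flowOn : ContDiff ℝ ∞ fun p : ℝ × ℝ => flowOn P Q p.1 p.2 := by
  have h : ContDiff ℝ ∞ fun p : ℝ × ℝ => (p.1, (p.2 - P) / (Q - P)) :=
    contDiff_fst.prodMk ((contDiff_snd.sub contDiff_const).div_const _)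
  exact contDiff_const.add (contDiff_const.mul (contDiff_flow.comp h))

end IntervalFlow

/-! ### Periodic extension in the logarithmic variable -/

section Periodization

theorem log_two_pos : 0 < Real.log 2 := Real.log_pos one_lt_two

/-- The extension to all `u`, with period `log 2`, of the restriction of `N` to
`a ≤ u < a + log 2`. -/
noncomputable def periodize (a : ℝ) (N : ℝ × ℝ → ℝ) (p : ℝ × ℝ) : ℝ :=
  N (p.1, toIcoMod log_two_pos a p.2)

variable {a b : ℝ} {N : ℝ × ℝ → ℝ}

theorem periodize_eq (hab : a ≤ b) (hl : ∀ ε, ∀ v ≤ a, N (ε, v) = 0) (hr : ∀ ε v, b ≤ v → N (ε, v) = 0)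
    (ε u : ℝ) (k : ℤ) (hu : u - k * Real.log 2 ∈ Ioo (b - Real.log 2) (a + Real.log 2)) :
    periodize a N (ε, u) = N (ε, u - k * Real.log 2) := by
  rw [periodize]
  rcases le_or_gt a (u - k * Real.log 2) with h | h
  · congr 2
    exact (toIcoMod_eq_iff log_two_pos).mpr ⟨⟨h, hu.2⟩, k, by rw [zsmul_eq_mul]; ring⟩
  · have : toIcoMod log_two_pos a u = u - k * Real.log 2 + Real.log 2 := by
      refine (toIcoMod_eq_iff log_two_pos).mpr ⟨⟨by linarith [hu.1], by linarith⟩, k - 1, ?_⟩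
      rw [zsmul_eq_mul]
      push_cast
      ring
    simp only [this]
    rw [hl _ _ h.le, hr _ _ (by linarith [hu.1])]

/-- The support in the second variable is shorter than a period. So the open window (b - log 2, a +
log 2) contains a full period, and on each translate of it the extension is a single translate of
`N`; smoothness is therefore local. -/
theorem flatPeriodic_periodize (hN : ContDiff ℝ ∞ N) (hab : a ≤ b) (hba : b < a + Real.log 2)
    (hl : ∀ ε, ∀ v ≤ a, N (ε, v) = 0) (hr : ∀ ε v, b ≤ v → N (ε, v) = 0)
    (h0 : ∀ v, N (0, v) = 0) : FlatPeriodic (periodize a N) where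
  contDiff := by
    refine contDiff_iff_contDiffAt.mpr fun ⟨ε, u⟩ => ?_
    set k := toIcoDiv log_two_pos a u
    have hk : u - k * Real.log 2 ∈ Ioo (b - Real.log 2) (a + Real.log 2) := by
      have := sub_toIcoDiv_zsmul_mem_Ico log_two_pos a u
      rw [zsmul_eq_mul] at this
      exact ⟨by linarith [this.1], this.2⟩
    have h1 : ContDiff ℝ ∞ fun p : ℝ × ℝ => N (p.1, p.2 - k * Real.log 2) :=
      hN.comp (contDiff_fst.prodMk (contDiff_snd.sub contDiff_const))
    refine h1.contDiffAt.congr_of_eventuallyEq ?_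
    have hc : ContinuousAt (fun p : ℝ × ℝ => p.2 - k * Real.log 2) (ε, u) := by fun_prop
    filter_upwards [hc.eventually_mem (Ioo_mem_nhds hk.1 hk.2)] with p hp
    exact periodize_eq hab hl hr p.1 p.2 k hp
  periodic ε u := by rw [periodize, periodize, toIcoMod_add_right]
  zero u := h0 _

/-- The values of `periodize` at `log (2ᵏ y)` do not depend on `k`. -/
theorem periodize_log (hab : a ≤ b) (hl : ∀ ε, ∀ v ≤ a, N (ε, v) = 0) (hr : ∀ ε v, b ≤ v → N (ε, v) = 0)
    {y : ℝ} (hy : 0 < y) (k : ℤ)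
    (hu : Real.log y ∈ Ioo (b - Real.log 2) (a + Real.log 2)) (ε : ℝ) :
    periodize a N (ε, Real.log (2 ^ k * y)) = N (ε, Real.log y) := by
  have e : Real.log (2 ^ k * y) - k * Real.log 2 = Real.log y := by
    rw [Real.log_mul (by positivity) hy.ne', Real.log_zpow]; ring
  rw [periodize_eq hab hl hr ε _ k (by rwa [e]), e]

end Periodization

/-! ### The smooth example -/

section SmoothData

theorem log_lt_log_add {P Q : ℝ} (hP : 0 < P) (hPQ : P < Q) (hQ : Q < 2 * P) :
    Real.log Q < Real.log P + Real.log 2 := by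
  rw [← Real.log_mul hP.ne' two_ne_zero]
  exact Real.log_lt_log (hP.trans hPQ) (by linarith)

/-- The bump on `[log 4, log 7]`, equal to `1` on `[log 5, log 6]`. -/
noncomputable def logBump (v : ℝ) : ℝ :=
  Real.smoothTransition ((v - Real.log 4) / (Real.log 5 - Real.log 4)) *
    Real.smoothTransition ((Real.log 7 - v) / (Real.log 7 - Real.log 6))

theorem logBump_of_le {v : ℝ} (hv : v ≤ Real.log 4) : logBump v = 0 := by
  have h : Real.log 4 < Real.log 5 := Real.log_lt_log (by norm_num) (by norm_num)
  rw [logBump, Real.smoothTransition.zero_of_nonpos, zero_mul]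
  exact div_nonpos_of_nonpos_of_nonneg (by linarith) (by linarith)

theorem logBump_of_ge {v : ℝ} (hv : Real.log 7 ≤ v) : logBump v = 0 := by
  have h : Real.log 6 < Real.log 7 := Real.log_lt_log (by norm_num) (by norm_num)
  rw [logBump, Real.smoothTransition.zero_of_nonpos (x := (Real.log 7 - v) / _), mul_zero]
  exact div_nonpos_of_nonpos_of_nonneg (by linarith) (by linarith)

theorem logBump_of_mem {v : ℝ} (hv : v ∈ Icc (Real.log 5) (Real.log 6)) : logBump v = 1 := by
  have h1 : Real.log 4 < Real.log 5 := Real.log_lt_log (by norm_num) (by norm_num)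
  have h2 : Real.log 6 < Real.log 7 := Real.log_lt_log (by norm_num) (by norm_num)
  rw [logBump, Real.smoothTransition.one_of_one_le, Real.smoothTransition.one_of_one_le, one_mul]
  · rw [le_div_iff₀ (by linarith)]; linarith [hv.2]
  · rw [le_div_iff₀ (by linarith)]; linarith [hv.1]

theorem contDiff_logBump : ContDiff ℝ ∞ logBump := by
  have h := Real.smoothTransition.contDiff (n := ⊤)
  exact (h.comp ((contDiff_id.sub contDiff_const).div_const _)).mul
    (h.comp ((contDiff_const.sub contDiff_id).div_const _))

/-- A smooth profile which near `-∞` is the identity on the shells `2ᵏ (-4, -7/2)` and translation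
by `-1` on the shells `2ᵏ (-6, -5)`. -/
theorem exists_smooth_f : ∃ f : ℝ ≃o ℝ,
    (∀ n, radial n (coord⁻¹ * f * coord) ∈ DiffFix ∞ n) ∧
    (∀ᶠ t in atBot, t ∈ shells (7 / 2) 4 → f t = t) ∧
    ∀ᶠ t in atBot, t ∈ shells 5 6 → f t = t - 1 := by
  -- With ε = -1/t, the map t (1 + N) is t minus the bump at the logarithm of the rescaled point, so
  -- the displacement is 0 on one family of shells and exactly 1 on the other.
  set N : ℝ × ℝ → ℝ := fun p => p.1 * logBump p.2 with hN
  have hl : ∀ ε, ∀ v ≤ Real.log 4, N (ε, v) = 0 := fun ε v hv => by simp [hN, logBump_of_le hv]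
  have hr : ∀ ε v, Real.log 7 ≤ v → N (ε, v) = 0 := fun ε v hv => by simp [hN, logBump_of_ge hv]
  have hab : Real.log 4 ≤ Real.log 7 := Real.log_le_log (by norm_num) (by norm_num)
  have hba : Real.log 7 < Real.log 4 + Real.log 2 :=
    log_lt_log_add (by norm_num) (by norm_num) (by norm_num)
  have hsm : ContDiff ℝ ∞ N := contDiff_fst.mul (contDiff_logBump.comp contDiff_snd)
  obtain ⟨f, hf, hev⟩ := (flatPeriodic_periodize hsm hab hba hl hr
    (fun v => by simp [hN])).exists_profile
  have key : ∀ (P Q : ℝ), 7 / 2 ≤ P → Q < 8 → ∀ t ∈ shells P Q,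
      (∃ y, y ∈ Ioo P Q ∧ t * (1 + periodize (Real.log 4) N (-t⁻¹, Real.log (-t))) =
        t - logBump (Real.log y)) := by
    intro P Q hP hQ t ht
    obtain ⟨k, hk1, hk2⟩ := mem_iUnion.mp ht
    have hc : (0 : ℝ) < 2 ^ k := by positivity
    have hy : -t / 2 ^ k ∈ Ioo P Q := by
      rw [mem_Ioo, lt_div_iff₀ hc, div_lt_iff₀ hc]
      constructor <;> linarith
    have hy0 : 0 < -t / 2 ^ k := by linarith [hy.1]
    have ht0 : t ≠ 0 := by
      rintro rfl
      simp at hy0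
    refine ⟨_, hy, ?_⟩
    have h78 : Real.log 7 - Real.log 2 = Real.log (7 / 2) := by
      rw [Real.log_div] <;> norm_num
    have h48 : Real.log 4 + Real.log 2 = Real.log 8 := by
      rw [← Real.log_mul] <;> norm_num
    have e : -t = 2 ^ k * (-t / 2 ^ k) := by field_simp
    conv_lhs => rw [e]
    rw [periodize_log hab hl hr hy0 k ⟨?_, ?_⟩, hN]
    · field_simp
      ring
    · rw [h78]; exact Real.log_lt_log (by norm_num) (hP.trans_lt hy.1)
    · rw [h48]; exact Real.log_lt_log hy0 (hy.2.trans hQ)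
  refine ⟨f, hf, ?_, ?_⟩
  · filter_upwards [hev] with t ht hts
    obtain ⟨y, hy, e⟩ := key _ _ le_rfl (by norm_num) t hts
    rw [ht, e, logBump_of_le (Real.log_le_log (by linarith [hy.1]) hy.2.le), sub_zero]
  · filter_upwards [hev] with t ht hts
    obtain ⟨y, hy, e⟩ := key _ _ (by norm_num) (by norm_num) t hts
    rw [ht, e, logBump_of_mem ⟨Real.log_le_log (by norm_num) hy.1.le,
      Real.log_le_log (by linarith [hy.1]) hy.2.le⟩]

/-- A smooth profile `g` with support in the shells `2ᵏ (-Q, -P)` and `a g a⁻¹ = g²` near `-∞`,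
where `a` is the doubling map. -/
theorem exists_smooth_g {P Q : ℝ} (hP : 0 < P) (hPQ : P < Q) (hQ : Q < 2 * P) : ∃ g : ℝ ≃o ℝ,
    (∀ n, radial n (coord⁻¹ * g * coord) ∈ DiffFix ∞ n) ∧
    (∀ᶠ t in atBot, g t ≤ t) ∧ (∀ᶠ t in atBot, g t ≠ t ↔ t ∈ shells P Q) ∧
    ∀ᶠ t in atBot, g (g (2 * t)) = 2 * g t := by
  -- At t = -2ᵏ y, where v = log y and ε = -1/t, the product exp(v) ε equals 2⁻ᵏ. So t (1 + N) is
  -- -2ᵏ times the time-2⁻ᵏ flow of y, and ε = 0 is time 0, where N vanishes.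
  set N : ℝ × ℝ → ℝ := fun p =>
    (flowOn P Q (Real.exp p.2 * p.1) (Real.exp p.2) - Real.exp p.2) * Real.exp (-p.2) with hN
  have hQ0 : 0 < Q := hP.trans hPQ
  have hl : ∀ ε, ∀ v ≤ Real.log P, N (ε, v) = 0 := fun ε v hv => by
    have : Real.exp v ∉ Ioo P Q := fun h => by
      have := (Real.log_lt_iff_lt_exp hP).mpr h.1
      linarith
    simp [hN, flowOn_of_notMem hPQ this]
  have hr : ∀ ε v, Real.log Q ≤ v → N (ε, v) = 0 := fun ε v hv => by
    have : Real.exp v ∉ Ioo P Q := fun h => by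
      have := (Real.lt_log_iff_exp_lt hQ0).mpr h.2
      linarith
    simp [hN, flowOn_of_notMem hPQ this]
  have hab : Real.log P ≤ Real.log Q := Real.log_le_log hP hPQ.le
  have hba : Real.log Q < Real.log P + Real.log 2 := log_lt_log_add hP hPQ hQ
  have hsm : ContDiff ℝ ∞ N := by
    have h1 : ContDiff ℝ ∞ fun p : ℝ × ℝ => (Real.exp p.2 * p.1, Real.exp p.2) := by fun_prop
    have h2 := (contDiff_flowOn (P := P) (Q := Q)).comp h1
    exact (h2.sub (by fun_prop)).mul (by fun_prop)
  obtain ⟨g, hg, hev⟩ := (flatPeriodic_periodize hsm hab hba hl hr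
    (fun v => by simp [hN, flowOn_zero hPQ])).exists_profile
  have key : ∀ᶠ t in atBot, ∀ (k : ℤ) (y : ℝ), y ∈ Ico P (2 * P) → t = -(2 ^ k * y) →
      g t = -(2 ^ k * flowOn P Q ((2 : ℝ) ^ k)⁻¹ y) := by
    filter_upwards [hev] with t ht k y hy hty
    have hc : (0 : ℝ) < 2 ^ k := by positivity
    have hy0 : 0 < y := hP.trans_le hy.1
    have hlog : Real.log y ∈ Ioo (Real.log Q - Real.log 2) (Real.log P + Real.log 2) := by
      refine ⟨?_, ?_⟩
      · have := Real.log_le_log hP hy.1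
        linarith
      · rw [← Real.log_mul hP.ne' two_ne_zero, mul_comm P]
        exact Real.log_lt_log hy0 hy.2
    have e : -t = 2 ^ k * y := by rw [hty, neg_neg]
    rw [ht, e, periodize_log hab hl hr hy0 k hlog, hN]
    simp only [Real.exp_neg, Real.exp_log hy0]
    have e2 : y * -t⁻¹ = (2 ^ k)⁻¹ := by
      rw [← inv_neg, e, mul_inv, mul_comm ((2 : ℝ) ^ k)⁻¹, mul_inv_cancel_left₀ hy0.ne']
    rw [e2, hty]
    field_simp
    ring
  have hdec : ∀ t < (0 : ℝ), ∃ (k : ℤ) (y : ℝ), y ∈ Ico P (2 * P) ∧ t = -(2 ^ k * y) := by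
    intro t ht
    obtain ⟨k, h1, h2⟩ := exists_mem_Ico_zpow (div_pos (neg_pos.mpr ht) hP) (one_lt_two (α := ℝ))
    have hc : (0 : ℝ) < 2 ^ k := by positivity
    rw [le_div_iff₀ hP] at h1
    rw [zpow_add_one₀ two_ne_zero, div_lt_iff₀ hP] at h2
    refine ⟨k, -t / 2 ^ k, ⟨?_, ?_⟩, by field_simp⟩
    · rw [le_div_iff₀ hc]; linarith
    · rw [div_lt_iff₀ hc]; linarith
  have hmem : ∀ s y, y ∈ Ico P (2 * P) → flowOn P Q s y ∈ Ico P (2 * P) := by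
    intro s y hy
    by_cases h : y ∈ Ioo P Q
    · have := flowOn_mem hPQ (s := s) h
      exact ⟨this.1.le, this.2.trans hQ⟩
    · rwa [flowOn_of_notMem hPQ h]
  have hle : ∀ᶠ t in atBot, g t ≤ t := by
    filter_upwards [key, eventually_lt_atBot 0] with t ht ht0
    obtain ⟨k, y, hy, hty⟩ := hdec t ht0
    have hc : (0 : ℝ) < 2 ^ k := by positivity
    rw [ht k y hy hty, hty, neg_le_neg_iff, mul_le_mul_iff_right₀ hc]
    by_cases h : y ∈ Ioo P Q
    · exact (lt_flowOn hPQ (inv_pos.mpr hc) h).le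
    · rw [flowOn_of_notMem hPQ h]
  refine ⟨g, hg, hle, ?_, ?_⟩
  · filter_upwards [key, eventually_lt_atBot 0] with t ht ht0
    constructor
    · intro hne
      obtain ⟨k, y, hy, hty⟩ := hdec t ht0
      have hc : (0 : ℝ) < 2 ^ k := by positivity
      have h : y ∈ Ioo P Q := by
        by_contra h
        rw [ht k y hy hty, flowOn_of_notMem hPQ h] at hne
        exact hne hty.symm
      refine mem_iUnion.mpr ⟨k, ?_, ?_⟩ <;> rw [hty] <;> nlinarith [h.1, h.2]
    · intro hts hfix
      obtain ⟨k, hk1, hk2⟩ := mem_iUnion.mp hts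
      have hc : (0 : ℝ) < 2 ^ k := by positivity
      have hy : -t / 2 ^ k ∈ Ioo P Q := by
        rw [mem_Ioo, lt_div_iff₀ hc, div_lt_iff₀ hc]
        constructor <;> linarith
      have e : t = -(2 ^ k * (-t / 2 ^ k)) := by field_simp
      have h1 := ht k _ ⟨hy.1.le, hy.2.trans hQ⟩ e
      have h2 := lt_flowOn hPQ (inv_pos.mpr hc) hy
      rw [hfix] at h1
      have h3 : (2 : ℝ) ^ k * (-t / 2 ^ k) = 2 ^ k * flowOn P Q (2 ^ k)⁻¹ (-t / 2 ^ k) := by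
        linarith
      rw [← mul_left_cancel₀ hc.ne' h3] at h2
      exact lt_irrefl _ h2
  · have hdbl : Tendsto (fun t : ℝ => 2 * t) atBot atBot :=
      tendsto_id.const_mul_atBot two_pos
    filter_upwards [key, hdbl.eventually key,
      (g.tendsto_atBot.comp hdbl).eventually key, eventually_lt_atBot 0] with t h1 h2 h3 ht0
    obtain ⟨k, y, hy, hty⟩ := hdec t ht0
    have e1 : (2 : ℝ) ^ (k + 1) = 2 ^ k * 2 := zpow_add_one₀ two_ne_zero k
    have h2' := h2 (k + 1) y hy (by rw [hty, e1]; ring)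
    have h3' := h3 (k + 1) _ (hmem _ y hy) h2'
    simp only [Function.comp_apply] at h3'
    rw [h3', h1 k y hy hty, flowOn_flowOn hPQ]
    -- Doubling raises the shell index by one and halves the flow time, so two applications of `g`
    -- on the doubled shell match one on the original.
    have e2 : ((2 : ℝ) ^ (k + 1))⁻¹ + ((2 : ℝ) ^ (k + 1))⁻¹ = (2 ^ k)⁻¹ := by
      rw [e1]; field_simp; norm_num
    rw [e2, e1]
    ring

theorem exists_smooth_example {n : ℕ} (hn : 1 ≤ n) : ∃ a b f₁ f₂ g₁ g₂ : ℝ ≃o ℝ,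
      radialGroup n a b f₁ f₂ g₁ g₂ ≤ G ∞ n ∧
      (radialGroup n a b f₁ f₂ g₁ g₂).FG ∧
      TorsionFree (radialGroup n a b f₁ f₂ g₁ g₂) ∧
      GenerateBS 1 2 (rgerm n a) (rgerm n b) ∧
      rgerm n f₁ * rgerm n f₂ = rgerm n b ∧
      Commute (rgerm n g₁) (rgerm n f₁) ∧ Commute (rgerm n g₂) (rgerm n f₂) ∧
      ¬ IsRealizable (radialGroup n a b f₁ f₂ g₁ g₂) := by
  obtain ⟨f, hfs, hf₁, hfb⟩ := exists_smooth_f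
  obtain ⟨g₁, hgs₁, hle₁, hg₁, hsq₁⟩ :=
    exists_smooth_g (P := 7 / 2) (Q := 4) (by norm_num) (by norm_num) (by norm_num)
  obtain ⟨g₂, hgs₂, hle₂, hg₂, hsq₂⟩ :=
    exists_smooth_g (P := 5) (Q := 6) (by norm_num) (by norm_num) (by norm_num)
  have hf₂ : ∀ᶠ t in atBot, t ∈ shells 5 6 → (f⁻¹ * shift) t = t := by
    filter_upwards [hfb] with t ht hts
    change f.symm (shift t) = t
    rw [OrderIso.symm_apply_eq, ht hts, shift_apply]
  have hff : rgerm n f * rgerm n (f⁻¹ * shift) = rgerm n shift := by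
    rw [← rgerm_mul, mul_inv_cancel_left]
  have c₁ : Commute (rgerm n g₁) (rgerm n f) := commute_rgerm_of_disjoint (by
    filter_upwards [hg₁, hf₁] with t h1 h2 h3 using h2 (h1.mp h3))
  have c₂ : Commute (rgerm n g₂) (rgerm n (f⁻¹ * shift)) := commute_rgerm_of_disjoint (by
    filter_upwards [hg₂, hf₂] with t h1 h2 h3 using h2 (h1.mp h3))
  have csq : ∀ g : ℝ ≃o ℝ, (∀ᶠ t in atBot, g (g (2 * t)) = 2 * g t) →
      rgerm n dbl * rgerm n g = rgerm n g ^ 2 * rgerm n dbl := by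
    intro g hg
    rw [pow_two, ← rgerm_mul, ← rgerm_mul, ← rgerm_mul]
    refine rgerm_eq_of_eventuallyEq ?_
    filter_upwards [hg] with t ht
    simp only [RelIso.mul_apply, dbl_apply]
    exact ht.symm
  have hreal := not_isRealizable hn two_ne_zero hff c₁ c₂ (csq _ hsq₁) (csq _ hsq₂) hle₁ hle₂
    hg₁ hg₂ hf₁ hf₂
  have hmul : ∀ h : ℝ ≃o ℝ, rgerm n (coord⁻¹ * h * coord) =
      MulAut.conj (rgerm n coord)⁻¹ (rgerm n h) := by
    intro h
    rw [← rgermHom_apply, map_mul, map_mul, map_inv, MulAut.conj_apply, inv_inv]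
    rfl
  -- The smoothness of f₂ needs no separate estimate: it is a product of smooth radial
  -- diffeomorphisms.
  have hf₂s : radial n (coord⁻¹ * (f⁻¹ * shift) * coord) ∈ DiffFix ∞ n := by
    have e : coord⁻¹ * (f⁻¹ * shift) * coord =
        (coord⁻¹ * f * coord)⁻¹ * (coord⁻¹ * shift * coord) := by group
    have h := (DiffFix ∞ n).mul_mem ((DiffFix ∞ n).inv_mem (hfs n))
      (radial_conj_shift_mem_DiffFix (n := n))
    have h' : radial n ((coord⁻¹ * f * coord)⁻¹ * (coord⁻¹ * shift * coord)) =
        (radial n (coord⁻¹ * f * coord))⁻¹ * radial n (coord⁻¹ * shift * coord) :=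
      ((radialHom n).map_mul _ _).trans (congrArg (· * _) ((radialHom n).map_inv _))
    rw [e, h']
    exact h
  refine ⟨coord⁻¹ * dbl * coord, coord⁻¹ * shift * coord, coord⁻¹ * f * coord,
    coord⁻¹ * (f⁻¹ * shift) * coord, coord⁻¹ * g₁ * coord, coord⁻¹ * g₂ * coord,
    radialGroup_le_G radial_conj_dbl_mem_DiffFix radial_conj_shift_mem_DiffFix (hfs n) hf₂s
      (hgs₁ n) (hgs₂ n),
    radialGroup_fg _ _ _ _ _ _, torsionFree_radialGroup hn _ _ _ _ _ _, ?_, ?_, ?_, ?_, ?_⟩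
  · rw [hmul, hmul]
    exact (generateBS_rgerm hn).map (MulAut.conj (rgerm n coord)⁻¹).toMonoidHom
      (MulAut.conj (rgerm n coord)⁻¹).injective
  · rw [hmul, hmul, hmul, ← map_mul, hff]
  · rw [hmul, hmul]
    exact c₁.map _
  · rw [hmul, hmul]
    exact c₂.map _
  · intro h
    -- A realization of the smooth group would conjugate back to one of the group with standard
    -- doubling and shift.
    refine hreal (h.of_conj (radial n coord⁻¹) fun γ hγ => ?_)
    have := conj_mem_radialGroup coord⁻¹ dbl shift f (f⁻¹ * shift) g₁ g₂ hγ
    rwa [inv_inv] at this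

end SmoothData

end GermSection

theorem theorem3p1 (n : ℕ) (hn : 1 ≤ n) :
    (∃ a b f₁ f₂ g₁ g₂ : ℝ ≃o ℝ, LineData a b f₁ f₂ g₁ g₂ ∧
      radialGroup n a b f₁ f₂ g₁ g₂ ≤ G 0 n ∧
      (radialGroup n a b f₁ f₂ g₁ g₂).FG ∧
      TorsionFree (radialGroup n a b f₁ f₂ g₁ g₂) ∧
      GenerateBS 1 2 (rgerm n a) (rgerm n b) ∧
      rgerm n f₁ * rgerm n f₂ = rgerm n b ∧
      Commute (rgerm n g₁) (rgerm n f₁) ∧ Commute (rgerm n g₂) (rgerm n f₂) ∧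
      Commute (rgerm n g₁) (rgerm n a) ∧ Commute (rgerm n g₂) (rgerm n a) ∧
      ¬ IsRealizable (radialGroup n a b f₁ f₂ g₁ g₂)) ∧
    (∃ a b f₁ f₂ g₁ g₂ : ℝ ≃o ℝ,
      radialGroup n a b f₁ f₂ g₁ g₂ ≤ G ∞ n ∧
      (radialGroup n a b f₁ f₂ g₁ g₂).FG ∧
      TorsionFree (radialGroup n a b f₁ f₂ g₁ g₂) ∧
      GenerateBS 1 2 (rgerm n a) (rgerm n b) ∧
      rgerm n f₁ * rgerm n f₂ = rgerm n b ∧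
      Commute (rgerm n g₁) (rgerm n f₁) ∧ Commute (rgerm n g₂) (rgerm n f₂) ∧
      ¬ IsRealizable (radialGroup n a b f₁ f₂ g₁ g₂)) :=
  ⟨exists_continuous_example hn, exists_smooth_example hn⟩
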